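/- Let $p$ be a prime, $q=p^e$ with $e\ge 1$, and let $n\ge 1$. Let $\mathcal A_q$ be the algebra of Steenrod $q$th powers: the $\mathbb F_q$-algebra generated by $P^r$, $r\ge 0$, subject to $P^0=1$ and the Adem relations $$P^aP^b=\sum_{j=0}^{\lfloor a/q\rfloor}(-1)^{a+j}\binom{(q-1)(b-j)-1}{a-qj}P^{a+b-j}P^j\qquad(a<qb).$$ Let $P(R)=P(r_1,r_2,\ldots)$ denote its Milnor basis: $\mathcal A_q$ embeds as an algebra in the dual of the Hopf algebra $\mathbb F_q[\xi_1,\xi_2,\ldots]$ with coproduct $\xi_k\mapsto\sum_{i+j=k}\xi_i^{q^j}\otimes\xi_j$ ($\xi_0=1$), with $P^r$ sent to the dual of $\xi_1^r$, and $P(R)\in\mathcal A_q$ is the element corresponding to the dual of $\xi^R=\prod_i\xi_i^{r_i}$ with respect to the basis of monomials. Put $P^s_t=P(0,\ldots,0,p^s)$, with $p^s$ in position $t$. Let $\mathcal A_q(n-2)$ be the subalgebra of $\mathcal A_q$ generated by the elements $P^{p^i}$, $0\le i<(n-1)e$. Its May filtration is the filtration by the powers $I^k$ of its augmentation ideal $I$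 (this is also the restriction of the filtration of $\mathcal A_q$ by powers of the augmentation ideal of $\mathcal A_q$), and $E^0(\mathcal A_q(n-2))=\bigoplus_{k\ge0}I^k/I^{k+1}$. A number is called $q$-atomic if it has the form $p^s(q^t-1)/(q-1)$ with $s\ge 0$, $t\ge 1$. Then: 1. There are exactly $en(n-1)/2$ $q$-atomic numbers $a=p^s(q^t-1)/(q-1)$ with $s\ge0$, $t\ge1$ and $s/e+t<n$. For each of them $P^s_t$ lies in $\mathcal A_q(n-2)$ and in $I^t$; let $P[a]\in I^t/I^{t+1}$ be its class. 2. The $\mathbb F_q$-algebra $E^0(\mathcal A_q(n-2))$ is defined by the generators $P[a]$, one for each such degree $a$, and the relations $P[a]^p=0$ for all $a$ and, for $a>b$, $$P[a]P[b]-P[b]P[a]=\begin{cases}P[a+b]&\text{if }a+b\text{ is }q\text{-atomic and is not a power of }p,\\0&\text{otherwise.}\end{cases}$$ 3. For every fixed order of the generators $P[a]$, the monomials in the $P[a]$, taken in this order and with exponents $\le p-1$, form an $\mathbb F_q$-basis of $E^0(\mathcal A_q(n-2))$. Its dimension over $\mathbb F_q$ is $p^{en(n-1)/2}=q^{n(n-1)/2}$.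 -/

import Mathlib

open scoped TensorProduct

noncomputable section

namespace SteenrodQ

/-! ### The algebra of Steenrod `q`th powers

Throughout, `F` is a field of characteristic `p`, and `q = p ^ e`. -/

/-- The defining relations of the algebra of Steenrod `q`th powers on free generators
`P^0, P^1, P^2, …`: the relation `P^0 = 1` and the Adem relations
`P^a P^b = ∑_{j=0}^{⌊a/q⌋} (-1)^(a+j) * binom ((q-1)(b-j)-1) (a-qj) P^(a+b-j) P^j` for `a < q b`.
In this range `j < b` and `q j ≤ a`, so no subtraction is truncated. -/
inductive AdemRel (F : Type*) [Field F] (q : ℕ) : FreeAlgebra F ℕ → FreeAlgebra F ℕ → Prop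
  | zero : AdemRel F q (FreeAlgebra.ι F 0) 1
  | adem (a b : ℕ) (h : a < q * b) :
      AdemRel F q (FreeAlgebra.ι F a * FreeAlgebra.ι F b)
        (∑ j ∈ Finset.range (a / q + 1),
          ((-1 : F) ^ (a + j) * (((q - 1) * (b - j) - 1).choose (a - q * j) : F)) •
            (FreeAlgebra.ι F (a + b - j) * FreeAlgebra.ι F j))

/-- The algebra `A_q` of Steenrod `q`th powers over `F`. -/
def SteenrodAlg (F : Type*) [Field F] (q : ℕ) : Type _ := RingQuot (AdemRel F q)

instance (F : Type*) [Field F] (q : ℕ) : Ring (SteenrodAlg F q) :=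
  inferInstanceAs (Ring (RingQuot (AdemRel F q)))

instance (F : Type*) [Field F] (q : ℕ) : Algebra F (SteenrodAlg F q) :=
  inferInstanceAs (Algebra F (RingQuot (AdemRel F q)))

/-- The Steenrod power `P^r` in `A_q`. -/
def stP (F : Type*) [Field F] (q r : ℕ) : SteenrodAlg F q :=
  RingQuot.mkAlgHom F (AdemRel F q) (FreeAlgebra.ι F r)

/-- The augmentation on the free algebra: `P^0 ↦ 1` and `P^r ↦ 0` for `r > 0`. -/
def freeAug (F : Type*) [Field F] : FreeAlgebra F ℕ →ₐ[F] F :=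
  FreeAlgebra.lift F fun r => if r = 0 then 1 else 0

theorem freeAug_rel (F : Type*) [Field F] (q : ℕ) ⦃x y : FreeAlgebra F ℕ⦄
    (h : AdemRel F q x y) : freeAug F x = freeAug F y := by
  cases h with
  | zero => simp [freeAug]
  | adem a b h =>
    have hb : b ≠ 0 := by rintro rfl; simp at h
    rw [map_mul, map_sum]
    have h1 : freeAug F (FreeAlgebra.ι F b) = 0 := by simp [freeAug, hb]
    rw [h1, mul_zero]
    refine (Finset.sum_eq_zero fun j hj => ?_).symm
    have hj' : j < b := by
      have h2 : a / q < b := Nat.div_lt_of_lt_mul h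
      have := Finset.mem_range.1 hj
      omega
    have h3 : a + b - j ≠ 0 := by omega
    have h4 : freeAug F (FreeAlgebra.ι F (a + b - j)) = 0 := by
      simp only [freeAug, FreeAlgebra.lift_ι_apply, if_neg h3]
    rw [map_smul, map_mul, h4, zero_mul, smul_zero]

/-- The augmentation `A_q → F`; its kernel `A_q⁺` is the augmentation ideal. -/
def aug (F : Type*) [Field F] (q : ℕ) : SteenrodAlg F q →ₐ[F] F :=
  RingQuot.liftAlgHom F ⟨freeAug F, freeAug_rel F q⟩

/-! ### The dual Hopf algebra and the Milnor basis -/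

/-- The polynomial algebra `F[ξ_1, ξ_2, …]`, carrying Milnor's coproduct
`ξ_k ↦ ∑_{i + j = k} ξ_i ^ (q ^ j) ⊗ ξ_j` (with `ξ_0 = 1`), where `q = p ^ e`. -/
def DualSteenrod (F : Type*) [Field F] (_p _e : ℕ) : Type _ := MvPolynomial ℕ+ F

instance (F : Type*) [Field F] (p e : ℕ) : CommRing (DualSteenrod F p e) :=
  inferInstanceAs (CommRing (MvPolynomial ℕ+ F))

instance (F : Type*) [Field F] (p e : ℕ) : Algebra F (DualSteenrod F p e) :=
  inferInstanceAs (Algebra F (MvPolynomial ℕ+ F))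

/-- The generators `ξ_k`, with `ξ_0 = 1`. -/
def xi (F : Type*) [Field F] (p e : ℕ) (k : ℕ) : DualSteenrod F p e :=
  if h : 0 < k then (MvPolynomial.X (⟨k, h⟩ : ℕ+) : MvPolynomial ℕ+ F) else 1

/-- Milnor's formula for the coproduct of `ξ_k`. -/
def xiComul (F : Type*) [Field F] (p e : ℕ) (k : ℕ) :
    DualSteenrod F p e ⊗[F] DualSteenrod F p e :=
  ∑ ij ∈ Finset.HasAntidiagonal.antidiagonal k, (xi F p e ij.1 ^ (p ^ e) ^ ij.2) ⊗ₜ[F] xi F p e ij.2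

/-- The coproduct. -/
def comulHom (F : Type*) [Field F] (p e : ℕ) :
    DualSteenrod F p e →ₐ[F] DualSteenrod F p e ⊗[F] DualSteenrod F p e :=
  (MvPolynomial.aeval (fun k : ℕ+ => xiComul F p e k) :
    MvPolynomial ℕ+ F →ₐ[F] DualSteenrod F p e ⊗[F] DualSteenrod F p e)

/-- The counit, sending each `ξ_k`, `k ≥ 1`, to `0`. -/
def counitHom (F : Type*) [Field F] (p e : ℕ) : DualSteenrod F p e →ₐ[F] F :=
  (MvPolynomial.aeval (fun _ : ℕ+ => (0 : F)) : MvPolynomial ℕ+ F →ₐ[F] F)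

section Coassoc

variable (F : Type*) [Field F] (p e : ℕ)

theorem dual_algHom_ext {B : Type*} [Semiring B] [Algebra F B]
    {f g : DualSteenrod F p e →ₐ[F] B} (h : ∀ k : ℕ+, f (xi F p e k) = g (xi F p e k)) :
    f = g := by
  refine MvPolynomial.algHom_ext (R := F) (σ := ℕ+) fun k => ?_
  have h1 : xi F p e k = (MvPolynomial.X k : MvPolynomial ℕ+ F) := dif_pos k.pos
  have := h k
  rwa [h1] at this

theorem xi_zero : xi F p e 0 = 1 := by simp [xi]

theorem comulHom_xi (k : ℕ) : comulHom F p e (xi F p e k) = xiComul F p e k := by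
  rcases Nat.eq_zero_or_pos k with rfl | hk
  · rw [xi_zero, map_one]
    simp [xiComul, xi_zero, Algebra.TensorProduct.one_def]
  · have h1 : xi F p e k = (MvPolynomial.X (⟨k, hk⟩ : ℕ+) : MvPolynomial ℕ+ F) :=
      dif_pos hk
    rw [h1]
    exact MvPolynomial.aeval_X _ _

theorem counitHom_xi (k : ℕ) : counitHom F p e (xi F p e k) = if k = 0 then 1 else 0 := by
  rcases Nat.eq_zero_or_pos k with rfl | hk
  · rw [xi_zero, map_one, if_pos rfl]
  · have h1 : xi F p e k = (MvPolynomial.X (⟨k, hk⟩ : ℕ+) : MvPolynomial ℕ+ F) :=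
      dif_pos hk
    rw [h1, if_neg hk.ne']
    exact MvPolynomial.aeval_X _ _

theorem add_pow_char_pow' [Fact p.Prime] [CharP F p] {R : Type*} [CommRing R] [Algebra F R]
    (m : ℕ) (x y : R) : (x + y) ^ p ^ m = x ^ p ^ m + y ^ p ^ m := by
  obtain ⟨r, hr⟩ := exists_add_pow_prime_pow_eq (Fact.out : p.Prime) x y m
  have h0 : (p : R) = 0 := by
    rw [← map_natCast (algebraMap F R), CharP.cast_eq_zero, map_zero]
  rw [hr, h0]; simp

theorem sum_pow_char_pow' [Fact p.Prime] [CharP F p] {R ι : Type*} [CommRing R] [Algebra F R]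
    (m : ℕ) (s : Finset ι) (f : ι → R) : (∑ i ∈ s, f i) ^ p ^ m = ∑ i ∈ s, f i ^ p ^ m := by
  classical
  induction s using Finset.induction_on with
  | empty =>
    have : p ^ m ≠ 0 := pow_ne_zero _ (Fact.out : p.Prime).ne_zero
    simp only [Finset.sum_empty, zero_pow this]
  | insert a s ha ih => rw [Finset.sum_insert ha, Finset.sum_insert ha, add_pow_char_pow' F, ih]

theorem xiComul_pow [Fact p.Prime] [CharP F p] (k j : ℕ) :
    xiComul F p e k ^ (p ^ e) ^ j = ∑ il ∈ Finset.HasAntidiagonal.antidiagonal k,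
      (xi F p e il.1 ^ (p ^ e) ^ (il.2 + j)) ⊗ₜ[F] (xi F p e il.2 ^ (p ^ e) ^ j) := by
  rw [xiComul, ← pow_mul, sum_pow_char_pow' F]
  refine Finset.sum_congr rfl fun il _ => ?_
  rw [Algebra.TensorProduct.tmul_pow, ← pow_mul, pow_add, pow_mul p e j]

instance [Fact p.Prime] [CharP F p] : Bialgebra F (DualSteenrod F p e) :=
  Bialgebra.ofAlgHom (comulHom F p e) (counitHom F p e)
    (by
      refine dual_algHom_ext F p e fun k => ?_
      change Algebra.TensorProduct.assoc F F F _ _ _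
        (Algebra.TensorProduct.map (comulHom F p e) (.id F _) (comulHom F p e (xi F p e k)))
        = Algebra.TensorProduct.map (.id F _) (comulHom F p e) (comulHom F p e (xi F p e k))
      rw [comulHom_xi, xiComul]
      simp only [map_sum, Algebra.TensorProduct.map_tmul, map_pow, comulHom_xi,
        AlgHom.coe_id, id_eq]
      simp only [xiComul_pow F, TensorProduct.sum_tmul, map_sum, Algebra.TensorProduct.assoc_tmul]
      simp only [xiComul, TensorProduct.tmul_sum]
      rw [Finset.sum_sigma', Finset.sum_sigma']
      refine Finset.sum_bij' (fun x _ => ⟨(x.2.1, x.2.2 + x.1.2), (x.2.2, x.1.2)⟩)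
        (fun x _ => ⟨(x.1.1 + x.2.1, x.2.2), (x.1.1, x.2.1)⟩) ?_ ?_ ?_ ?_ ?_ <;>
        simp +contextual [Finset.mem_sigma] <;> grind)
    (by
      refine dual_algHom_ext F p e fun k => ?_
      change Algebra.TensorProduct.map (counitHom F p e) (.id F _) (comulHom F p e (xi F p e k))
        = (1 : F) ⊗ₜ[F] xi F p e k
      rw [comulHom_xi]
      simp only [xiComul, map_sum, Algebra.TensorProduct.map_tmul, map_pow, counitHom_xi,
        AlgHom.coe_id, id_eq]
      rw [Finset.sum_eq_single (0, (k : ℕ))]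
      · simp
      · rintro ⟨i, j⟩ hij hne
        have hi : i ≠ 0 := by
          rintro rfl
          simp at hij hne
          exact hne hij
        have hq : (p ^ e) ^ j ≠ 0 := pow_ne_zero _ (pow_ne_zero _ (Fact.out : p.Prime).ne_zero)
        simp only [if_neg hi, zero_pow hq, TensorProduct.zero_tmul]
      · intro h; simp at h)
    (by
      refine dual_algHom_ext F p e fun k => ?_
      change Algebra.TensorProduct.map (.id F _) (counitHom F p e) (comulHom F p e (xi F p e k))
        = xi F p e k ⊗ₜ[F] (1 : F)
      rw [comulHom_xi]
      simp only [xiComul, map_sum, Algebra.TensorProduct.map_tmul, counitHom_xi,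
        AlgHom.coe_id, id_eq]
      rw [Finset.sum_eq_single ((k : ℕ), 0)]
      · simp
      · rintro ⟨i, j⟩ hij hne
        have hj : j ≠ 0 := by
          rintro rfl
          simp at hij hne
          exact hne hij
        simp [hj]
      · intro h; simp at h)

end Coassoc

/-- The linear dual of `F[ξ_1, ξ_2, …]`, with the (convolution) product dual to the coproduct. -/
abbrev MilnorAlg (F : Type*) [Field F] (p e : ℕ) : Type _ := WithConv (DualSteenrod F p e →ₗ[F] F)

/-- The functional dual to the monomial `ξ^R = ∏ ξ_i ^ (R i)` in the basis of monomials. -/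
def dualMonomial (F : Type*) [Field F] (p e : ℕ) (R : ℕ+ →₀ ℕ) : MilnorAlg F p e :=
  WithConv.toConv (MvPolynomial.lcoeff (R := F) R : MvPolynomial ℕ+ F →ₗ[F] F)

/-- `P` is the family of Milnor basis elements `P(R) = P(r_1, r_2, …)` of `A_q`: it corresponds
to the basis dual to the monomials `ξ^R` under the embedding of `A_q` in the
dual of `F[ξ_1, ξ_2, …]` which sends `P^r` to the dual of `ξ_1 ^ r`. -/
def IsMilnorBasis {F : Type*} [Field F] (p e : ℕ) [Fact p.Prime] [CharP F p]
    (P : (ℕ+ →₀ ℕ) → SteenrodAlg F (p ^ e)) : Prop :=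
  ∃ ρ : SteenrodAlg F (p ^ e) →ₐ[F] MilnorAlg F p e,
    (∀ r : ℕ, ρ (stP F (p ^ e) r) = dualMonomial F p e (Finsupp.single 1 r)) ∧
    Function.Injective ρ ∧ ∀ R, ρ (P R) = dualMonomial F p e R

/-- There is at most one family of Milnor basis elements. -/
theorem IsMilnorBasis.unique {F : Type*} [Field F] {p e : ℕ} [Fact p.Prime] [CharP F p]
    {P P' : (ℕ+ →₀ ℕ) → SteenrodAlg F (p ^ e)} (h : IsMilnorBasis p e P)
    (h' : IsMilnorBasis p e P') : P = P' := by
  obtain ⟨ρ, h1, h2, h3⟩ := h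
  obtain ⟨ρ', h1', -, h3'⟩ := h'
  have : ρ = ρ' := by
    refine RingQuot.ringQuot_ext' (S := F) (s := AdemRel F (p ^ e)) ρ ρ'
      (FreeAlgebra.hom_ext (funext fun r => ?_))
    exact (h1 r).trans (h1' r).symm
  funext R
  apply h2
  rw [h3 R, this, h3' R]

/-- The subalgebra `A_q(n-2)` of `A_q` generated by `P^(p^i)`, `0 ≤ i < (n-1)e`. -/
def subAlg (F : Type*) [Field F] (p e n : ℕ) : Subalgebra F (SteenrodAlg F (p ^ e)) :=
  Algebra.adjoin F {x | ∃ i : ℕ, i < (n - 1) * e ∧ x = stP F (p ^ e) (p ^ i)}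

/-! ### The graded algebra of the filtration by powers of an ideal -/

section Gr

set_option linter.unusedSectionVars false

variable (F : Type*) [Field F] {A : Type*} [Ring A] [Algebra F A] (I : Ideal A) [I.IsTwoSided]

/-- The power `I ^ k` as an `F`-subspace (so `I ^ 0` is the whole algebra). -/
def powSub (k : ℕ) : Submodule F A := (I ^ k).restrictScalars F

/-- The `k`th filtration quotient `I ^ k / I ^ (k + 1)`. -/
def GrPiece (k : ℕ) : Type _ := powSub F I k ⧸ (powSub F I (k + 1)).submoduleOf (powSub F I k)

instance (k : ℕ) : AddCommGroup (GrPiece F I k) :=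
  inferInstanceAs (AddCommGroup (powSub F I k ⧸ (powSub F I (k + 1)).submoduleOf (powSub F I k)))

instance (k : ℕ) : Module F (GrPiece F I k) :=
  inferInstanceAs (Module F (powSub F I k ⧸ (powSub F I (k + 1)).submoduleOf (powSub F I k)))

/-- The quotient map `I ^ k → I ^ k / I ^ (k + 1)`. -/
def grQ (k : ℕ) : powSub F I k →ₗ[F] GrPiece F I k :=
  Submodule.mkQ ((powSub F I (k + 1)).submoduleOf (powSub F I k))

variable {I}

/-- The coset in `I ^ k / I ^ (k + 1)` of an element of `I ^ k`. -/
def grMk (k : ℕ) (x : A) (hx : x ∈ I ^ k) : GrPiece F I k := grQ F I k ⟨x, hx⟩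

theorem grMk_eq_zero {k : ℕ} {x : A} (hx : x ∈ I ^ k) : grMk F k x hx = 0 ↔ x ∈ I ^ (k + 1) :=
  Submodule.Quotient.mk_eq_zero ((powSub F I (k + 1)).submoduleOf (powSub F I k))

theorem grMk_add {k : ℕ} {x y : A} (hx : x ∈ I ^ k) (hy : y ∈ I ^ k) :
    grMk F k (x + y) (add_mem hx hy) = grMk F k x hx + grMk F k y hy :=
  map_add (grQ F I k) ⟨x, hx⟩ ⟨y, hy⟩

theorem grMk_neg {k : ℕ} {x : A} (hx : x ∈ I ^ k) :
    grMk F k (-x) (neg_mem hx) = -grMk F k x hx :=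
  map_neg (grQ F I k) ⟨x, hx⟩

theorem mul_mem_pow {i j : ℕ} {x y : A} (hx : x ∈ I ^ i) (hy : y ∈ I ^ j) :
    x * y ∈ I ^ (i + j) := by
  rw [Ideal.IsTwoSided.pow_add]
  exact Ideal.mul_mem_mul hx hy

variable (I)

/-- Multiplication `I ^ i × I ^ j → I ^ (i + j)`. -/
def powMul (i j : ℕ) : powSub F I i →ₗ[F] powSub F I j →ₗ[F] powSub F I (i + j) :=
  LinearMap.mk₂ F (fun x y => ⟨x.1 * y.1, mul_mem_pow x.2 y.2⟩)
    (fun _ _ _ => Subtype.ext (add_mul _ _ _)) (fun _ _ _ => Subtype.ext (smul_mul_assoc _ _ _))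
    (fun _ _ _ => Subtype.ext (mul_add _ _ _)) (fun _ _ _ => Subtype.ext (mul_smul_comm _ _ _))

/-- The product `(x + I ^ (i + 1)) (y + I ^ (j + 1)) = x y + I ^ (i + j + 1)`. -/
def grMul (i j : ℕ) : GrPiece F I i →ₗ[F] GrPiece F I j →ₗ[F] GrPiece F I (i + j) :=
  Submodule.liftQ ((powSub F I (i + 1)).submoduleOf (powSub F I i))
    (LinearMap.flip <| Submodule.liftQ ((powSub F I (j + 1)).submoduleOf (powSub F I j))
      (LinearMap.flip <| (powMul F I i j).compr₂ (grQ F I (i + j)))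
      (by
        intro y hy
        refine LinearMap.ext fun x => (grMk_eq_zero F (mul_mem_pow x.2 y.2)).2 ?_
        have hx : x.1 ∈ I ^ i := x.2
        have hy' : y.1 ∈ I ^ (j + 1) := hy
        have := mul_mem_pow hx hy'
        rwa [← add_assoc] at this))
    (by
      intro x hx
      refine LinearMap.ext fun b => ?_
      obtain ⟨y, rfl⟩ := Submodule.mkQ_surjective _ b
      refine (grMk_eq_zero F (mul_mem_pow x.2 y.2)).2 ?_
      have hx' : x.1 ∈ I ^ (i + 1) := hx
      have := mul_mem_pow hx' y.2
      rwa [show i + j + 1 = i + 1 + j by omega])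

variable {I}

theorem grMul_mk {i j : ℕ} {x y : A} (hx : x ∈ I ^ i) (hy : y ∈ I ^ j) :
    grMul F I i j (grMk F i x hx) (grMk F j y hy) = grMk F (i + j) (x * y) (mul_mem_pow hx hy) :=
  rfl

theorem exists_grMk {k : ℕ} (a : GrPiece F I k) : ∃ x, ∃ hx : x ∈ I ^ k, a = grMk F k x hx := by
  obtain ⟨⟨x, hx⟩, rfl⟩ := Submodule.Quotient.mk_surjective _ a
  exact ⟨x, hx, rfl⟩

theorem grMk_congr {k l : ℕ} {x y : A} (hx : x ∈ I ^ k) (hy : y ∈ I ^ l) (hkl : k = l)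
    (hxy : x = y) : (GradedMonoid.mk k (grMk F k x hx) : GradedMonoid (GrPiece F I)) =
      GradedMonoid.mk l (grMk F l y hy) := by
  subst hkl; subst hxy; rfl

theorem mem_pow_zero (x : A) : x ∈ I ^ 0 := by
  rw [Submodule.pow_zero, Ideal.one_eq_top]; trivial

instance : GradedMonoid.GMul (GrPiece F I) where
  mul a b := grMul F I _ _ a b

instance : GradedMonoid.GOne (GrPiece F I) where
  one := grMk F 0 1 (mem_pow_zero 1)

instance : DirectSum.GSemiring (GrPiece F I) where
  mul_zero a := map_zero _
  zero_mul b := LinearMap.map_zero₂ (grMul F I _ _) b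
  mul_add a b c := map_add _ _ _
  add_mul a b c := LinearMap.map_add₂ (grMul F I _ _) a b c
  one_mul := by
    rintro ⟨i, a⟩
    obtain ⟨x, hx, rfl⟩ := exists_grMk F a
    exact grMk_congr F _ _ (zero_add i) (one_mul x)
  mul_one := by
    rintro ⟨i, a⟩
    obtain ⟨x, hx, rfl⟩ := exists_grMk F a
    exact grMk_congr F _ _ (add_zero i) (mul_one x)
  mul_assoc := by
    rintro ⟨i, a⟩ ⟨j, b⟩ ⟨k, c⟩
    obtain ⟨x, hx, rfl⟩ := exists_grMk F a
    obtain ⟨y, hy, rfl⟩ := exists_grMk F b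
    obtain ⟨z, hz, rfl⟩ := exists_grMk F c
    exact grMk_congr F _ _ (add_assoc i j k) (mul_assoc x y z)
  natCast m := grMk F 0 m (mem_pow_zero _)
  natCast_zero := by
    refine (grMk_eq_zero F _).2 ?_
    rw [Nat.cast_zero]
    exact zero_mem _
  natCast_succ m := by
    simp only [Nat.cast_succ]
    exact grMk_add F (mem_pow_zero _) (mem_pow_zero _)

instance : DirectSum.GRing (GrPiece F I) where
  intCast m := grMk F 0 m (mem_pow_zero _)
  intCast_ofNat m := by simp only [Int.cast_natCast]; rfl
  intCast_negSucc_ofNat m := by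
    simp only [Int.cast_negSucc]
    exact grMk_neg F (mem_pow_zero _)

instance : DirectSum.GAlgebra F (GrPiece F I) where
  toFun :=
    { toFun := fun r => grMk F 0 (algebraMap F A r) (mem_pow_zero _)
      map_zero' := by
        refine (grMk_eq_zero F _).2 ?_
        rw [map_zero]
        exact zero_mem _
      map_add' := fun r s => by
        simp only [map_add]
        exact grMk_add F (mem_pow_zero _) (mem_pow_zero _) }
  map_one := by
    change grMk F 0 (algebraMap F A 1) _ = grMk F 0 1 _
    simp only [map_one]
  map_mul r s := grMk_congr F _ _ (zero_add 0).symm (map_mul _ r s)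
  commutes r := by
    rintro ⟨i, a⟩
    obtain ⟨x, hx, rfl⟩ := exists_grMk F a
    exact grMk_congr F _ _ ((zero_add i).trans (add_zero i).symm) (Algebra.commutes r x)
  smul_def r := by
    rintro ⟨i, a⟩
    obtain ⟨x, hx, rfl⟩ := exists_grMk F a
    refine grMk_congr F ((I ^ i).restrictScalars F |>.smul_mem r hx) _ (zero_add i).symm
      (Algebra.smul_def r x)

variable (I)

/-- The associated graded algebra `⨁ k, I ^ k / I ^ (k + 1)`. -/
abbrev Gr : Type _ := DirectSum ℕ (GrPiece F I)

variable {I}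

/-- The element of grading `k` in the associated graded algebra given by `x ∈ I ^ k`. -/
def grOf (k : ℕ) (x : A) (hx : x ∈ I ^ k) : Gr F I :=
  DirectSum.of (GrPiece F I) k (grMk F k x hx)

end Gr

/-- The augmentation ideal of `A_q(n-2)`. -/
def augIdeal (F : Type*) [Field F] (p e n : ℕ) : Ideal (subAlg F p e n) :=
  RingHom.ker ((aug F (p ^ e)).comp (subAlg F p e n).val)

instance (F : Type*) [Field F] (p e n : ℕ) : (augIdeal F p e n).IsTwoSided :=
  inferInstanceAs (RingHom.ker ((aug F (p ^ e)).comp (subAlg F p e n).val)).IsTwoSided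

/-- `E⁰(A_q(n-2))`, the graded algebra of the filtration of `A_q(n-2)` by the powers of its
augmentation ideal. -/
abbrev E0 (F : Type*) [Field F] (p e n : ℕ) : Type _ := Gr F (augIdeal F p e n)

/-! ### The presented algebra -/

/-- The number `p^s (q^t - 1) / (q - 1)`, where `q = p ^ e`. -/
def atomicNum (p e s : ℕ) (t : ℕ+) : ℕ := p ^ s * (((p ^ e) ^ (t : ℕ) - 1) / (p ^ e - 1))

/-- A number is `q`-atomic if it has the form `p^s (q^t - 1) / (q - 1)`, `s ≥ 0`, `t ≥ 1`. -/
def IsAtomic (p e a : ℕ) : Prop := ∃ (s : ℕ) (t : ℕ+), a = atomicNum p e s t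

/-- The `q`-atomic degrees `p^s (q^t - 1) / (q - 1)` with `s / e + t < n`. -/
def genDegrees (p e n : ℕ) : Set ℕ :=
  {a | ∃ (s : ℕ) (t : ℕ+), (s : ℚ) / e + (t : ℕ) < n ∧ a = atomicNum p e s t}

/-- The power relations and commutator relations on the generators `P[a]`. -/
inductive PowerCommRel (F : Type*) [Field F] (p e n : ℕ) :
    FreeAlgebra F (genDegrees p e n) → FreeAlgebra F (genDegrees p e n) → Prop
  | power (a : genDegrees p e n) : PowerCommRel F p e n (FreeAlgebra.ι F a ^ p) 0
  | comm (a b c : genDegrees p e n) (hab : (b : ℕ) < a) (hc : (c : ℕ) = a + b)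
      (hpow : ¬ ∃ i : ℕ, (a : ℕ) + b = p ^ i) :
      PowerCommRel F p e n
        (FreeAlgebra.ι F a * FreeAlgebra.ι F b - FreeAlgebra.ι F b * FreeAlgebra.ι F a)
        (FreeAlgebra.ι F c)
  | comm_zero (a b : genDegrees p e n) (hab : (b : ℕ) < a)
      (h : ¬ (IsAtomic p e (a + b) ∧ ¬ ∃ i : ℕ, (a : ℕ) + b = p ^ i)) :
      PowerCommRel F p e n
        (FreeAlgebra.ι F a * FreeAlgebra.ι F b - FreeAlgebra.ι F b * FreeAlgebra.ι F a) 0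

/-- The algebra with generators `P[a]` and the power and commutator relations. -/
abbrev PowerCommAlg (F : Type*) [Field F] (p e n : ℕ) : Type _ := RingQuot (PowerCommRel F p e n)

/-- The generator `P[a]` of the presented algebra. -/
def gen (F : Type*) [Field F] (p e n : ℕ) (a : genDegrees p e n) : PowerCommAlg F p e n :=
  RingQuot.mkAlgHom F (PowerCommRel F p e n) (FreeAlgebra.ι F a)

end SteenrodQ

end

/-! Everything is computed in the dual of F[ξ_1, ξ_2, …]. Right multiplication by the dual of ξ_t^c
is the transpose of an explicit operator `act t c`, the coefficient of X^c in the algebra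
homomorphism ξ_k ↦ ξ_k + ξ_{k-t}^(q^t) X (`mul_dualMonomial_single`). Give ξ_k^(p^s) the weight k,
and extend this to monomials through the base p digits of the exponents. Digit sums are subadditive,
and additive when the binomial coefficient is nonzero modulo p; hence `act t c` lowers weights by at
least t times the digit sum of c (`act_wt`). The functionals vanishing on small weights therefore
form a filtration in which P^s_t has filtration t. Modulo higher filtration few terms survive: the
P^s_t commute except that [P^(s+et)_u, P^s_t] ≡ P^s_(u+t) (`milP_commutator`), and their pth powers
vanish (`milP_pow_char`).

The functionals supported on the profile r_k < q^(n-k) are closed under products. Peeling off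
leading digits of exponents expresses them through products of the P^s_t, and the commutator formula
reduces P^s_t to words of length t in the P^(p^i). So on the profile the weight filtration is the
filtration by word length (`profFil_eq_wordFil`).

The Adem relations hold in the dual by a power series identity (`choose_eq_adem_sum`), which yields
the homomorphism ρ. In each degree there are at most as many admissible words as monomials ξ^R,
while the image of ρ contains every dual monomial; hence ρ is injective (`rho_injective`). It
follows that the powers of the augmentation ideal of A_q(n-2) are given by weight
(`mem_augIdeal_pow_iff`), and that the classes of the P(R), R in the profile, are linearly
independent in E⁰. This bounds the dimension from below by p^(en(n-1)/2).

For the upper bound, `isAtomic_add_iff` translates the condition for a nonzero commutator into one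
on degrees, so the presented algebra maps onto E⁰. Sorting words shows that its ordered monomials
with exponents below p span it (`span_ordered_eq_top`). The two bounds agree, so the surjection is
an isomorphism and each family of ordered monomials is a basis. -/

noncomputable section

namespace SteenrodQ

/-! ### Digit sums -/

/-- The sum of the base `p` digits of `n`. -/
def dsum (p n : ℕ) : ℕ := (Nat.digits p n).sum

section Digits

set_option linter.unusedSectionVars false

variable {p : ℕ} [hp : Fact p.Prime]

theorem dsum_zero : dsum p 0 = 0 := by simp [dsum]

/-- Kummer's theorem, from Legendre's formula applied to `(a + b)! = binom(a + b, a) a! b!`: every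
carry costs `p - 1` in the digit sum. -/
theorem dsum_add_dsum (a b : ℕ) :
    dsum p a + dsum p b = dsum p (a + b) + (p - 1) * padicValNat p ((a + b).choose a) := by
  have h (n : ℕ) : (p - 1) * padicValNat p n.factorial + dsum p n = n := by
    rw [sub_one_mul_padicValNat_factorial]
    exact Nat.sub_add_cancel (Nat.digit_sum_le p n)
  have h1 : padicValNat p (a + b).factorial = padicValNat p ((a + b).choose a) +
      padicValNat p a.factorial + padicValNat p b.factorial := by
    rw [← Nat.add_choose_mul_factorial_mul_factorial a b, padicValNat.mul, padicValNat.mul,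
      Nat.choose_symm_add] <;> simp [Nat.factorial_ne_zero, Nat.choose_eq_zero_iff]
  have h2 := h (a + b)
  rw [h1, mul_add, mul_add] at h2
  have := h a
  have := h b
  omega

theorem dsum_add_le (a b : ℕ) : dsum p (a + b) ≤ dsum p a + dsum p b := by
  rw [dsum_add_dsum]; omega

theorem dsum_add_of_choose_ne {F : Type*} [Field F] [CharP F p] {a b : ℕ}
    (h : ((a + b).choose a : F) ≠ 0) : dsum p (a + b) = dsum p a + dsum p b := by
  rw [dsum_add_dsum, padicValNat.eq_zero_of_not_dvd, mul_zero, add_zero]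
  rwa [Ne, CharP.cast_eq_zero_iff F p] at h

theorem dsum_mul (a : ℕ) : dsum p (p * a) = dsum p a := by
  rcases Nat.eq_zero_or_pos a with rfl | ha
  · simp
  · rw [dsum, ← zero_add (p * a), Nat.digits_add p hp.out.one_lt 0 a hp.out.pos (Or.inr ha.ne')]
    simp [dsum]

theorem dsum_pow_mul (m a : ℕ) : dsum p (p ^ m * a) = dsum p a := by
  induction m with
  | zero => simp
  | succ m ih => rw [pow_succ', mul_assoc, dsum_mul, ih]

theorem dsum_of_lt {a : ℕ} (h : a < p) : dsum p a = a := by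
  rcases Nat.eq_zero_or_pos a with rfl | ha
  · simp [dsum]
  · simp [dsum, Nat.digits_of_lt p a ha.ne' h]

theorem dsum_pow (m : ℕ) : dsum p (p ^ m) = 1 := by
  have := dsum_pow_mul (p := p) m 1
  rwa [mul_one, dsum_of_lt hp.out.one_lt] at this

theorem dsum_pos {a : ℕ} (h : a ≠ 0) : 0 < dsum p a := by
  rw [Nat.pos_iff_ne_zero]
  intro h0
  have h1 : ∀ d ∈ Nat.digits p a, d = 0 := by
    intro d hd
    exact Nat.eq_zero_of_le_zero ((List.single_le_sum (by simp) d hd).trans h0.le)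
  exact Nat.getLast_digit_ne_zero p h (h1 _ (List.getLast_mem (Nat.digits_ne_nil_iff_ne_zero.2 h)))

variable {F : Type*} [Field F] [CharP F p]

/-- Modulo `p`, `(1 + x)^(p^m) = 1 + x^(p^m)`, so below degree `p^m` this factor contributes only
`1`. -/
theorem cast_choose_pow_add {m c : ℕ} (hc : c < p ^ m) (T : ℕ) :
    ((p ^ m + T).choose c : F) = (T.choose c : F) := by
  rw [Nat.add_choose_eq, Nat.cast_sum, Finset.sum_eq_single (0, c)]
  · simp
  · rintro ⟨i, j⟩ hij hne
    replace hij : i + j = c := Finset.HasAntidiagonal.mem_antidiagonal.1 hij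
    have hi : i ≠ 0 := by
      rintro rfl
      exact hne (by simpa using hij)
    have : p ∣ (p ^ m).choose i := hp.out.dvd_choose_pow hi (by omega)
    rw [Nat.cast_mul, (CharP.cast_eq_zero_iff F p _).2 this, zero_mul]
  · intro h; simp at h

/-- A binomial coefficient that survives modulo `p` means subtraction without borrowing, so the
digits of `T` from position `m` on are untouched. This keeps exponents outside the profile in
`act_profile`. -/
theorem le_sub_of_choose_ne {m c T : ℕ} (hc : c < p ^ m) (hT : p ^ m ≤ T)
    (h : (T.choose c : F) ≠ 0) : p ^ m ≤ T - c := by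
  obtain ⟨T', rfl⟩ := Nat.exists_eq_add_of_le hT
  rw [cast_choose_pow_add hc] at h
  have : c ≤ T' := by
    by_contra h'
    rw [Nat.choose_eq_zero_of_lt (by omega)] at h
    simp at h
  omega

theorem cast_choose_pow_mul (m j k : ℕ) :
    (((p ^ m * j).choose (p ^ m * k) : ℕ) : F) = (j.choose k : F) := by
  induction m with
  | zero => simp
  | succ m ih =>
    rw [← ih, CharP.natCast_eq_natCast F p]
    refine (Choose.choose_modEq_choose_mod_mul_choose_div_nat (p := p)).trans ?_
    rw [pow_succ', mul_assoc, mul_assoc]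
    simp only [Nat.mul_mod_right, Nat.choose_self, one_mul, Nat.mul_div_cancel_left _ hp.out.pos]
    rfl

/-- By Lucas the binomial coefficient is the digit of `r` in position `s`, which here is the leading
one. -/
theorem cast_choose_pow_ne_zero {s r : ℕ} (h1 : p ^ s ≤ r) (h2 : r < p ^ (s + 1)) :
    (r.choose (p ^ s) : F) ≠ 0 := by
  have h0 : 0 < p ^ s := pow_pos hp.out.pos s
  have key : ∀ j m : ℕ, m < p ^ s → ((p ^ s * j + m).choose (p ^ s) : F) = (j : F) := by
    intro j m hm
    rw [Nat.add_choose_eq, Nat.cast_sum, Finset.sum_eq_single (p ^ s, 0)]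
    · have := cast_choose_pow_mul (F := F) (p := p) s j 1
      simpa using this
    · rintro ⟨i, k⟩ hik hne
      replace hik : i + k = p ^ s := Finset.HasAntidiagonal.mem_antidiagonal.1 hik
      rcases Nat.eq_zero_or_pos i with rfl | hi
      · rw [Nat.choose_eq_zero_of_lt (show m < k by omega)]; simp
      · have hk : k ≠ 0 := by rintro rfl; simp at hik; simp [hik] at hne
        have : ((p ^ s * j).choose i : F) = 0 := by
          by_contra hne'
          have hlt : i < p ^ s := by omega
          clear hik hne
          induction j with
          | zero => rw [mul_zero, Nat.choose_eq_zero_of_lt hi] at hne'; simp at hne'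
          | succ j ih =>
            rw [Nat.mul_succ, add_comm, cast_choose_pow_add hlt] at hne'
            exact ih hne'
        rw [Nat.cast_mul, this, zero_mul]
    · intro h; simp at h
  rw [← Nat.div_add_mod r (p ^ s), key _ _ (Nat.mod_lt _ h0), Ne, CharP.cast_eq_zero_iff F p]
  intro hd
  have h3 : r / p ^ s < p := Nat.div_lt_of_lt_mul (by rwa [pow_succ] at h2)
  have h4 : 0 < r / p ^ s := Nat.div_pos h1 h0
  exact absurd (Nat.le_of_dvd h4 hd) (by omega)

end Digits

/-! ### The binomial identity behind the Adem relations -/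

section Binomial

open PowerSeries

theorem coeff_one_sub_X_pow {R : Type*} [CommRing R] (m k : ℕ) :
    coeff k ((1 - X : PowerSeries R) ^ m) = (-1) ^ k * (m.choose k : R) := by
  induction m generalizing k with
  | zero => cases k <;> simp [coeff_one]
  | succ m ih =>
    have h : (1 - X : PowerSeries R) ^ (m + 1) = (1 - X) ^ m - X * (1 - X) ^ m := by ring
    rw [h, map_sub, ih]
    cases k with
    | zero => simp
    | succ k =>
      rw [coeff_succ_X_mul, ih, Nat.choose_succ_succ]
      push_cast
      ring

/-- The operator `X d/dX` multiplies the coefficient of `X^m` by `m`, so `m v^m - X (v^m)'` has no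
term in degree `m`. This is `m` times the series in question; integer coefficients allow division by
`m`. -/
theorem coeff_pow_sub_X_mul_derivative (v : PowerSeries ℤ) {m : ℕ} (hm : m ≠ 0) :
    coeff m (v ^ (m - 1) * (v - X * derivative ℤ v)) = 0 := by
  obtain ⟨n, rfl⟩ := Nat.exists_eq_succ_of_ne_zero hm
  have h0 : ((n + 1 : ℕ) : ℤ) ≠ 0 := by positivity
  have h1 : ((n + 1 : ℕ) : PowerSeries ℤ) * (v ^ n * (v - X * derivative ℤ v)) =
      ((n + 1 : ℕ) : PowerSeries ℤ) * v ^ (n + 1) - X * derivative ℤ (v ^ (n + 1)) := by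
    rw [derivative_pow, Nat.add_sub_cancel]
    ring
  have h2 := congrArg (coeff (n + 1)) h1
  have h3 (f : PowerSeries ℤ) : coeff (n + 1) (((n + 1 : ℕ) : PowerSeries ℤ) * f) =
      ((n + 1 : ℕ) : ℤ) * coeff (n + 1) f := by
    rw [← map_natCast (C (R := ℤ)), coeff_C_mul]
  rw [map_sub, h3, h3, coeff_succ_X_mul, coeff_derivative] at h2
  have h4 : ((n + 1 : ℕ) : ℤ) * coeff (n + 1) (v ^ n * (v - X * derivative ℤ v)) = 0 := by
    rw [h2]; push_cast; ring
  exact (mul_eq_zero.1 h4).resolve_left h0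

variable {F : Type*} [Field F] {p e : ℕ} [hp : Fact p.Prime] [CharP F p]

theorem one_sub_X_pow_char : (1 - X : PowerSeries F) ^ p ^ e = 1 - X ^ p ^ e := by
  have h := add_pow_char_pow' F (p := p) e (1 - X : PowerSeries F) X
  rw [sub_add_cancel, one_pow] at h
  exact eq_sub_of_add_eq h.symm

theorem exists_geom {q : ℕ} (hq : q ≠ 0) : ∃ U : PowerSeries ℤ, U * (1 - X ^ q) = 1 := by
  refine ⟨invOfUnit (1 - X ^ q) 1, ?_⟩
  rw [mul_comm, mul_invOfUnit]
  simp [hq]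

/-- Apply the preceding lemma with `m = a + 1` to `v = (1 - X^(q+1)) / (1 - X^q)` over `ℤ`. Up to
multiples of `q`, which vanish in `F`, `v - X v'` is `1 / (1 - X^q)`. The detour through `ℤ` is
needed because `a + 1` may vanish in `F`. -/
theorem coeff_geom_pow_eq_zero (he : e ≠ 0) {U : PowerSeries F} (hU : U * (1 - X ^ p ^ e) = 1)
    (a : ℕ) : coeff (a + 1) ((1 - X ^ (p ^ e + 1)) ^ a * U ^ (a + 1)) = 0 := by
  obtain ⟨q', hq'⟩ := Nat.exists_eq_succ_of_ne_zero (pow_ne_zero e hp.out.ne_zero)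
  have hqF : ((q' + 1 : ℕ) : PowerSeries F) = 0 := by
    have : ((p ^ e : ℕ) : F) = 0 := by
      rw [CharP.cast_eq_zero_iff F p]; exact dvd_pow_self p he
    rw [← map_natCast (algebraMap F (PowerSeries F)), ← Nat.succ_eq_add_one, ← hq', this, map_zero]
  rw [hq', Nat.succ_eq_add_one] at hU ⊢
  obtain ⟨V, hV⟩ := exists_geom (q := q' + 1) (by omega)
  have hVU : map (Int.castRingHom F) V = U := by
    have h1 := congrArg (map (Int.castRingHom F)) hV
    simp only [map_mul, map_sub, map_one, map_pow, map_X] at h1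
    calc _ = map (Int.castRingHom F) V * (U * (1 - X ^ (q' + 1))) := by rw [hU, mul_one]
      _ = U * (map (Int.castRingHom F) V * (1 - X ^ (q' + 1))) := by ring
      _ = U := by rw [h1, mul_one]
  set v : PowerSeries ℤ := (1 - X ^ (q' + 1 + 1)) * V with hv
  have hdV : derivative ℤ V = ((q' + 1 : ℕ) : PowerSeries ℤ) * X ^ q' * V ^ 2 := by
    have h1 := congrArg (derivative ℤ) hV
    rw [Derivation.leibniz, map_sub, derivative_pow, derivative_X, derivative_one] at h1
    simp only [smul_eq_mul, Nat.add_sub_cancel] at h1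
    linear_combination V * h1 - (derivative ℤ V) * hV
  have hdv : v - X * derivative ℤ v =
      V + ((q' + 1 : ℕ) : PowerSeries ℤ) * (X ^ (q' + 2) * V -
        X ^ (q' + 1) * (1 - X ^ (q' + 2)) * V ^ 2) := by
    rw [hv, Derivation.leibniz, map_sub, derivative_pow, derivative_X, derivative_one, hdV]
    simp only [smul_eq_mul, Nat.add_sub_cancel]
    push_cast
    ring
  have h := congrArg (Int.castRingHom F) (coeff_pow_sub_X_mul_derivative v (Nat.succ_ne_zero a))
  rw [← coeff_map, hdv, Nat.succ_eq_add_one, Nat.add_sub_cancel] at h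
  simp only [hv, map_mul, map_sub, map_one, map_pow, map_X, map_add, map_natCast, hqF, hVU,
    zero_mul, add_zero, map_zero, mul_pow] at h
  rw [← h]
  congr 1
  ring

/-- With `U = B^q`, the identity `(1 - X^(q+1)) U B = X B + U` makes these coefficients satisfy
Pascal's recursion. For `b = 0` the second term vanishes by `coeff_geom_pow_eq_zero`. -/
theorem coeff_adem (he : e ≠ 0) {B : PowerSeries F} (hB : B * (1 - X) = 1) (a b : ℕ) :
    coeff a ((1 - X ^ (p ^ e + 1)) ^ (a + b) * B ^ (p ^ e * a + b + 1)) =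
      ((a + b).choose a : F) := by
  set q := p ^ e with hq
  have hq0 : q ≠ 0 := pow_ne_zero e hp.out.ne_zero
  set U := B ^ q with hUdef
  have hU : U * (1 - X ^ q) = 1 := by
    rw [hUdef, hq, ← one_sub_X_pow_char, ← mul_pow, hB, one_pow]
  have key : (1 - X ^ (q + 1)) * (U * B) = X * B + U := by
    linear_combination (X * B) * hU + U * hB
  induction a generalizing b with
  | zero =>
    have hB0 : constantCoeff B = 1 := by
      have := congrArg constantCoeff hB
      simpa using this
    simp [hB0]
  | succ a iha =>
    induction b with
    | zero =>
      have h1 : (1 - X ^ (q + 1)) ^ (a + 1 + 0) * B ^ (q * (a + 1) + 0 + 1) =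
          X * ((1 - X ^ (q + 1)) ^ (a + 0) * B ^ (q * a + 0 + 1)) +
            (1 - X ^ (q + 1)) ^ a * U ^ (a + 1) := by
        have : (B ^ (q * a) : PowerSeries F) = U ^ a := by rw [hUdef, pow_mul]
        have h2 : (B ^ (q * (a + 1)) : PowerSeries F) = U ^ a * U := by
          rw [hUdef, pow_mul, pow_succ]
        simp only [add_zero, pow_succ, this, h2]
        linear_combination ((1 - X ^ q * X) ^ a * U ^ a) * key
      rw [h1, map_add, coeff_succ_X_mul, iha, coeff_geom_pow_eq_zero he hU]
      simp
    | succ b ihb =>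
      have h1 : (1 - X ^ (q + 1)) ^ (a + 1 + (b + 1)) * B ^ (q * (a + 1) + (b + 1) + 1) =
          X * ((1 - X ^ (q + 1)) ^ (a + (b + 1)) * B ^ (q * a + (b + 1) + 1)) +
            (1 - X ^ (q + 1)) ^ (a + 1 + b) * B ^ (q * (a + 1) + b + 1) := by
        have : (B ^ (q * a) : PowerSeries F) = U ^ a := by rw [hUdef, pow_mul]
        have h2 : (B ^ (q * (a + 1)) : PowerSeries F) = U ^ a * U := by
          rw [hUdef, pow_mul, pow_succ]
        rw [show a + 1 + (b + 1) = a + b + 1 + 1 by ring, show a + (b + 1) = a + b + 1 by ring,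
          show a + 1 + b = a + b + 1 by ring]
        generalize a + b + 1 = N
        simp only [pow_add, pow_one, this, h2]
        linear_combination ((1 - X ^ q * X) ^ N * U ^ a * B ^ b * B) * key
      rw [h1, map_add, coeff_succ_X_mul, iha, ihb]
      rw [show a + 1 + (b + 1) = a + b + 1 + 1 by ring, Nat.choose_succ_succ,
        show a + (b + 1) = a + b + 1 by ring, show a + 1 + b = a + b + 1 by ring]
      push_cast
      rfl

/-- The binomial identity modulo `p` which expresses the Adem relations on powers of `ξ_1`. -/
theorem choose_eq_adem_sum (he : e ≠ 0) {a b : ℕ} (h : a < p ^ e * b) :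
    ((a + b).choose a : F) = ∑ i ∈ Finset.range (a / p ^ e + 1),
      (-1 : F) ^ (a + i) * (((p ^ e - 1) * (b - i) - 1).choose (a - p ^ e * i) : F) *
        ((a + b).choose i : F) := by
  set q := p ^ e with hq
  have hq2 : 2 ≤ q := hp.out.two_le.trans (Nat.le_self_pow he p)
  set B : PowerSeries F := mk 1
  have hB : B * (1 - X) = 1 := mk_one_mul_one_sub_eq_one F
  have hBpow (m k : ℕ) : (1 - X : PowerSeries F) ^ (m + k) * B ^ m = (1 - X) ^ k := by
    rw [pow_add, mul_right_comm, ← mul_pow, mul_comm _ B, hB, one_pow, one_mul]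
  have hA : (1 - X ^ (q + 1) : PowerSeries F) = X ^ q * (1 - X) + (1 - X) ^ q := by
    rw [hq, one_sub_X_pow_char]; ring
  have hlt : ∀ i ∈ Finset.range (a / q + 1), q * i ≤ a ∧ i < b := by
    intro i hi
    have h1 : i ≤ a / q := by simpa [Nat.lt_succ_iff] using hi
    have h2 := (Nat.mul_le_mul_left q h1).trans (Nat.mul_div_le a q)
    exact ⟨h2, lt_of_mul_lt_mul_left (h2.trans_lt h) (Nat.zero_le q)⟩
  -- Expanding the power of `1 - X^(q+1)` binomially by `hA`, the `i`th term becomes `X^(q i)` times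
  -- a power of `1 - X`. Its coefficient at `X^a` is the `i`th Adem summand, and terms with `q i >
  -- a` contribute nothing.
  rw [← coeff_adem he hB a b, ← hq, hA, add_pow, Finset.sum_mul, map_sum]
  have hsub : Finset.range (a / q + 1) ⊆ Finset.range (a + b + 1) := by
    intro i hi
    have := (hlt i hi).2
    simp; omega
  rw [← Finset.sum_subset hsub]
  · refine Finset.sum_congr rfl fun i hi => ?_
    obtain ⟨h1, h2⟩ := hlt i hi
    have hexp : i + q * (a + b - i) = (q * a + b + 1) + ((q - 1) * (b - i) - 1) := by
      obtain ⟨c, rfl⟩ := Nat.exists_eq_add_of_lt h2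
      obtain ⟨r, hr⟩ : ∃ r, q = r + 2 := ⟨q - 2, by omega⟩
      rw [show a + (i + c + 1) - i = a + (c + 1) by omega, show i + c + 1 - i = c + 1 by omega, hr,
        show (r + 2 - 1) * (c + 1) - 1 = (r + 1) * (c + 1) - 1 by rfl]
      have : (r + 1) * (c + 1) = (r * c + r + c) + 1 := by ring
      rw [this, Nat.add_sub_cancel]
      ring
    have h3 : (X ^ q * (1 - X)) ^ i * ((1 - X) ^ q) ^ (a + b - i) *
        ((a + b).choose i : PowerSeries F) * B ^ (q * a + b + 1) = X ^ (q * i) * (C ((a + b).choose i : F) *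
          (1 - X) ^ ((q - 1) * (b - i) - 1)) := by
      rw [← hBpow (q * a + b + 1) ((q - 1) * (b - i) - 1), ← hexp, map_natCast,
        pow_add (1 - X), pow_mul (1 - X), pow_mul X, mul_pow]
      ring
    rw [h3, coeff_X_pow_mul', if_pos h1, coeff_C_mul, coeff_one_sub_X_pow]
    -- The exponents differ by `(q + 1) i`, and `(-1)^(q + 1) = 1` in characteristic `p`, including
    -- `p = 2`.
    have hs : (-1 : F) ^ (a + i) = (-1) ^ (a - q * i) := by
      have hm : (-1 : F) ^ (q + 1) = 1 := by
        rcases hp.out.eq_two_or_odd' with h2 | hodd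
        · subst h2
          have : (2 : F) = 0 := by
            have := CharP.cast_eq_zero F 2
            exact_mod_cast this
          have : (-1 : F) = 1 := by linear_combination -this
          rw [this, one_pow]
        · exact (Odd.add_one (hodd.pow)).neg_one_pow
      have : a + i = (a - q * i) + (q + 1) * i := by
        have : (q + 1) * i = q * i + i := by ring
        omega
      rw [this, pow_add, pow_mul, hm, one_pow, mul_one]
    rw [hs]
    ring
  · intro i _ hi
    have h1 : ¬ q * i ≤ a := by
      intro h1
      apply hi
      have : i ≤ a / q := (Nat.le_div_iff_mul_le (by omega)).2 (by rwa [mul_comm])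
      simp; omega
    rw [mul_pow, ← pow_mul, mul_assoc, mul_assoc, mul_assoc, coeff_X_pow_mul', if_neg h1]

end Binomial

/-! ### Monomials in the dual algebra -/

section Monomials

set_option linter.unusedSectionVars false

variable (F : Type*) [Field F] (p e : ℕ)

/-- The monomial `ξ^R`. -/
def mon (R : ℕ+ →₀ ℕ) : DualSteenrod F p e := (MvPolynomial.monomial R 1 : MvPolynomial ℕ+ F)

/-- The coefficient of `ξ^R`. -/
def coef (R : ℕ+ →₀ ℕ) : DualSteenrod F p e →ₗ[F] F :=
  (MvPolynomial.lcoeff (R := F) R : MvPolynomial ℕ+ F →ₗ[F] F)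

theorem ofConv_dualMonomial (R : ℕ+ →₀ ℕ) : (dualMonomial F p e R).ofConv = coef F p e R := rfl

theorem coef_mon (R S : ℕ+ →₀ ℕ) : coef F p e R (mon F p e S) = if S = R then 1 else 0 :=
  MvPolynomial.coeff_monomial R S (1 : F)

theorem mon_zero : mon F p e 0 = 1 := rfl

theorem mon_add (R S : ℕ+ →₀ ℕ) : mon F p e (R + S) = mon F p e R * mon F p e S := by
  have := MvPolynomial.monomial_mul (s := R) (s' := S) (a := (1 : F)) (b := 1)
  rw [one_mul] at this
  exact this.symm

/-- The exponent sequence of `ξ_k ^ m`, where `ξ_0 = 1`. -/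
def sg (k m : ℕ) : ℕ+ →₀ ℕ := if h : 0 < k then Finsupp.single ⟨k, h⟩ m else 0

theorem sg_pnat (k : ℕ+) (m : ℕ) : sg k m = Finsupp.single k m := dif_pos k.pos

theorem sg_zero_left (m : ℕ) : sg 0 m = 0 := rfl

theorem sg_zero_right (k : ℕ) : sg k 0 = 0 := by
  unfold sg
  split_ifs
  · exact Finsupp.single_zero _
  · rfl

theorem mon_sg (k m : ℕ) : mon F p e (sg k m) = xi F p e k ^ m := by
  rcases Nat.eq_zero_or_pos k with rfl | hk
  · rw [xi_zero, one_pow, sg_zero_left, mon_zero]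
  · have h1 : xi F p e k = (MvPolynomial.X (⟨k, hk⟩ : ℕ+) : MvPolynomial ℕ+ F) := dif_pos hk
    rw [h1, sg, dif_pos hk]
    exact MvPolynomial.X_pow_eq_monomial.symm

theorem mon_single (k : ℕ+) (m : ℕ) : mon F p e (Finsupp.single k m) = xi F p e k ^ m := by
  rw [← sg_pnat, mon_sg]

variable {F p e}

theorem dual_lin_ext {V : Type*} [AddCommMonoid V] [Module F V] {f g : DualSteenrod F p e →ₗ[F] V}
    (h : ∀ R, f (mon F p e R) = g (mon F p e R)) : f = g := by
  refine MvPolynomial.linearMap_ext (R := F) (σ := ℕ+) fun R => LinearMap.ext_ring ?_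
  exact h R

theorem milnor_ext {f g : MilnorAlg F p e}
    (h : ∀ R, f.ofConv (mon F p e R) = g.ofConv (mon F p e R)) : f = g :=
  WithConv.ext (dual_lin_ext h)

theorem mem_span_mon {E : Set (ℕ+ →₀ ℕ)} {x : DualSteenrod F p e} :
    x ∈ Submodule.span F (mon F p e '' E) ↔ ∀ R, coef F p e R x ≠ 0 → R ∈ E := by
  have := Finsupp.mem_supported (R := F) (s := E) (M := F)
  constructor
  · intro hx R
    induction hx using Submodule.span_induction with
    | mem x hx =>
      obtain ⟨S, hS, rfl⟩ := hx
      rw [coef_mon]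
      split_ifs with h
      · subst h; exact fun _ => hS
      · simp
    | zero => simp
    | add x y _ _ hx hy =>
      intro h
      by_cases h1 : coef F p e R x = 0
      · exact hy (by rwa [map_add, h1, zero_add] at h)
      · exact hx h1
    | smul c x _ hx =>
      intro h
      refine hx fun h1 => h ?_
      rw [map_smul, h1, smul_zero]
  · intro h
    have hx := MvPolynomial.support_sum_monomial_coeff (R := F) (σ := ℕ+) x
    have h2 : x = ∑ R ∈ MvPolynomial.support (R := F) (σ := ℕ+) x,
        coef F p e R x • mon F p e R := by
      conv_lhs => rw [← hx]
      refine Finset.sum_congr rfl fun R _ => ?_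
      have := MvPolynomial.smul_monomial (R := F) (s := R) (a := (1 : F)) (coef F p e R x)
      rw [smul_eq_mul, mul_one] at this
      exact this.symm
    rw [h2]
    refine Submodule.sum_mem _ fun R hR => Submodule.smul_mem _ _ (Submodule.subset_span ?_)
    exact ⟨R, h R (MvPolynomial.mem_support_iff.1 hR), rfl⟩

end Monomials

/-! ### The action of the dual of `ξ_t ^ c` -/

section Action

set_option linter.unusedSectionVars false

variable (F : Type*) [Field F] (p e : ℕ)

/-- The algebra homomorphism `ξ_k ↦ ξ_k + ξ_{k-t} ^ (q ^ t) X`. -/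
def theta (t : ℕ+) : DualSteenrod F p e →ₐ[F] Polynomial (DualSteenrod F p e) :=
  (MvPolynomial.aeval fun k : ℕ+ => Polynomial.C (xi F p e k) +
    if (t : ℕ) ≤ k then Polynomial.C (xi F p e (k - t) ^ (p ^ e) ^ (t : ℕ)) * Polynomial.X else 0 :
    MvPolynomial ℕ+ F →ₐ[F] Polynomial (DualSteenrod F p e))

/-- The coefficient of `X ^ c` in `theta t`. -/
def act (t : ℕ+) (c : ℕ) : DualSteenrod F p e →ₗ[F] DualSteenrod F p e :=
  ((Polynomial.lcoeff (DualSteenrod F p e) c).restrictScalars F) ∘ₗ (theta F p e t).toLinearMap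

theorem act_apply (t : ℕ+) (c : ℕ) (x : DualSteenrod F p e) :
    act F p e t c x = (theta F p e t x).coeff c := rfl

theorem theta_xi (t : ℕ+) (k : ℕ) : theta F p e t (xi F p e k) = Polynomial.C (xi F p e k) +
    if (t : ℕ) ≤ k then Polynomial.C (xi F p e (k - t) ^ (p ^ e) ^ (t : ℕ)) * Polynomial.X
    else 0 := by
  rcases Nat.eq_zero_or_pos k with rfl | hk
  · have : ¬ (t : ℕ) ≤ 0 := by have := t.pos; omega
    rw [xi_zero, map_one, map_one, if_neg this, add_zero]
  · have h1 : xi F p e k = (MvPolynomial.X (⟨k, hk⟩ : ℕ+) : MvPolynomial ℕ+ F) := dif_pos hk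
    rw [h1]
    refine (MvPolynomial.aeval_X _ _).trans ?_
    rw [← h1]
    rfl

/-- The algebra homomorphism `ξ_t ↦ X`, `ξ_k ↦ 0` for `k ≠ t`. -/
def xiEval (t : ℕ+) : DualSteenrod F p e →ₐ[F] Polynomial (DualSteenrod F p e) :=
  (MvPolynomial.aeval fun k : ℕ+ => if k = t then Polynomial.X else 0 :
    MvPolynomial ℕ+ F →ₐ[F] Polynomial (DualSteenrod F p e))

theorem xiEval_xi (t : ℕ+) (k : ℕ) : xiEval F p e t (xi F p e k) =
    if k = 0 then 1 else if k = t then Polynomial.X else 0 := by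
  rcases Nat.eq_zero_or_pos k with rfl | hk
  · simp [xi_zero]
  · obtain ⟨k, rfl⟩ : ∃ k' : ℕ+, (k' : ℕ) = k := ⟨⟨k, hk⟩, rfl⟩
    have h1 : xi F p e k = (MvPolynomial.X k : MvPolynomial ℕ+ F) := dif_pos hk
    rw [h1, if_neg hk.ne']
    refine (MvPolynomial.aeval_X _ _).trans ?_
    simp only [PNat.coe_inj]

theorem xiEval_mon (t : ℕ+) (R : ℕ+ →₀ ℕ) :
    xiEval F p e t (mon F p e R) =
      if R = Finsupp.single t (R t) then Polynomial.X ^ R t else 0 := by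
  induction R using Finsupp.induction with
  | zero => simp [mon_zero]
  | single_add k r R hk hr ih =>
    rw [mon_add, map_mul, ih, mon_single, map_pow, xiEval_xi, if_neg k.pos.ne']
    have hRk : R k = 0 := by simpa using hk
    by_cases hkt : k = t
    · subst hkt
      rw [if_pos rfl]
      by_cases hR : R = 0
      · subst hR; simp
      · have h1 : R ≠ Finsupp.single k (R k) := by rwa [hRk, Finsupp.single_zero]
        have h2 : Finsupp.single k r + R ≠ Finsupp.single k ((Finsupp.single k r + R) k) := by
          simpa [hRk] using hR
        rw [if_neg h1, if_neg h2, mul_zero]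
    · have h1 : (k : ℕ) ≠ t := fun h => hkt (PNat.coe_inj.1 h)
      have h2 : Finsupp.single k r + R ≠ Finsupp.single t ((Finsupp.single k r + R) t) := by
        intro h
        have := DFunLike.congr_fun h k
        simp [hRk, hr, Ne.symm hkt] at this
      rw [if_neg h1, if_neg h2, zero_pow hr, zero_mul]

/-- The functionals dual to the powers of `ξ_t` thus have a multiplicative generating function,
which turns convolution with all of them at once into an algebra homomorphism. -/
theorem coeff_xiEval (t : ℕ+) (c : ℕ) (y : DualSteenrod F p e) :
    (xiEval F p e t y).coeff c =
      algebraMap F (DualSteenrod F p e) (coef F p e (Finsupp.single t c) y) := by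
  have h : ((Polynomial.lcoeff (DualSteenrod F p e) c).restrictScalars F) ∘ₗ
      (xiEval F p e t).toLinearMap =
      (Algebra.linearMap F (DualSteenrod F p e)) ∘ₗ coef F p e (Finsupp.single t c) := by
    refine dual_lin_ext fun R => ?_
    change (xiEval F p e t (mon F p e R)).coeff c =
      algebraMap F (DualSteenrod F p e) (coef F p e (Finsupp.single t c) (mon F p e R))
    rw [xiEval_mon, coef_mon]
    by_cases h : R = Finsupp.single t (R t)
    · rw [if_pos h, Polynomial.coeff_X_pow]
      by_cases hc : c = R t
      · rw [if_pos hc, if_pos (by rw [hc, ← h]), map_one]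
      · rw [if_neg hc, if_neg, map_zero]
        intro h2
        rw [h2] at hc
        simp at hc
    · rw [if_neg h, if_neg, map_zero, Polynomial.coeff_zero]
      rintro rfl
      simp at h
  exact LinearMap.congr_fun h y

variable [Fact p.Prime] [CharP F p]

/-- Generators suffice, and in the coproduct of `ξ_k` only the summands with right factor `1` or
`ξ_t` survive `xiEval`. -/
theorem productMap_comul (t : ℕ+) (x : DualSteenrod F p e) :
    Algebra.TensorProduct.productMap (Polynomial.CAlgHom (R := F) (A := DualSteenrod F p e))
      (xiEval F p e t) (comulHom F p e x) = theta F p e t x := by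
  have h : (Algebra.TensorProduct.productMap
      (Polynomial.CAlgHom (R := F) (A := DualSteenrod F p e)) (xiEval F p e t)).comp
      (comulHom F p e) = theta F p e t := by
    refine dual_algHom_ext F p e fun k => ?_
    rw [AlgHom.comp_apply, comulHom_xi, theta_xi, xiComul, map_sum]
    simp only [Algebra.TensorProduct.productMap_apply_tmul, xiEval_xi]
    have hne : ((k : ℕ), 0) ∈ Finset.HasAntidiagonal.antidiagonal (k : ℕ) := by simp
    rw [← Finset.add_sum_erase _ _ hne]
    congr 1
    · simp
    · by_cases ht : (t : ℕ) ≤ k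
      · rw [if_pos ht, Finset.sum_eq_single ((k : ℕ) - t, (t : ℕ))]
        · simp
        · rintro ⟨i, j⟩ hij hn
          simp only [Finset.mem_erase, Finset.HasAntidiagonal.mem_antidiagonal, ne_eq,
            Prod.mk.injEq] at hij hn
          rw [if_neg (by omega), if_neg (by omega), mul_zero]
        · intro h
          have := t.pos
          simp only [Finset.mem_erase, Finset.HasAntidiagonal.mem_antidiagonal, ne_eq,
            Prod.mk.injEq] at h
          omega
      · rw [if_neg ht]
        refine Finset.sum_eq_zero ?_
        rintro ⟨i, j⟩ hij
        simp only [Finset.mem_erase, Finset.HasAntidiagonal.mem_antidiagonal, ne_eq,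
            Prod.mk.injEq] at hij
        rw [if_neg (by omega), if_neg (by omega), mul_zero]
  exact DFunLike.congr_fun h x

/-- Right multiplication by the dual of `ξ_t ^ c` is precomposition with `act t c`. -/
theorem mul_dualMonomial_single (f : MilnorAlg F p e) (t : ℕ+) (c : ℕ) :
    f * dualMonomial F p e (Finsupp.single t c) =
      WithConv.toConv (f.ofConv ∘ₗ act F p e t c) := by
  refine WithConv.ext (LinearMap.ext fun x => ?_)
  change LinearMap.mul' F F (TensorProduct.map f.ofConv (coef F p e (Finsupp.single t c))
    (comulHom F p e x)) = f.ofConv (act F p e t c x)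
  rw [act_apply, ← productMap_comul]
  induction comulHom F p e x using TensorProduct.induction_on with
  | zero => simp
  | tmul y z =>
    rw [Algebra.TensorProduct.productMap_apply_tmul, TensorProduct.map_tmul,
      LinearMap.mul'_apply]
    change _ = f.ofConv ((Polynomial.C y * _).coeff c)
    rw [Polynomial.coeff_C_mul, coeff_xiEval, mul_comm y, ← Algebra.smul_def, map_smul,
      smul_eq_mul, mul_comm]
  | add y z hy hz => rw [map_add, map_add, hy, hz, map_add, Polynomial.coeff_add, map_add]

theorem act_mul (t : ℕ+) (c : ℕ) (x y : DualSteenrod F p e) :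
    act F p e t c (x * y) = ∑ ij ∈ Finset.HasAntidiagonal.antidiagonal c,
      act F p e t ij.1 x * act F p e t ij.2 y := by
  simp only [act_apply, map_mul, Polynomial.coeff_mul]

/-- Binomial expansion of `(ξ_k + ξ_{k-t}^(q^t) X)^r`. For `k = t` the new factor is a power of `ξ_0
= 1`, in accordance with `sg 0 _ = 0`. -/
theorem act_single (t k : ℕ+) (c r : ℕ) : act F p e t c (mon F p e (Finsupp.single k r)) =
    if (t : ℕ) ≤ k then (r.choose c : F) •
      mon F p e (Finsupp.single k (r - c) + sg (k - t) ((p ^ e) ^ (t : ℕ) * c))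
    else if c = 0 then mon F p e (Finsupp.single k r) else 0 := by
  rw [act_apply, mon_single, map_pow, theta_xi]
  by_cases h : (t : ℕ) ≤ k
  · rw [if_pos h, if_pos h, add_comm, add_pow, Polynomial.finsetSum_coeff]
    have (i : ℕ) : ((Polynomial.C (xi F p e (k - t) ^ (p ^ e) ^ (t : ℕ)) * Polynomial.X) ^ i *
        Polynomial.C (xi F p e k) ^ (r - i) * (r.choose i : Polynomial (DualSteenrod F p e))).coeff
          c = if c = i then (xi F p e (k - t) ^ (p ^ e) ^ (t : ℕ)) ^ i * xi F p e k ^ (r - i) *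
            (r.choose i : DualSteenrod F p e) else 0 := by
      have h1 (a b m : Polynomial (DualSteenrod F p e)) (j : ℕ) :
          (a * Polynomial.X) ^ j * b * m = a ^ j * b * m * Polynomial.X ^ j := by ring
      rw [h1, ← Polynomial.C_pow, ← Polynomial.C_pow,
        ← map_natCast (Polynomial.C (R := DualSteenrod F p e)), ← Polynomial.C_mul,
        ← Polynomial.C_mul, Polynomial.coeff_C_mul, Polynomial.coeff_X_pow, mul_ite, mul_one,
        mul_zero]
    simp only [this]
    rw [Finset.sum_ite_eq (Finset.range (r + 1)) c]
    have hfin : (r.choose c : F) • mon F p e (Finsupp.single k (r - c) +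
        sg (k - t) ((p ^ e) ^ (t : ℕ) * c)) = (xi F p e (k - t) ^ (p ^ e) ^ (t : ℕ)) ^ c *
          xi F p e k ^ (r - c) * (r.choose c : DualSteenrod F p e) := by
      rw [mon_add, mon_single, mon_sg, Algebra.smul_def, map_natCast, pow_mul]
      ring
    rw [hfin]
    split_ifs with hc
    · rfl
    · rw [Nat.choose_eq_zero_of_lt (by simpa using hc)]; simp
  · rw [if_neg h, if_neg h, add_zero, ← Polynomial.C_pow, Polynomial.coeff_C]

/-- The monomials which occur in `act t c (ξ^T)` belong to `E T c`, if `E` is compatible with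
products of monomials and holds for powers of the `ξ_k`. -/
theorem act_mem_span (t : ℕ+) (E : (ℕ+ →₀ ℕ) → ℕ → Set (ℕ+ →₀ ℕ)) (h0 : 0 ∈ E 0 0)
    (hlt : ∀ k r, 0 < r → k < t → Finsupp.single k r ∈ E (Finsupp.single k r) 0)
    (hle : ∀ (k : ℕ+) r c, 0 < r → (t : ℕ) ≤ k → (r.choose c : F) ≠ 0 →
      Finsupp.single k (r - c) + sg (k - t) ((p ^ e) ^ (t : ℕ) * c) ∈ E (Finsupp.single k r) c)
    (hadd : ∀ k r T c c' S S', 0 < r → T k = 0 → S ∈ E (Finsupp.single k r) c → S' ∈ E T c' →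
      S + S' ∈ E (Finsupp.single k r + T) (c + c')) (T : ℕ+ →₀ ℕ) (c : ℕ) :
    act F p e t c (mon F p e T) ∈ Submodule.span F (mon F p e '' E T c) := by
  induction T using Finsupp.induction generalizing c with
  | zero =>
    rw [mon_zero, act_apply, map_one, Polynomial.coeff_one]
    split_ifs with hc
    · subst hc
      exact Submodule.subset_span ⟨0, h0, mon_zero F p e⟩
    · exact zero_mem _
  | single_add k r T hk hr ih =>
    rw [mon_add, act_mul]
    refine Submodule.sum_mem _ ?_
    rintro ⟨c1, c2⟩ hc
    rw [Finset.HasAntidiagonal.mem_antidiagonal] at hc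
    dsimp only at hc ⊢
    subst hc
    have h1 : act F p e t c1 (mon F p e (Finsupp.single k r)) ∈
        Submodule.span F (mon F p e '' E (Finsupp.single k r) c1) := by
      rw [act_single]
      split_ifs with h2 h3
      · by_cases hz : (r.choose c1 : F) = 0
        · rw [hz, zero_smul]; exact zero_mem _
        · exact Submodule.smul_mem _ _ (Submodule.subset_span
            ⟨_, hle k r c1 (Nat.pos_of_ne_zero hr) h2 hz, rfl⟩)
      · subst h3
        exact Submodule.subset_span ⟨_, hlt k r (Nat.pos_of_ne_zero hr) (not_le.1 h2), rfl⟩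
      · exact zero_mem _
    have h2 := Submodule.mul_mem_mul h1 (ih c2)
    rw [Submodule.span_mul_span] at h2
    refine Submodule.span_mono ?_ h2
    rintro _ ⟨_, ⟨S, hS, rfl⟩, _, ⟨S', hS', rfl⟩, rfl⟩
    exact ⟨S + S', hadd k r T c1 c2 S S' (Nat.pos_of_ne_zero hr) (by simpa using hk) hS hS',
      mon_add F p e S S'⟩

end Action

/-! ### Weight, degree and profile of exponent sequences -/

section Weights

set_option linter.unusedSectionVars false

/-- The weight of `ξ^R`, in which `ξ_k ^ (p ^ s)` has weight `k`. -/
def wt (p : ℕ) (R : ℕ+ →₀ ℕ) : ℕ := R.sum fun k r => (k : ℕ) * dsum p r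

/-- The number `1 + q + ⋯ + q ^ (k - 1)`. -/
def brk (q k : ℕ) : ℕ := ∑ i ∈ Finset.range k, q ^ i

/-- The degree of `ξ^R`, in which `ξ_k` has degree `1 + q + ⋯ + q ^ (k - 1)`. -/
def deg (q : ℕ) (R : ℕ+ →₀ ℕ) : ℕ := R.sum fun k r => brk q k * r

/-- The exponent sequences of the monomials outside the ideal generated by
the `ξ_k ^ (q ^ (n - k))`. -/
def InProfile (p e n : ℕ) (R : ℕ+ →₀ ℕ) : Prop := ∀ k : ℕ+, R k < p ^ (e * (n - k))

variable {p : ℕ} [hp : Fact p.Prime]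

theorem wt_zero : wt p 0 = 0 := Finsupp.sum_zero_index

theorem wt_single (k : ℕ+) (r : ℕ) : wt p (Finsupp.single k r) = k * dsum p r :=
  Finsupp.sum_single_index (by simp [dsum_zero])

theorem wt_sg (k r : ℕ) : wt p (sg k r) = k * dsum p r := by
  rcases Nat.eq_zero_or_pos k with rfl | hk
  · rw [sg_zero_left, wt_zero, zero_mul]
  · obtain ⟨k, rfl⟩ : ∃ k' : ℕ+, (k' : ℕ) = k := ⟨⟨k, hk⟩, rfl⟩
    rw [sg_pnat, wt_single]

theorem wt_eq_sum {R : ℕ+ →₀ ℕ} {s : Finset ℕ+} (hs : R.support ⊆ s) :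
    wt p R = ∑ k ∈ s, (k : ℕ) * dsum p (R k) :=
  Finsupp.sum_of_support_subset _ hs _ (by simp [dsum_zero])

theorem wt_add_le (R S : ℕ+ →₀ ℕ) : wt p (R + S) ≤ wt p R + wt p S := by
  classical
  rw [wt_eq_sum (Finsupp.support_add : (R + S).support ⊆ R.support ∪ S.support),
    wt_eq_sum (Finset.subset_union_left : R.support ⊆ R.support ∪ S.support),
    wt_eq_sum (Finset.subset_union_right : S.support ⊆ R.support ∪ S.support),
    ← Finset.sum_add_distrib]
  refine Finset.sum_le_sum fun k _ => ?_
  rw [← mul_add]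
  exact Nat.mul_le_mul_left _ (dsum_add_le _ _)

theorem wt_single_add {k : ℕ+} {r : ℕ} {T : ℕ+ →₀ ℕ} (h : T k = 0) :
    wt p (Finsupp.single k r + T) = k * dsum p r + wt p T := by
  rw [← wt_single]
  refine Finsupp.sum_add_index_of_disjoint ?_ _
  rw [Finset.disjoint_left]
  intro j hj hT
  have : j = k := by
    by_contra hne
    simp [Ne.symm hne] at hj
  subst this
  simp [h] at hT

theorem wt_pos {R : ℕ+ →₀ ℕ} (h : R ≠ 0) : 0 < wt p R := by
  obtain ⟨k, hk⟩ := Finsupp.support_nonempty_iff.2 h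
  refine Finset.sum_pos' (fun _ _ => Nat.zero_le _) ⟨k, hk, ?_⟩
  exact Nat.mul_pos k.pos (dsum_pos (Finsupp.mem_support_iff.1 hk))

theorem deg_zero (q : ℕ) : deg q 0 = 0 := Finsupp.sum_zero_index

theorem deg_add (q : ℕ) (R S : ℕ+ →₀ ℕ) : deg q (R + S) = deg q R + deg q S :=
  Finsupp.sum_add_index' (by simp) (by intros; ring)

theorem deg_single (q : ℕ) (k : ℕ+) (r : ℕ) : deg q (Finsupp.single k r) = brk q k * r :=
  Finsupp.sum_single_index (by simp)

theorem deg_sg (q k r : ℕ) : deg q (sg k r) = brk q k * r := by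
  rcases Nat.eq_zero_or_pos k with rfl | hk
  · rw [sg_zero_left, deg_zero]; simp [brk]
  · obtain ⟨k, rfl⟩ : ∃ k' : ℕ+, (k' : ℕ) = k := ⟨⟨k, hk⟩, rfl⟩
    rw [sg_pnat, deg_single]

theorem brk_add (q a b : ℕ) : brk q (a + b) = brk q a * q ^ b + brk q b := by
  rw [brk, add_comm a b, Finset.sum_range_add, add_comm, brk, brk, Finset.sum_mul]
  congr 1
  exact Finset.sum_congr rfl fun i _ => by rw [← pow_add, add_comm]

theorem inProfile_finite (p e n : ℕ) : {R | InProfile p e n R}.Finite := by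
  classical
  have : {R | InProfile p e n R} ⊆ Set.Iic
      (∑ k ∈ Finset.Icc (1 : ℕ+) n.succPNat, Finsupp.single k (p ^ (e * (n - k)))) := by
    intro R hR
    refine (Finsupp.le_iff _ _).2 fun k hk => ?_
    have hk' : (k : ℕ) ≤ n := by
      by_contra h
      have := hR k
      -- Beyond `n` the truncated difference is `0`, so the profile bound is `1` and the exponent
      -- vanishes.
      rw [Nat.sub_eq_zero_of_le (by omega), mul_zero, pow_zero] at this
      exact Finsupp.mem_support_iff.1 hk (by omega)
    rw [Finsupp.finsetSum_apply]
    have hmem : k ∈ Finset.Icc (1 : ℕ+) n.succPNat := by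
      rw [Finset.mem_Icc]
      refine ⟨one_le, ?_⟩
      rw [← PNat.coe_le_coe, Nat.succPNat_coe]
      omega
    refine (hR k).le.trans (le_trans ?_ (Finset.single_le_sum (fun _ _ => Nat.zero_le _) hmem))
    simp
  exact (Set.finite_Iic _).subset this

theorem InProfile.mono {e n : ℕ} {R S : ℕ+ →₀ ℕ} (h : R ≤ S) (hS : InProfile p e n S) :
    InProfile p e n R := fun k => (h k).trans_lt (hS k)

/-- The profiles exhaust all exponent sequences as `n` grows, which brings every `P(R)` within reach
of a finite stage. -/
theorem exists_inProfile {e : ℕ} (he : e ≠ 0) (R : ℕ+ →₀ ℕ) : ∃ n, InProfile p e n R := by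
  refine ⟨∑ k ∈ R.support, ((k : ℕ) + R k), fun k => ?_⟩
  by_cases hk : k ∈ R.support
  · have h1 : (k : ℕ) + R k ≤ ∑ k ∈ R.support, ((k : ℕ) + R k) :=
      Finset.single_le_sum (f := fun k : ℕ+ => (k : ℕ) + R k) (fun _ _ => Nat.zero_le _) hk
    have h2 : R k ≤ e * ((∑ k ∈ R.support, ((k : ℕ) + R k)) - k) :=
      (show R k ≤ (∑ k ∈ R.support, ((k : ℕ) + R k)) - k by omega).trans
        (Nat.le_mul_of_pos_left _ (Nat.pos_of_ne_zero he))
    exact (Nat.lt_pow_self hp.out.one_lt).trans_le (Nat.pow_le_pow_right hp.out.pos h2)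
  · rw [Finsupp.notMem_support_iff.1 hk]
    exact pow_pos hp.out.pos _

theorem inProfile_single {e n : ℕ} {t : ℕ+} {c : ℕ} (h : c < p ^ (e * (n - t))) :
    InProfile p e n (Finsupp.single t c) := by
  intro k
  rw [Finsupp.single_apply]
  split_ifs with hk
  · rwa [← hk]
  · exact pow_pos hp.out.pos _

end Weights

/-! ### Effect of the action on weight, degree and profile -/

section ActionWeights

set_option linter.unusedSectionVars false

variable {F : Type*} [Field F] {p e : ℕ} [hp : Fact p.Prime] [CharP F p]

/-- On `ξ_k^r` the action removes `c` from the exponent of `ξ_k` and adds `q^t c` to that of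
`ξ_{k-t}`. As the binomial coefficient is nonzero, `c + (r - c)` has no carry; so each unit of the
digit sum of `c` costs `k` and returns at most `k - t`. -/
theorem act_wt (t : ℕ+) (c : ℕ) (T : ℕ+ →₀ ℕ) : act F p e t c (mon F p e T) ∈
    Submodule.span F (mon F p e '' {S | wt p S + t * dsum p c ≤ wt p T}) := by
  refine act_mem_span F p e t (fun T c => {S | wt p S + t * dsum p c ≤ wt p T}) ?_ ?_ ?_ ?_ T c
  · simp [dsum_zero]
  · intro k r _ _
    simp [dsum_zero]
  · intro k r c _ htk hc
    have hcr : c ≤ r := by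
      by_contra h
      rw [Nat.choose_eq_zero_of_lt (by omega)] at hc
      simp at hc
    obtain ⟨d, rfl⟩ := Nat.exists_eq_add_of_le hcr
    obtain ⟨j, hj⟩ := Nat.exists_eq_add_of_le htk
    have h1 := dsum_add_of_choose_ne (F := F) (p := p) hc
    have h2 := wt_add_le (p := p) (Finsupp.single k (c + d - c))
      (sg (k - t) ((p ^ e) ^ (t : ℕ) * c))
    rw [wt_single, wt_sg, ← pow_mul, dsum_pow_mul, Nat.add_sub_cancel_left] at h2
    simp only [Set.mem_ofPred_eq]
    rw [wt_single, h1]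
    rw [← pow_mul, Nat.add_sub_cancel_left]
    rw [show (k : ℕ) - t = j by omega] at h2 ⊢
    rw [hj] at h2 ⊢
    nlinarith
  · intro k r T c c' S S' _ hT hS hS'
    simp only [Set.mem_ofPred_eq] at hS hS' ⊢
    rw [wt_single] at hS
    rw [wt_single_add hT]
    have h1 := wt_add_le (p := p) S S'
    have h2 := Nat.mul_le_mul_left (t : ℕ) (dsum_add_le (p := p) c c')
    rw [mul_add] at h2
    omega

/-- By `brk_add`, trading `ξ_k` for `ξ_{k-t}^(q^t)` lowers the degree by exactly `brk q t`. -/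
theorem act_deg (t : ℕ+) (c : ℕ) (T : ℕ+ →₀ ℕ) : act F p e t c (mon F p e T) ∈
    Submodule.span F (mon F p e '' {S | deg (p ^ e) S + brk (p ^ e) t * c = deg (p ^ e) T}) := by
  refine act_mem_span F p e t
    (fun T c => {S | deg (p ^ e) S + brk (p ^ e) t * c = deg (p ^ e) T}) ?_ ?_ ?_ ?_ T c
  · simp [deg_zero]
  · intro k r _ _
    simp
  · intro k r c _ htk hc
    have hcr : c ≤ r := by
      by_contra h
      rw [Nat.choose_eq_zero_of_lt (by omega)] at hc
      simp at hc
    obtain ⟨d, rfl⟩ := Nat.exists_eq_add_of_le hcr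
    obtain ⟨j, hj⟩ := Nat.exists_eq_add_of_le htk
    simp only [Set.mem_ofPred_eq]
    rw [deg_add, deg_single, deg_single, deg_sg, Nat.add_sub_cancel_left, show (k : ℕ) - t = j by
      omega, hj, add_comm (t : ℕ) j, brk_add]
    ring
  · intro k r T c c' S S' _ hT hS hS'
    simp only [Set.mem_ofPred_eq] at hS hS' ⊢
    rw [deg_add, deg_add, ← hS, ← hS']
    ring

/-- The ideal spanned by the monomials outside the profile is stable. If the exponent of `ξ_k` is
too large and `c < q^(n-k)`, subtraction without borrowing leaves it too large; if `c ≥ q^(n-k)`,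
then `t < k` and `ξ_{k-t}` receives the exponent `q^t c`, which is too large for it. -/
theorem act_profile (n : ℕ) (t : ℕ+) (c : ℕ) (T : ℕ+ →₀ ℕ) (hc : c < p ^ (e * (n - t)))
    (hT : ¬ InProfile p e n T) : act F p e t c (mon F p e T) ∈
    Submodule.span F (mon F p e '' {S | ¬ InProfile p e n S}) := by
  -- The bound on `c` is part of the set because the product rule splits `c` into smaller shares,
  -- which inherit it.
  refine Submodule.span_mono (Set.image_mono ?_) (act_mem_span F p e t
    (fun T c => {S | c < p ^ (e * (n - t)) → ¬ InProfile p e n T → ¬ InProfile p e n S})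
    ?_ ?_ ?_ ?_ T c)
  · exact fun S hS => hS hc hT
  · exact fun _ h => h
  · exact fun k r _ _ _ h => h
  · intro k r c _ htk hc hlt hT hS
    have hr : p ^ (e * (n - k)) ≤ r := by
      by_contra h
      exact hT (inProfile_single (not_le.1 h))
    have h1 := hS k
    by_cases hck : c < p ^ (e * (n - k))
    · have := le_sub_of_choose_ne hck hr hc
      rw [Finsupp.add_apply, Finsupp.single_eq_same] at h1
      omega
    · rcases htk.eq_or_lt with h | h
      · rw [h] at hlt; exact hck hlt
      · obtain ⟨m, hm⟩ : ∃ m : ℕ+, (m : ℕ) = k - t := ⟨⟨k - t, by omega⟩, rfl⟩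
        have h2 := hS m
        rw [← hm, sg_pnat, Finsupp.add_apply, Finsupp.single_eq_same] at h2
        have h3 : p ^ (e * (n - m)) ≤ (p ^ e) ^ (t : ℕ) * c := by
          refine le_trans ?_ (Nat.mul_le_mul_left _ (not_lt.1 hck))
          rw [← pow_mul, ← pow_add, ← mul_add]
          exact Nat.pow_le_pow_right hp.out.pos (Nat.mul_le_mul_left _ (by omega))
        omega
  · intro k r T c c' S S' _ hT hS hS' hlt hkT hSS
    by_cases h : InProfile p e n T
    · refine hS (by omega) (fun h' => hkT fun j => ?_)
        (InProfile.mono (fun _ => by simp) hSS)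
      rw [Finsupp.add_apply]
      by_cases hj : j = k
      · subst hj; rw [hT, add_zero]; exact h' j
      · rw [Finsupp.single_eq_of_ne hj, zero_add]; exact h j
    · exact hS' (by omega) h (InProfile.mono (fun _ => by simp) hSS)

theorem act_zero (t : ℕ+) (x : DualSteenrod F p e) : act F p e t 0 x = x := by
  have h : act F p e t 0 = LinearMap.id := by
    refine dual_lin_ext fun T => ?_
    induction T using Finsupp.induction with
    | zero => rw [mon_zero, act_apply, map_one]; simp
    | single_add k r T _ _ ih =>
      rw [mon_add, act_mul, Finset.HasAntidiagonal.antidiagonal_zero, Finset.sum_singleton, ih,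
        act_single]
      simp [mul_zero, sg_zero_right]
  rw [h]; rfl

/-- The part of `act t c (ξ^T)` that comes from acting on a single power of some `ξ_k`. -/
def actMain (F : Type*) [Field F] (p e : ℕ) (t : ℕ+) (c : ℕ) (T : ℕ+ →₀ ℕ) : DualSteenrod F p e :=
  ∑ k ∈ T.support, mon F p e (T.erase k) * act F p e t c (mon F p e (Finsupp.single k (T k)))

/-- If two factors both receive a positive share of `p^s = a + b`, the digit sums of the shares add
up to at least `2`, so the weight drops by at least `2 t ≥ t + 1`. -/
theorem act_sub_actMain (t : ℕ+) (s : ℕ) (T : ℕ+ →₀ ℕ) :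
    act F p e t (p ^ s) (mon F p e T) - actMain F p e t (p ^ s) T ∈
    Submodule.span F (mon F p e '' {S | wt p S + t + 1 ≤ wt p T}) := by
  classical
  have hps : p ^ s ≠ 0 := pow_ne_zero s hp.out.ne_zero
  induction T using Finsupp.induction with
  | zero =>
    rw [mon_zero, act_apply, map_one, Polynomial.coeff_one, if_neg hps, actMain]
    simp
  | single_add k r T hk hr ih =>
    have hTk : T k = 0 := by simpa using hk
    have hsupp : (Finsupp.single k r + T).support = insert k T.support := by
      ext j
      by_cases hj : j = k
      · subst hj; simp [hTk, hr]
      · simp [hj, Finsupp.single_eq_of_ne hj]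
    have hmain : actMain F p e t (p ^ s) (Finsupp.single k r + T) =
        mon F p e T * act F p e t (p ^ s) (mon F p e (Finsupp.single k r)) +
          mon F p e (Finsupp.single k r) * actMain F p e t (p ^ s) T := by
      rw [actMain, hsupp, Finset.sum_insert hk, Finsupp.add_apply, Finsupp.single_eq_same, hTk,
        add_zero, Finsupp.erase_add, Finsupp.erase_single, zero_add,
        Finsupp.erase_of_notMem_support hk, actMain, Finset.mul_sum]
      congr 1
      refine Finset.sum_congr rfl fun j hj => ?_
      have hjk : j ≠ k := by rintro rfl; exact hk hj
      rw [Finsupp.add_apply, Finsupp.single_eq_of_ne hjk, zero_add, Finsupp.erase_add,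
        Finsupp.erase_of_notMem_support (show j ∉ (Finsupp.single k r).support by
          simp [Finsupp.single_eq_of_ne hjk]), mon_add, mul_assoc]
    have h1 : ((0 : ℕ), p ^ s) ∈ Finset.HasAntidiagonal.antidiagonal (p ^ s) := by simp
    have h2 : (p ^ s, (0 : ℕ)) ∈ (Finset.HasAntidiagonal.antidiagonal (p ^ s)).erase (0, p ^ s) := by
      rw [Finset.mem_erase]
      exact ⟨fun h => hps (congrArg Prod.fst h), by simp⟩
    rw [hmain, mon_add, act_mul, ← Finset.add_sum_erase _ _ h1, ← Finset.add_sum_erase _ _ h2,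
      act_zero, act_zero]
    have hsplit : ∀ a b c d x y : DualSteenrod F p e,
        a * b + (c * d + x) - (d * c + a * y) = a * (b - y) + x := by intros; ring
    rw [hsplit]
    refine add_mem ?_ (Submodule.sum_mem _ ?_)
    · have h3 : mon F p e (Finsupp.single k r) ∈ Submodule.span F
          (mon F p e '' {Finsupp.single k r}) := Submodule.subset_span ⟨_, rfl, rfl⟩
      have h4 := Submodule.mul_mem_mul h3 ih
      rw [Submodule.span_mul_span] at h4
      refine Submodule.span_mono ?_ h4
      rintro _ ⟨_, ⟨S, hS, rfl⟩, _, ⟨S', hS', rfl⟩, rfl⟩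
      refine ⟨S + S', ?_, mon_add F p e S S'⟩
      rw [Set.mem_singleton_iff] at hS
      subst hS
      simp only [Set.mem_ofPred_eq] at hS' ⊢
      have := wt_add_le (p := p) (Finsupp.single k r) S'
      rw [wt_single] at this
      rw [wt_single_add hTk]
      omega
    · rintro ⟨a, b⟩ hab
      simp only [Finset.mem_erase, ne_eq, Prod.mk.injEq,
        Finset.HasAntidiagonal.mem_antidiagonal] at hab
      have ha := dsum_pos (p := p) (a := a) (by omega)
      have hb := dsum_pos (p := p) (a := b) (by omega)
      have h4 := Submodule.mul_mem_mul (act_wt (F := F) (e := e) t a (Finsupp.single k r))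
        (act_wt (F := F) (e := e) t b T)
      rw [Submodule.span_mul_span] at h4
      refine Submodule.span_mono ?_ h4
      rintro _ ⟨_, ⟨S, hS, rfl⟩, _, ⟨S', hS', rfl⟩, rfl⟩
      refine ⟨S + S', ?_, mon_add F p e S S'⟩
      simp only [Set.mem_ofPred_eq] at hS hS' ⊢
      have := wt_add_le (p := p) S S'
      rw [wt_single] at hS
      rw [wt_single_add hTk]
      have h5 := Nat.mul_le_mul_left (t : ℕ) ha
      have h6 := Nat.mul_le_mul_left (t : ℕ) hb
      have := t.pos
      simp only [Nat.succ_eq_add_one, zero_add, mul_one] at h5 h6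
      omega

/-- The weight bound leaves no room for the error term of `act_sub_actMain`: only terms acting on a
single factor reach `ξ^R`. -/
theorem coef_act (t : ℕ+) (s : ℕ) {R T : ℕ+ →₀ ℕ} (h : wt p T ≤ wt p R + t) :
    coef F p e R (act F p e t (p ^ s) (mon F p e T)) = ∑ k ∈ T.support,
      if (t : ℕ) ≤ k ∧ T.erase k + (Finsupp.single k (T k - p ^ s) +
        sg (k - t) ((p ^ e) ^ (t : ℕ) * p ^ s)) = R then ((T k).choose (p ^ s) : F) else 0 := by
  have h0 : coef F p e R (act F p e t (p ^ s) (mon F p e T) - actMain F p e t (p ^ s) T) = 0 := by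
    by_contra hne
    have := mem_span_mon.1 (act_sub_actMain (F := F) (e := e) t s T) R hne
    simp only [Set.mem_ofPred_eq] at this
    omega
  rw [map_sub, sub_eq_zero] at h0
  rw [h0, actMain, map_sum]
  refine Finset.sum_congr rfl fun k _ => ?_
  rw [act_single]
  by_cases h1 : (t : ℕ) ≤ k
  · rw [if_pos h1, mul_smul_comm, ← mon_add, map_smul, coef_mon, smul_eq_mul]
    simp [h1]
  · rw [if_neg h1, if_neg (pow_ne_zero s hp.out.ne_zero), if_neg (fun h => h1 h.1), mul_zero,
      map_zero]

end ActionWeights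

/-! ### The weight filtration, and products of the `P^s_t` modulo higher weight -/

section Filtration

set_option linter.unusedSectionVars false

variable (F : Type*) [Field F] (p e : ℕ)

/-- The functionals which vanish on the monomials of weight less than `k`. -/
def wtFil (k : ℕ) : Submodule F (MilnorAlg F p e) where
  carrier := {f | ∀ S, wt p S < k → f.ofConv (mon F p e S) = 0}
  add_mem' hf hg S hS := by
    rw [WithConv.ofConv_add, LinearMap.add_apply, hf S hS, hg S hS, add_zero]
  zero_mem' S _ := rfl
  smul_mem' c f hf S hS := by
    rw [WithConv.ofConv_smul, LinearMap.smul_apply, hf S hS, smul_zero]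

/-- The functionals which vanish on the monomials outside the profile. -/
def profSub (n : ℕ) : Submodule F (MilnorAlg F p e) where
  carrier := {f | ∀ S, ¬ InProfile p e n S → f.ofConv (mon F p e S) = 0}
  add_mem' hf hg S hS := by
    rw [WithConv.ofConv_add, LinearMap.add_apply, hf S hS, hg S hS, add_zero]
  zero_mem' S _ := rfl
  smul_mem' c f hf S hS := by
    rw [WithConv.ofConv_smul, LinearMap.smul_apply, hf S hS, smul_zero]

/-- The part of `profSub n` in filtration `k`. -/
def profFil (n k : ℕ) : Submodule F (MilnorAlg F p e) := wtFil F p e k ⊓ profSub F p e n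

/-- The Milnor basis element `P^s_t`, the dual of `ξ_t ^ (p ^ s)`. -/
def milP (t : ℕ+) (s : ℕ) : MilnorAlg F p e := dualMonomial F p e (Finsupp.single t (p ^ s))

variable {F p e}

theorem wtFil_antitone {k l : ℕ} (h : k ≤ l) : wtFil F p e l ≤ wtFil F p e k :=
  fun _ hf S hS => hf S (hS.trans_le h)

theorem mem_wtFil_zero (f : MilnorAlg F p e) : f ∈ wtFil F p e 0 := fun S hS => by omega

theorem profFil_antitone (n : ℕ) {k l : ℕ} (h : k ≤ l) : profFil F p e n l ≤ profFil F p e n k :=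
  inf_le_inf_right _ (wtFil_antitone h)

theorem dualMonomial_mon (R S : ℕ+ →₀ ℕ) :
    (dualMonomial F p e R).ofConv (mon F p e S) = if S = R then 1 else 0 := coef_mon F p e R S

theorem dualMonomial_mem_wtFil {R : ℕ+ →₀ ℕ} {k : ℕ} (h : k ≤ wt p R) :
    dualMonomial F p e R ∈ wtFil F p e k := by
  intro S hS
  rw [dualMonomial_mon, if_neg]
  rintro rfl
  omega

theorem dualMonomial_mem_profSub {R : ℕ+ →₀ ℕ} {n : ℕ} (h : InProfile p e n R) :
    dualMonomial F p e R ∈ profSub F p e n := by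
  intro S hS
  rw [dualMonomial_mon, if_neg]
  rintro rfl
  exact hS h

theorem dualMonomial_mem_profFil {R : ℕ+ →₀ ℕ} {n k : ℕ} (h : InProfile p e n R)
    (hk : k ≤ wt p R) : dualMonomial F p e R ∈ profFil F p e n k :=
  ⟨dualMonomial_mem_wtFil hk, dualMonomial_mem_profSub h⟩

theorem eq_sum_of_mem_profSub {n : ℕ} {f : MilnorAlg F p e} (hf : f ∈ profSub F p e n) :
    f = ∑ R ∈ (inProfile_finite p e n).toFinset,
      f.ofConv (mon F p e R) • dualMonomial F p e R := by
  refine milnor_ext fun S => ?_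
  have h1 : (∑ R ∈ (inProfile_finite p e n).toFinset,
      f.ofConv (mon F p e R) • dualMonomial F p e R).ofConv (mon F p e S) =
      ∑ R ∈ (inProfile_finite p e n).toFinset, f.ofConv (mon F p e R) * if S = R then 1 else 0 := by
    have := map_sum ((LinearMap.applyₗ (R := F) (mon F p e S) : (DualSteenrod F p e →ₗ[F] F) →ₗ[F] F)
      ∘ₗ (WithConv.linearEquiv F (DualSteenrod F p e →ₗ[F] F)).toLinearMap)
      (fun R => f.ofConv (mon F p e R) • dualMonomial F p e R) (inProfile_finite p e n).toFinset
    refine this.trans (Finset.sum_congr rfl fun R _ => ?_)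
    change f.ofConv (mon F p e R) * (dualMonomial F p e R).ofConv (mon F p e S) = _
    rw [dualMonomial_mon]
  rw [h1]
  simp only [mul_ite, mul_one, mul_zero, Finset.sum_ite_eq]
  split_ifs with h
  · rfl
  · exact hf S (by simpa using h)

/-- A functional in `profFil n k` is a combination of dual monomials of weight at least `k`. -/
theorem profFil_le {n k : ℕ} {N : Submodule F (MilnorAlg F p e)}
    (h : ∀ R, InProfile p e n R → k ≤ wt p R → dualMonomial F p e R ∈ N) :
    profFil F p e n k ≤ N := by
  intro f hf
  rw [eq_sum_of_mem_profSub hf.2]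
  refine Submodule.sum_mem _ fun R hR => ?_
  by_cases hk : k ≤ wt p R
  · exact Submodule.smul_mem _ _ (h R (by simpa using hR) hk)
  · rw [hf.1 R (not_le.1 hk), zero_smul]
    exact zero_mem _

/-- The profile is finite, so its weights are bounded; this starts the descending induction along
the filtration. -/
theorem exists_profFil_eq_bot (F : Type*) [Field F] (p e n : ℕ) :
    ∃ B, ∀ k, B ≤ k → profFil F p e n k = ⊥ := by
  obtain ⟨B, hB⟩ := ((inProfile_finite p e n).image (wt p)).bddAbove
  refine ⟨B + 1, fun k hk => eq_bot_iff.2 (profFil_le fun R hR hkR => ?_)⟩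
  have := hB ⟨R, hR, rfl⟩
  omega

/-- Descending induction along the filtration. -/
theorem profFil_le_of_le_sup {n : ℕ} {Y : ℕ → Submodule F (MilnorAlg F p e)}
    (hY : ∀ k, Y (k + 1) ≤ Y k) (h : ∀ k, profFil F p e n k ≤ Y k ⊔ profFil F p e n (k + 1))
    (k : ℕ) : profFil F p e n k ≤ Y k := by
  obtain ⟨B, hB⟩ := exists_profFil_eq_bot F p e n
  by_cases hk : B ≤ k
  · rw [hB k hk]; exact bot_le
  · refine Nat.decreasingInduction (n := B) (motive := fun k _ => profFil F p e n k ≤ Y k) ?_ ?_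
      (not_le.1 hk).le
    · intro k _ ih
      exact (h k).trans (sup_le le_rfl (ih.trans (hY k)))
    · rw [hB B le_rfl]; exact bot_le

theorem wt_single_pow [Fact p.Prime] (t : ℕ+) (s : ℕ) : wt p (Finsupp.single t (p ^ s)) = t := by
  rw [wt_single, dsum_pow, mul_one]

variable [hp : Fact p.Prime] [CharP F p]

theorem mul_single_apply (f : MilnorAlg F p e) (t : ℕ+) (c : ℕ) (x : DualSteenrod F p e) :
    (f * dualMonomial F p e (Finsupp.single t c)).ofConv x = f.ofConv (act F p e t c x) := by
  rw [mul_dualMonomial_single]; rfl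

theorem vanish_of_mem_span {f : DualSteenrod F p e →ₗ[F] F} {E : Set (ℕ+ →₀ ℕ)}
    (hf : ∀ S ∈ E, f (mon F p e S) = 0) {x : DualSteenrod F p e}
    (hx : x ∈ Submodule.span F (mon F p e '' E)) : f x = 0 := by
  have : Submodule.span F (mon F p e '' E) ≤ LinearMap.ker f := by
    rw [Submodule.span_le]
    rintro _ ⟨S, hS, rfl⟩
    exact hf S hS
  exact this hx

theorem mul_single_mem_wtFil {f : MilnorAlg F p e} {k : ℕ} (hf : f ∈ wtFil F p e k) (t : ℕ+)
    (c : ℕ) : f * dualMonomial F p e (Finsupp.single t c) ∈ wtFil F p e (k + t * dsum p c) := by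
  intro S hS
  rw [mul_single_apply]
  refine vanish_of_mem_span (fun S' hS' => hf S' ?_) (act_wt t c S)
  simp only [Set.mem_ofPred_eq] at hS'
  omega

theorem mul_milP_mem_wtFil {f : MilnorAlg F p e} {k : ℕ} (hf : f ∈ wtFil F p e k) (t : ℕ+)
    (s : ℕ) : f * milP F p e t s ∈ wtFil F p e (k + t) := by
  have := mul_single_mem_wtFil hf t (p ^ s)
  rwa [dsum_pow, mul_one] at this

theorem mul_milP_mem_profSub {f : MilnorAlg F p e} {n : ℕ} (hf : f ∈ profSub F p e n) {t : ℕ+}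
    {s : ℕ} (hs : s < e * (n - t)) : f * milP F p e t s ∈ profSub F p e n := by
  intro S hS
  rw [milP, mul_single_apply]
  exact vanish_of_mem_span (fun S' hS' => hf S' hS')
    (act_profile n t _ S (Nat.pow_lt_pow_right hp.out.one_lt hs) hS)

theorem one_eq_dualMonomial : (1 : MilnorAlg F p e) = dualMonomial F p e 0 := by
  refine milnor_ext fun R => ?_
  rw [dualMonomial_mon]
  change counitHom F p e (mon F p e R) = _
  induction R using Finsupp.induction with
  | zero => rw [mon_zero, map_one, if_pos rfl]
  | single_add k r R hk hr _ =>
    rw [mon_add, map_mul, mon_single, map_pow, counitHom_xi, if_neg k.pos.ne', zero_pow hr,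
      zero_mul, if_neg]
    intro h
    have := DFunLike.congr_fun h k
    simp [hr] at this

theorem one_mem_profSub (n : ℕ) : (1 : MilnorAlg F p e) ∈ profSub F p e n := by
  rw [one_eq_dualMonomial]
  exact dualMonomial_mem_profSub fun k => pow_pos hp.out.pos _

/-- Multiplication by `P^s_t` on the right, for `s` at least as large as all digit positions. -/
theorem dualMonomial_mul_milP (he : e ≠ 0) {R : ℕ+ →₀ ℕ} {s : ℕ} (hR : ∀ k, R k < p ^ (s + 1))
    (t : ℕ+) : dualMonomial F p e R * milP F p e t s -
      ((R t + p ^ s).choose (p ^ s) : F) • dualMonomial F p e (R + Finsupp.single t (p ^ s)) ∈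
        wtFil F p e (wt p R + t + 1) := by
  have hps : 0 < p ^ s := pow_pos hp.out.pos s
  intro T hT
  rw [WithConv.ofConv_sub, LinearMap.sub_apply, WithConv.ofConv_smul, LinearMap.smul_apply,
    dualMonomial_mon, milP, mul_single_apply, ofConv_dualMonomial, coef_act t s (by omega),
    sub_eq_zero]
  have key : ∀ k : ℕ+, (if (t : ℕ) ≤ k ∧ T.erase k + (Finsupp.single k (T k - p ^ s) +
        sg (k - t) ((p ^ e) ^ (t : ℕ) * p ^ s)) = R then ((T k).choose (p ^ s) : F) else 0) =
      if k = t then (if T = R + Finsupp.single t (p ^ s) then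
        ((R t + p ^ s).choose (p ^ s) : F) else 0) else 0 := by
    intro k
    by_cases hkt : k = t
    · subst hkt
      rw [if_pos rfl]
      by_cases hk : p ^ s ≤ T k
      · have h1 : T.erase k + (Finsupp.single k (T k - p ^ s) + sg ((k : ℕ) - k)
            ((p ^ e) ^ (k : ℕ) * p ^ s)) + Finsupp.single k (p ^ s) = T := by
          rw [Nat.sub_self, sg_zero_left, add_zero, add_assoc, ← Finsupp.single_add,
            Nat.sub_add_cancel hk, add_comm, Finsupp.single_add_erase]
        by_cases h2 : T = R + Finsupp.single k (p ^ s)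
        · rw [if_pos h2, if_pos]
          · rw [h2]; simp
          · exact ⟨le_rfl, add_right_cancel (h1.trans h2)⟩
        · rw [if_neg h2, if_neg]
          rintro ⟨-, h3⟩
          rw [h3] at h1
          exact h2 h1.symm
      · have hT' : T ≠ R + Finsupp.single k (p ^ s) := by
          rintro rfl
          simp at hk
        rw [Nat.choose_eq_zero_of_lt (not_le.1 hk), if_neg hT', Nat.cast_zero, ite_self]
    -- For `k ≠ t` the action creates `ξ_{k-t}` with exponent at least `q^t p^s ≥ p^(s+1)`, more
    -- than any exponent of `R`.
    · rw [if_neg hkt, if_neg]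
      rintro ⟨h1, h2⟩
      have hne : (k : ℕ) ≠ t := fun h => hkt (PNat.coe_inj.1 h)
      obtain ⟨m, hm⟩ : ∃ m : ℕ+, (m : ℕ) = k - t := ⟨⟨k - t, by omega⟩, rfl⟩
      rw [← hm, sg_pnat] at h2
      have h3 := hR m
      rw [← h2] at h3
      simp only [Finsupp.add_apply, Finsupp.single_eq_same] at h3
      have h4 : p ^ (s + 1) ≤ (p ^ e) ^ (t : ℕ) * p ^ s := by
        rw [← pow_mul, ← pow_add]
        refine Nat.pow_le_pow_right hp.out.pos ?_
        have := Nat.mul_pos (Nat.pos_of_ne_zero he) t.pos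
        omega
      omega
  simp only [key, Finset.sum_ite_eq', smul_eq_mul, mul_ite, mul_one, mul_zero]
  by_cases h1 : T = R + Finsupp.single t (p ^ s)
  · rw [if_pos h1, if_pos]
    rw [h1, Finsupp.mem_support_iff, Finsupp.add_apply, Finsupp.single_eq_same]
    omega
  · simp [h1]

/-- In weight at most `u + t` the product detects only two monomials: the evident `ξ_u^(p^v)
ξ_t^(p^s)`, and `ξ_{u+t}^(p^s)`, from which the action produces `ξ_u^(q^t p^s)`. The latter is
`ξ_u^(p^v)` only for `v = s + e t`. -/
theorem milP_mul_milP_apply (t u : ℕ+) (s v : ℕ) {T : ℕ+ →₀ ℕ}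
    (hT : wt p T < u + t + 1) : (milP F p e u v * milP F p e t s).ofConv (mon F p e T) =
      (if T = Finsupp.single u (p ^ v) + Finsupp.single t (p ^ s) then
        ((T t).choose (p ^ s) : F) else 0) +
      (if v = s + e * t ∧ T = Finsupp.single (u + t) (p ^ s) then 1 else 0) := by
  have hps : 0 < p ^ s := pow_pos hp.out.pos s
  have hpv : 0 < p ^ v := pow_pos hp.out.pos v
  have hqs : (p ^ e) ^ (t : ℕ) * p ^ s = p ^ (s + e * t) := by
    rw [← pow_mul, ← pow_add, add_comm]
  have hut : u + t ≠ t := fun h => by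
    have := congrArg PNat.val h
    have := u.pos
    simp at *
  rw [milP, milP, mul_single_apply, ofConv_dualMonomial,
    coef_act t s (by rw [wt_single_pow]; omega)]
  have key : ∀ k ∈ T.support, (if (t : ℕ) ≤ k ∧ T.erase k + (Finsupp.single k (T k - p ^ s) +
        sg (k - t) ((p ^ e) ^ (t : ℕ) * p ^ s)) = Finsupp.single u (p ^ v)
        then ((T k).choose (p ^ s) : F) else 0) =
      (if k = t then (if T = Finsupp.single u (p ^ v) + Finsupp.single t (p ^ s) then
        ((T t).choose (p ^ s) : F) else 0) else 0) +
      (if k = u + t then (if v = s + e * t ∧ T = Finsupp.single (u + t) (p ^ s) then 1 else 0)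
        else 0) := by
    intro k hkT
    by_cases hkt : k = t
    · subst hkt
      rw [if_pos rfl, if_neg hut.symm, add_zero]
      by_cases hk : p ^ s ≤ T k
      · have h1 : T.erase k + (Finsupp.single k (T k - p ^ s) + sg ((k : ℕ) - k)
            ((p ^ e) ^ (k : ℕ) * p ^ s)) + Finsupp.single k (p ^ s) = T := by
          rw [Nat.sub_self, sg_zero_left, add_zero, add_assoc, ← Finsupp.single_add,
            Nat.sub_add_cancel hk, add_comm, Finsupp.single_add_erase]
        by_cases h2 : T = Finsupp.single u (p ^ v) + Finsupp.single k (p ^ s)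
        · rw [if_pos h2, if_pos]
          exact ⟨le_rfl, add_right_cancel (h1.trans h2)⟩
        · rw [if_neg h2, if_neg]
          rintro ⟨-, h3⟩
          rw [h3] at h1
          exact h2 h1.symm
      · rw [Nat.choose_eq_zero_of_lt (not_le.1 hk)]
        simp
    · rw [if_neg hkt, zero_add]
      have hne : (k : ℕ) ≠ t := fun h => hkt (PNat.coe_inj.1 h)
      by_cases hk : p ^ s ≤ T k
      · by_cases htk : (t : ℕ) ≤ k
        · obtain ⟨m, hm⟩ : ∃ m : ℕ+, (m : ℕ) = k - t := ⟨⟨k - t, by omega⟩, rfl⟩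
          have hkm : k = m + t := PNat.coe_inj.1 (by rw [PNat.add_coe]; omega)
          have hmk : m ≠ k := by
            rintro rfl
            have := t.pos
            omega
          rw [← hm, sg_pnat, hqs]
          by_cases h2 : T.erase k + (Finsupp.single k (T k - p ^ s) +
              Finsupp.single m (p ^ (s + e * t))) = Finsupp.single u (p ^ v)
          · rw [if_pos ⟨htk, h2⟩]
            have hmu : m = u := by
              by_contra hmu
              have h3 := DFunLike.congr_fun h2 m
              simp only [Finsupp.add_apply, Finsupp.single_eq_same,
                Finsupp.single_eq_of_ne hmu] at h3
              have : 0 < p ^ (s + e * t) := pow_pos hp.out.pos _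
              omega
            subst hmu
            set T0 := T.erase k + Finsupp.single k (T k - p ^ s) with hT0
            have hTT0 : T = T0 + Finsupp.single k (p ^ s) := by
              rw [hT0, add_assoc, ← Finsupp.single_add, Nat.sub_add_cancel hk, add_comm,
                Finsupp.single_add_erase]
            rw [← add_assoc, ← hT0] at h2
            have hT0k : T0 k = 0 := by
              have h3 := DFunLike.congr_fun h2 k
              simp only [Finsupp.add_apply, Finsupp.single_eq_of_ne hmk.symm] at h3
              omega
            have hwt : wt p T = k + wt p T0 := by
              rw [hTT0, add_comm, wt_single_add hT0k, dsum_pow, mul_one]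
            -- The factor `ξ_k^(p^s)`, with `k = u + t`, already uses up the permitted weight, so no
            -- other factor remains.
            have hT00 : T0 = 0 := by
              by_contra h0
              have := wt_pos (p := p) h0
              rw [hkm, PNat.add_coe] at hwt
              omega
            rw [hT00, zero_add] at hTT0 h2
            have hv : v = s + e * t := by
              have h3 := DFunLike.congr_fun h2 m
              simp only [Finsupp.single_eq_same] at h3
              exact (Nat.pow_right_injective hp.out.two_le h3).symm
            rw [if_pos hkm, if_pos ⟨hv, hkm ▸ hTT0⟩, hTT0]
            simp
          · rw [if_neg (fun h => h2 h.2)]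
            split_ifs with h3 h4
            · exfalso
              obtain ⟨rfl, h5⟩ := h4
              rw [← h3] at h5
              have hmu : m = u := add_right_cancel (hkm.symm.trans h3)
              subst hmu
              apply h2
              rw [h5]
              simp
            · rfl
            · rfl
        · rw [if_neg (fun h => htk h.1), if_neg]
          rintro rfl
          rw [PNat.add_coe] at htk
          omega
      · have hz : (if k = u + t then
            (if v = s + e * t ∧ T = Finsupp.single (u + t) (p ^ s) then (1 : F) else 0) else 0)
            = 0 := by
          split_ifs with h2 h3
          · rw [h2, h3.2] at hk; simp at hk
          · rfl
          · rfl
        rw [hz, Nat.choose_eq_zero_of_lt (not_le.1 hk), Nat.cast_zero, ite_self]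
  rw [Finset.sum_congr rfl key, Finset.sum_add_distrib, Finset.sum_ite_eq', Finset.sum_ite_eq']
  congr 1
  · by_cases h1 : T = Finsupp.single u (p ^ v) + Finsupp.single t (p ^ s)
    · rw [if_pos]
      rw [h1, Finsupp.mem_support_iff, Finsupp.add_apply, Finsupp.single_eq_same]
      omega
    · simp [h1]
  · by_cases h1 : v = s + e * t ∧ T = Finsupp.single (u + t) (p ^ s)
    · rw [if_pos]
      rw [h1.2, Finsupp.mem_support_iff, Finsupp.single_eq_same]
      omega
    · simp [h1]

/-- The commutation relations modulo higher filtration. -/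
theorem milP_commutator (t u : ℕ+) (s v : ℕ) :
    milP F p e u v * milP F p e t s - milP F p e t s * milP F p e u v -
      ((if v = s + e * t then milP F p e (u + t) s else 0) -
        (if s = v + e * u then milP F p e (u + t) v else 0)) ∈ wtFil F p e (u + t + 1) := by
  intro T hT
  have hif (c : Prop) [Decidable c] (k : ℕ+) (r : ℕ) :
      (if c then milP F p e k r else 0).ofConv (mon F p e T) =
        if c ∧ T = Finsupp.single k (p ^ r) then 1 else 0 := by
    split_ifs with h1 h2 h2
    · rw [milP, dualMonomial_mon, if_pos h2.2]
    · rw [milP, dualMonomial_mon, if_neg (fun h => h2 ⟨h1, h⟩)]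
    · exact absurd h2.1 h1
    · rfl
  simp only [WithConv.ofConv_sub, LinearMap.sub_apply]
  rw [milP_mul_milP_apply t u s v hT, milP_mul_milP_apply u t v s (by omega), hif, hif,
    add_comm t u, add_comm (Finsupp.single t (p ^ s))]
  -- The terms from the product monomial cancel in the commutator; for `u = t` this is the symmetry
  -- of binomial coefficients.
  have hsym : (if T = Finsupp.single u (p ^ v) + Finsupp.single t (p ^ s) then
        ((T t).choose (p ^ s) : F) else 0) =
      if T = Finsupp.single u (p ^ v) + Finsupp.single t (p ^ s) then
        ((T u).choose (p ^ v) : F) else 0 := by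
    by_cases h : T = Finsupp.single u (p ^ v) + Finsupp.single t (p ^ s)
    · rw [if_pos h, if_pos h, h]
      by_cases hut : u = t
      · subst hut
        simp only [Finsupp.add_apply, Finsupp.single_eq_same]
        rw [Nat.choose_symm_add]
      · simp [Finsupp.single_eq_of_ne hut, Finsupp.single_eq_of_ne (Ne.symm hut)]
    · rw [if_neg h, if_neg h]
  rw [hsym]
  ring

/-- Each factor `P^s_t` raises the digit in position `s` by one; as long as `j < p` there is no
carry, and `dualMonomial_mul_milP` applies at each step. The value of the scalar is irrelevant. -/
theorem exists_milP_pow (he : e ≠ 0) (t : ℕ+) (s : ℕ) {j : ℕ} (hj : j < p) : ∃ c : F,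
    milP F p e t s ^ j - c • dualMonomial F p e (Finsupp.single t (p ^ s * j)) ∈
      wtFil F p e (t * j + 1) := by
  induction j with
  | zero =>
    refine ⟨1, ?_⟩
    rw [pow_zero, Nat.mul_zero (p ^ s), Finsupp.single_zero, one_smul, one_eq_dualMonomial, sub_self]
    exact zero_mem _
  | succ j ih =>
    obtain ⟨c, hc⟩ := ih (by omega)
    have h1 := mul_milP_mem_wtFil hc t s
    have h2 := dualMonomial_mul_milP (F := F) (e := e) he (R := Finsupp.single t (p ^ s * j)) (s := s)
      (fun k => by
        rw [Finsupp.single_apply, pow_succ]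
        split_ifs
        · exact Nat.mul_lt_mul_of_pos_left (by omega) (pow_pos hp.out.pos s)
        · exact Nat.mul_pos (pow_pos hp.out.pos s) hp.out.pos) t
    rw [wt_single, dsum_pow_mul, dsum_of_lt (by omega), ← Finsupp.single_add,
      ← Nat.mul_succ] at h2
    set c' : F := (((Finsupp.single t (p ^ s * j) : ℕ+ →₀ ℕ) t + p ^ s).choose (p ^ s) : F)
    refine ⟨c * c', ?_⟩
    have h3 := Submodule.smul_mem _ c h2
    have h4 := add_mem (wtFil_antitone (show t * (j + 1) + 1 ≤ t * j + 1 + t by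
      rw [mul_add, mul_one]; omega) h1) (wtFil_antitone (show t * (j + 1) + 1 ≤ t * j + t + 1 by
      rw [mul_add, mul_one]) h3)
    convert h4 using 1
    rw [pow_succ, sub_mul, smul_mul_assoc, smul_sub, smul_smul]
    abel

/-- The `p`th power of `P^s_t` has higher filtration than expected. -/
theorem milP_pow_char (he : e ≠ 0) (t : ℕ+) (s : ℕ) :
    milP F p e t s ^ p ∈ wtFil F p e (t * p + 1) := by
  obtain ⟨j, hj⟩ : ∃ j, p = j + 1 := ⟨p - 1, by have := hp.out.pos; omega⟩
  obtain ⟨c, hc⟩ := exists_milP_pow (F := F) he t s (j := j) (by omega)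
  have h1 := mul_milP_mem_wtFil hc t s
  have h2 := dualMonomial_mul_milP (F := F) (e := e) he (R := Finsupp.single t (p ^ s * j)) (s := s)
    (fun k => by
      rw [Finsupp.single_apply, pow_succ]
      split_ifs
      · exact Nat.mul_lt_mul_of_pos_left (by omega) (pow_pos hp.out.pos s)
      · exact Nat.mul_pos (pow_pos hp.out.pos s) hp.out.pos) t
  -- The last factor completes a carry: its scalar is `binom(p^(s+1), p^s)`, which equals `p = 0` in
  -- `F`.
  have h0 : (((Finsupp.single t (p ^ s * j) : ℕ+ →₀ ℕ) t + p ^ s).choose (p ^ s) : F) = 0 := by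
    have := cast_choose_pow_mul (F := F) (p := p) s (j + 1) 1
    rw [mul_one, Nat.mul_succ, Nat.choose_one_right, ← hj, CharP.cast_eq_zero F p] at this
    rwa [Finsupp.single_eq_same]
  rw [wt_single, dsum_pow_mul, dsum_of_lt (by omega), h0, zero_smul, sub_zero] at h2
  have h3 := Submodule.smul_mem _ c h2
  have hle : t * p + 1 = t * j + t + 1 := by
    conv_lhs => rw [hj]
    rw [mul_add, mul_one]
  have h4 := add_mem (wtFil_antitone (show t * p + 1 ≤ t * j + 1 + t by omega) h1)
    (wtFil_antitone hle.le h3)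
  convert h4 using 1
  rw [show milP F p e t s ^ p = milP F p e t s ^ (j + 1) from congrArg (milP F p e t s ^ ·) hj,
    pow_succ, sub_mul, smul_mul_assoc]
  abel

end Filtration

/-! ### Generation of the profile by the `P^s_t` and by the `P^s_1` -/

section Generation

set_option linter.unusedSectionVars false

variable (F : Type*) [Field F] (p e : ℕ) [hp : Fact p.Prime] [CharP F p]

/-- The span of the products of elements `P^s_t`, `s < e (n - t)`, of total weight at least `k`. -/
def prodFil (n k : ℕ) : Submodule F (MilnorAlg F p e) :=
  Submodule.span F {x | ∃ l : List (ℕ+ × ℕ), (∀ a ∈ l, a.2 < e * (n - a.1)) ∧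
    k ≤ (l.map fun a => (a.1 : ℕ)).sum ∧ x = (l.map fun a => milP F p e a.1 a.2).prod}

/-- The span of the words of length at least `k` in the elements `P^s_1`, `s < (n - 1) e`. -/
def wordFil (n k : ℕ) : Submodule F (MilnorAlg F p e) :=
  Submodule.span F {x | ∃ l : List ℕ, (∀ a ∈ l, a < (n - 1) * e) ∧ k ≤ l.length ∧
    x = (l.map fun a => milP F p e 1 a).prod}

variable {F p e}

theorem prodFil_antitone (n : ℕ) {k l : ℕ} (h : k ≤ l) : prodFil F p e n l ≤ prodFil F p e n k :=
  Submodule.span_mono fun _ ⟨L, h1, h2, h3⟩ => ⟨L, h1, h.trans h2, h3⟩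

theorem wordFil_antitone (n : ℕ) {k l : ℕ} (h : k ≤ l) : wordFil F p e n l ≤ wordFil F p e n k :=
  Submodule.span_mono fun _ ⟨L, h1, h2, h3⟩ => ⟨L, h1, h.trans h2, h3⟩

theorem prodFil_mul_milP {n k : ℕ} {f : MilnorAlg F p e} (hf : f ∈ prodFil F p e n k) {t : ℕ+}
    {s : ℕ} (hs : s < e * (n - t)) : f * milP F p e t s ∈ prodFil F p e n (k + t) := by
  unfold prodFil at hf
  induction hf using Submodule.span_induction with
  | mem x hx =>
    obtain ⟨l, h1, h2, rfl⟩ := hx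
    refine Submodule.subset_span ⟨l ++ [(t, s)], ?_, ?_, ?_⟩
    · intro a ha
      rcases List.mem_append.1 ha with h | h
      · exact h1 a h
      · rw [List.mem_singleton.1 h]; exact hs
    · simpa using h2
    · simp
  | zero => rw [zero_mul]; exact zero_mem _
  | add x y _ _ hx hy => rw [add_mul]; exact add_mem hx hy
  | smul c x _ hx => rw [smul_mul_assoc]; exact Submodule.smul_mem _ _ hx

theorem profFil_mul_milP {n k : ℕ} {f : MilnorAlg F p e} (hf : f ∈ profFil F p e n k) {t : ℕ+}
    {s : ℕ} (hs : s < e * (n - t)) : f * milP F p e t s ∈ profFil F p e n (k + t) :=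
  ⟨mul_milP_mem_wtFil hf.1 t s, mul_milP_mem_profSub hf.2 hs⟩

theorem milP_mem_profFil {n : ℕ} {t : ℕ+} {s : ℕ} (hs : s < e * (n - t)) :
    milP F p e t s ∈ profFil F p e n t :=
  dualMonomial_mem_profFil (inProfile_single (Nat.pow_lt_pow_right hp.out.one_lt hs))
    (wt_single_pow t s).ge

/-- Here `s` is the highest digit position occurring in any exponent, as `dualMonomial_mul_milP`
requires. -/
theorem exists_top_digit {R : ℕ+ →₀ ℕ} (h : R ≠ 0) :
    ∃ (t : ℕ+) (s : ℕ), p ^ s ≤ R t ∧ ∀ k, R k < p ^ (s + 1) := by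
  obtain ⟨t, ht, hmax⟩ := Finset.exists_max_image R.support R (Finsupp.support_nonempty_iff.2 h)
  have ht0 : R t ≠ 0 := Finsupp.mem_support_iff.1 ht
  refine ⟨t, Nat.log p (R t), Nat.pow_log_le_self p ht0, fun k => ?_⟩
  refine lt_of_le_of_lt ?_ (Nat.lt_pow_succ_log_self hp.out.one_lt (R t))
  by_cases hk : k ∈ R.support
  · exact hmax k hk
  · rw [Finsupp.notMem_support_iff.1 hk]; exact Nat.zero_le _

/-- Induction on weight. Removing the leading `p^s` from the largest exponent `R t` gives `R'` of
weight smaller by `t`, and `P(R') P^s_t` is a multiple of `P(R)` modulo higher weight. The scalar is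
nonzero since it is a leading digit. -/
theorem dualMonomial_mem_sup (he : e ≠ 0) (n : ℕ) (m : ℕ) (R : ℕ+ →₀ ℕ) (hR : InProfile p e n R)
    (hm : wt p R = m) : dualMonomial F p e R ∈ prodFil F p e n m ⊔ profFil F p e n (m + 1) := by
  induction m using Nat.strong_induction_on generalizing R with
  | _ m ih =>
    by_cases h0 : R = 0
    · subst h0
      rw [wt_zero] at hm
      subst hm
      rw [← one_eq_dualMonomial]
      exact Submodule.mem_sup_left (Submodule.subset_span ⟨[], by simp, by simp, by simp⟩)
    · obtain ⟨t, s, h1, h2⟩ := exists_top_digit (p := p) h0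
      set R' : ℕ+ →₀ ℕ := R - Finsupp.single t (p ^ s) with hR'
      have hRR : R = R' + Finsupp.single t (p ^ s) := by
        rw [hR', tsub_add_cancel_of_le]
        rwa [Finsupp.single_le_iff]
      have hle : R' ≤ R := by rw [hR']; exact tsub_le_self
      have hR't : R' t + p ^ s = R t := by
        rw [hRR, Finsupp.add_apply, Finsupp.single_eq_same]
      have hc : (((R' t + p ^ s).choose (p ^ s) : ℕ) : F) ≠ 0 := by
        rw [hR't]
        exact cast_choose_pow_ne_zero h1 (h2 t)
      have hs : s < e * (n - t) := by
        have := h1.trans_lt (hR t)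
        exact (Nat.pow_lt_pow_iff_right hp.out.one_lt).1 this
      have hwt : wt p R' + t = m := by
        have h3 : dsum p (R t) = dsum p (p ^ s) + dsum p (R' t) := by
          rw [add_comm (R' t)] at hc
          rw [← hR't, add_comm (R' t)]
          exact dsum_add_of_choose_ne hc
        have h4 (S : ℕ+ →₀ ℕ) : wt p S = t * dsum p (S t) + wt p (S.erase t) := by
          conv_lhs => rw [← Finsupp.single_add_erase t S]
          exact wt_single_add (by simp)
        have h5 : R.erase t = R'.erase t := by
          rw [hRR, Finsupp.erase_add, Finsupp.erase_single, add_zero]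
        rw [← hm, h4 R, h4 R', h3, h5, dsum_pow, mul_add, mul_one]
        ring
      have h6 := dualMonomial_mul_milP (F := F) (e := e) he
        (R := R') (s := s) (fun k => (hle k).trans_lt (h2 k)) t
      rw [← hRR, hwt] at h6
      have h7 : dualMonomial F p e R' * milP F p e t s ∈
          prodFil F p e n m ⊔ profFil F p e n (m + 1) := by
        obtain ⟨z, hz, g, hg, hzg⟩ := Submodule.mem_sup.1
          (ih (wt p R') (by have := t.pos; omega) R' (hR.mono hle) rfl)
        rw [← hzg, add_mul, ← hwt]
        refine add_mem (Submodule.mem_sup_left (prodFil_mul_milP hz hs))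
          (Submodule.mem_sup_right ?_)
        have := profFil_mul_milP hg hs
        rwa [add_right_comm] at this
      have h8 : ((R' t + p ^ s).choose (p ^ s) : F) • dualMonomial F p e R ∈
          prodFil F p e n m ⊔ profFil F p e n (m + 1) := by
        have h9 : dualMonomial F p e R' * milP F p e t s - ((R' t + p ^ s).choose (p ^ s) : F) •
            dualMonomial F p e R ∈ profFil F p e n (m + 1) :=
          ⟨h6, sub_mem (mul_milP_mem_profSub (dualMonomial_mem_profSub (hR.mono hle)) hs)
            (Submodule.smul_mem _ _ (dualMonomial_mem_profSub hR))⟩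
        have := sub_mem h7 (Submodule.mem_sup_right h9)
        rwa [sub_sub_cancel] at this
      exact (Submodule.smul_mem_iff _ hc).1 h8

theorem profFil_le_prodFil (he : e ≠ 0) (n k : ℕ) : profFil F p e n k ≤ prodFil F p e n k := by
  refine profFil_le_of_le_sup (fun k => prodFil_antitone n (Nat.le_succ k)) (fun k => ?_) k
  refine profFil_le fun R hR hk => ?_
  rcases hk.eq_or_lt with h | h
  · exact dualMonomial_mem_sup he n k R hR h.symm
  · exact Submodule.mem_sup_right (dualMonomial_mem_profFil hR h)

/-- The action formula controls only right factors dual to powers of a single `ξ_t`;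
`profFil_le_prodFil` reduces `g` to products of such factors. -/
theorem mul_mem_wtFil (he : e ≠ 0) {n k l : ℕ} {f g : MilnorAlg F p e} (hf : f ∈ wtFil F p e k)
    (hg : g ∈ profFil F p e n l) : f * g ∈ wtFil F p e (k + l) := by
  have hg' := profFil_le_prodFil he n l hg
  clear hg
  unfold prodFil at hg'
  induction hg' using Submodule.span_induction with
  | mem x hx =>
    obtain ⟨L, -, h2, rfl⟩ := hx
    refine wtFil_antitone (Nat.add_le_add_left h2 k) ?_
    clear h2
    induction L generalizing f k with
    | nil => simpa using hf
    | cons a L ih =>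
      have := ih (mul_milP_mem_wtFil hf a.1 a.2)
      simpa [mul_assoc, add_assoc] using this
  | zero => rw [mul_zero]; exact zero_mem _
  | add x y _ _ hx hy => rw [mul_add]; exact add_mem hx hy
  | smul c x _ hx => rw [mul_smul_comm]; exact Submodule.smul_mem _ _ hx

theorem mul_mem_profSub (he : e ≠ 0) {n : ℕ} {f g : MilnorAlg F p e} (hf : f ∈ profSub F p e n)
    (hg : g ∈ profSub F p e n) : f * g ∈ profSub F p e n := by
  have hg' := profFil_le_prodFil he n 0 ⟨mem_wtFil_zero g, hg⟩
  clear hg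
  unfold prodFil at hg'
  induction hg' using Submodule.span_induction with
  | mem x hx =>
    obtain ⟨L, h1, -, rfl⟩ := hx
    induction L generalizing f with
    | nil => simpa using hf
    | cons a L ih =>
      have := ih (mul_milP_mem_profSub hf (h1 a (by simp))) (fun b hb => h1 b (by simp [hb]))
      simpa [mul_assoc] using this
  | zero => rw [mul_zero]; exact zero_mem _
  | add x y _ _ hx hy => rw [mul_add]; exact add_mem hx hy
  | smul c x _ hx => rw [mul_smul_comm]; exact Submodule.smul_mem _ _ hx

theorem mul_mem_profFil (he : e ≠ 0) {n k l : ℕ} {f g : MilnorAlg F p e}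
    (hf : f ∈ profFil F p e n k) (hg : g ∈ profFil F p e n l) : f * g ∈ profFil F p e n (k + l) :=
  ⟨mul_mem_wtFil he hf.1 hg, mul_mem_profSub he hf.2 hg.2⟩

theorem mul_mem_wordFil {n k l : ℕ} {f g : MilnorAlg F p e} (hf : f ∈ wordFil F p e n k)
    (hg : g ∈ wordFil F p e n l) : f * g ∈ wordFil F p e n (k + l) := by
  have h := Submodule.mul_mem_mul hf hg
  unfold wordFil at h
  rw [Submodule.span_mul_span] at h
  refine Submodule.span_mono ?_ h
  rintro _ ⟨_, ⟨L, h1, h2, rfl⟩, _, ⟨L', h1', h2', rfl⟩, rfl⟩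
  refine ⟨L ++ L', ?_, ?_, by simp⟩
  · intro a ha
    rcases List.mem_append.1 ha with h | h
    · exact h1 a h
    · exact h1' a h
  · rw [List.length_append]; omega

theorem milP_one_mem_wordFil {n i : ℕ} (h : i < (n - 1) * e) :
    milP F p e 1 i ∈ wordFil F p e n 1 :=
  Submodule.subset_span ⟨[i], by simpa using h, by simp, by simp⟩

theorem one_mem_profFil (n : ℕ) : (1 : MilnorAlg F p e) ∈ profFil F p e n 0 :=
  ⟨mem_wtFil_zero _, one_mem_profSub n⟩

theorem wordFil_le_profFil (n k : ℕ) : wordFil F p e n k ≤ profFil F p e n k := by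
  refine Submodule.span_le.2 ?_
  rintro _ ⟨L, h1, h2, rfl⟩
  refine profFil_antitone n h2 ?_
  clear h2
  induction L using List.reverseRecOn with
  | nil => simpa using one_mem_profFil n
  | append_singleton L a ih =>
    have h3 : a < e * (n - (1 : ℕ+)) := by
      have := h1 a (by simp)
      rw [mul_comm] at this
      simpa using this
    have := profFil_mul_milP (ih fun b hb => h1 b (by simp [hb])) h3
    simpa using this

/-- Being a combination of words modulo higher filtration is multiplicative. This permits
calculation with leading terms before words are known to exhaust the filtration. -/
theorem mul_mem_sup (he : e ≠ 0) {n k l : ℕ} {f g : MilnorAlg F p e}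
    (hf : f ∈ wordFil F p e n k ⊔ profFil F p e n (k + 1))
    (hg : g ∈ wordFil F p e n l ⊔ profFil F p e n (l + 1)) :
    f * g ∈ wordFil F p e n (k + l) ⊔ profFil F p e n (k + l + 1) := by
  obtain ⟨x, hx, y, hy, rfl⟩ := Submodule.mem_sup.1 hf
  obtain ⟨x', hx', y', hy', rfl⟩ := Submodule.mem_sup.1 hg
  rw [add_mul, mul_add, add_assoc (x * x')]
  refine add_mem (Submodule.mem_sup_left (mul_mem_wordFil hx hx')) (Submodule.mem_sup_right
    (add_mem ?_ ?_))
  · have := mul_mem_profFil he (wordFil_le_profFil n k hx) hy'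
    rwa [← add_assoc] at this
  · have h : x' + y' ∈ profFil F p e n l :=
      add_mem (wordFil_le_profFil n l hx') (profFil_antitone n (Nat.le_succ l) hy')
    have := mul_mem_profFil he hy h
    rwa [add_right_comm] at this

/-- Induction on `t`: modulo higher weight, `P^s_{t+1}` is the commutator of `P^(s+et)_1` and
`P^s_t`. -/
theorem milP_mem_sup (he : e ≠ 0) {n : ℕ} (t : ℕ+) {s : ℕ} (hs : s < e * (n - t)) :
    milP F p e t s ∈ wordFil F p e n t ⊔ profFil F p e n (t + 1) := by
  induction t using PNat.recOn with
  | one =>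
    refine Submodule.mem_sup_left (milP_one_mem_wordFil ?_)
    rw [mul_comm]
    simpa using hs
  | succ t ih =>
    rw [PNat.add_coe, PNat.one_coe] at hs ⊢
    have hst : s < e * (n - t) := hs.trans_le (Nat.mul_le_mul_left _ (by omega))
    -- The profile bound in position `t + 1` is exactly what puts `P^(p^(s + e t))` among the
    -- generators.
    have hv : s + e * t < (n - 1) * e := by
      have h1 : e * (n - (t + 1)) + e * t = e * (n - (t + 1) + t) := by ring
      have h2 : 0 < n - (t + 1) := by
        by_contra h
        rw [Nat.eq_zero_of_not_pos h, mul_zero] at hs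
        omega
      have h3 : n - (t + 1) + t = n - 1 := by omega
      rw [h3, mul_comm e (n - 1)] at h1
      omega
    have hP1 : milP F p e 1 (s + e * t) ∈ wordFil F p e n 1 ⊔ profFil F p e n (1 + 1) :=
      Submodule.mem_sup_left (milP_one_mem_wordFil hv)
    have h1 := mul_mem_sup he hP1 (ih hst)
    have h2 := mul_mem_sup he (ih hst) hP1
    rw [add_comm 1 (t : ℕ)] at h1
    have h3 := milP_commutator (F := F) (p := p) (e := e) t 1 s (s + e * t)
    rw [if_pos rfl, if_neg (by rw [PNat.one_coe]; have := Nat.pos_of_ne_zero he; omega), sub_zero,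
      add_comm 1 t, PNat.one_coe, add_comm 1 (t : ℕ)] at h3
    have hprof : ∀ k, wordFil F p e n k ⊔ profFil F p e n (k + 1) ≤ profSub F p e n := fun k =>
      sup_le ((wordFil_le_profFil n k).trans inf_le_right) inf_le_right
    have h4 : milP F p e 1 (s + e * t) * milP F p e t s - milP F p e t s * milP F p e 1 (s + e * t) -
        milP F p e (t + 1) s ∈ profFil F p e n (t + 1 + 1) :=
      ⟨h3, sub_mem (sub_mem (hprof _ h1) (hprof _ h2))
        (milP_mem_profFil (t := t + 1) (by rwa [PNat.add_coe, PNat.one_coe])).2⟩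
    have := sub_mem (sub_mem h1 h2) (Submodule.mem_sup_right h4)
    rwa [sub_sub_cancel] at this

/-- The weight filtration of `profSub n` is the filtration by word length. -/
theorem profFil_eq_wordFil (he : e ≠ 0) (n k : ℕ) : profFil F p e n k = wordFil F p e n k := by
  refine le_antisymm ?_ (wordFil_le_profFil n k)
  refine profFil_le_of_le_sup (fun k => wordFil_antitone n (Nat.le_succ k)) (fun k => ?_) k
  refine (profFil_le_prodFil he n k).trans (Submodule.span_le.2 ?_)
  rintro _ ⟨L, h1, h2, rfl⟩
  refine (sup_le_sup (wordFil_antitone n h2) (profFil_antitone n (Nat.succ_le_succ h2)) :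
    wordFil F p e n _ ⊔ profFil F p e n _ ≤ _) ?_
  clear h2
  induction L with
  | nil =>
    exact Submodule.mem_sup_left (Submodule.subset_span ⟨[], by simp, by simp, by simp⟩)
  | cons a L ih =>
    have := mul_mem_sup he (milP_mem_sup he a.1 (h1 a (by simp)))
      (ih fun b hb => h1 b (by simp [hb]))
    simpa using this

end Generation

/-! ### The Adem relations in the Milnor algebra -/

section Adem

set_option linter.unusedSectionVars false

variable {F : Type*} [Field F] {p e : ℕ} [hp : Fact p.Prime] [CharP F p]

theorem neg_one_pow_succ_char : (-1 : F) ^ (p ^ e + 1) = 1 := by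
  rcases hp.out.eq_two_or_odd' with h2 | hodd
  · subst h2
    have : (2 : F) = 0 := by
      have := CharP.cast_eq_zero F 2
      exact_mod_cast this
    have : (-1 : F) = 1 := by linear_combination -this
    rw [this, one_pow]
  · exact (Odd.add_one hodd.pow).neg_one_pow

/-- The operator `act 1 b` lowers indices by at most one, so a factor `ξ_j` with `j > 2` always
leaves some `ξ_i` with `i ≥ 2`. -/
theorem coef_single_one_act_eq_zero (a b : ℕ) {T : ℕ+ →₀ ℕ} {j : ℕ+} (hj : 2 < j) (hT : T j ≠ 0) :
    coef F p e (Finsupp.single 1 a) (act F p e 1 b (mon F p e T)) = 0 := by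
  by_contra hne
  have h := mem_span_mon.1 (act_mem_span F p e 1
    (fun T _ => {S | (∀ k : ℕ+, 1 < k → S k = 0) → ∀ k : ℕ+, 2 < k → T k = 0})
    ?_ ?_ ?_ ?_ T b) _ hne
  · refine hT (h (fun k hk => ?_) j hj)
    rw [Finsupp.single_eq_of_ne hk.ne']
  · simp
  · intro k r _ hk
    exact absurd hk (not_lt_one)
  · intro k r c hr hk _ hS i hi
    by_contra hik
    have hki : i = k := by
      by_contra h
      exact hik (Finsupp.single_eq_of_ne h)
    subst hki
    have h1 := hS i (lt_trans (by decide) hi)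
    obtain ⟨m, hm⟩ : ∃ m : ℕ+, (m : ℕ) = i - (1 : ℕ+) := by
      have : (2 : ℕ) < i := by exact_mod_cast hi
      exact ⟨⟨i - 1, by omega⟩, rfl⟩
    have hm1 : 1 < m := by
      have : (2 : ℕ) < i := by exact_mod_cast hi
      rw [← PNat.coe_lt_coe, PNat.one_coe]
      rw [PNat.one_coe] at hm
      omega
    have h2 := hS m hm1
    rw [← hm, sg_pnat, Finsupp.add_apply, Finsupp.single_eq_same] at h1 h2
    have h3 : (p ^ e) ^ ((1 : ℕ+) : ℕ) * c = 0 := by omega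
    have h4 : c = 0 := by
      rcases mul_eq_zero.1 h3 with h | h
      · exact absurd h (pow_ne_zero _ (pow_ne_zero _ hp.out.ne_zero))
      · exact h
    omega
  · intro k r T c c' S S' _ hT hS hS' hSS i hi
    rw [Finsupp.add_apply, hS (fun k hk => ?_) i hi, hS' (fun k hk => ?_) i hi]
    · have := hSS k hk
      rw [Finsupp.add_apply] at this
      omega
    · have := hSS k hk
      rw [Finsupp.add_apply] at this
      omega

/-- The product of two Steenrod powers in the Milnor algebra. -/
theorem single_one_mul_single_one_apply (a b : ℕ) (T : ℕ+ →₀ ℕ) :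
    (dualMonomial F p e (Finsupp.single 1 a) * dualMonomial F p e (Finsupp.single 1 b)).ofConv
      (mon F p e T) = if T = Finsupp.single 1 (T 1) + Finsupp.single 2 (T 2) ∧
        T 1 + (p ^ e + 1) * T 2 = a + b ∧ T 2 ≤ b then ((T 1).choose (b - T 2) : F) else 0 := by
  have h12 : (1 : ℕ+) ≠ 2 := by decide
  rw [mul_single_apply, ofConv_dualMonomial]
  by_cases hT : T = Finsupp.single 1 (T 1) + Finsupp.single 2 (T 2)
  · generalize T 1 = r at hT ⊢
    generalize T 2 = j at hT ⊢
    subst hT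
    rw [mon_add, act_mul, map_sum]
    -- No `ξ_2` may remain, so every factor `ξ_2` must be converted to `ξ_1^q`; this forces the
    -- share `x.2 = j`.
    have key : ∀ x ∈ Finset.HasAntidiagonal.antidiagonal b,
        coef F p e (Finsupp.single 1 a) (act F p e 1 x.1 (mon F p e (Finsupp.single 1 r)) *
          act F p e 1 x.2 (mon F p e (Finsupp.single 2 j))) =
        if x.2 = j then (if r + (p ^ e + 1) * j = a + b then (r.choose (b - j) : F) else 0)
          else 0 := by
      rintro ⟨c, d⟩ hcd
      replace hcd : c + d = b := Finset.HasAntidiagonal.mem_antidiagonal.1 hcd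
      dsimp only
      rw [act_single, act_single, if_pos le_rfl, if_pos (by decide), Nat.sub_self, sg_zero_left,
        add_zero, smul_mul_smul_comm, ← mon_add, map_smul, coef_mon, smul_eq_mul]
      rw [show ((2 : ℕ+) : ℕ) - ((1 : ℕ+) : ℕ) = ((1 : ℕ+) : ℕ) from rfl, sg_pnat, PNat.one_coe,
        pow_one]
      by_cases hdj : d = j
      · subst hdj
        rw [if_pos rfl, Nat.choose_self, Nat.cast_one, mul_one, Nat.sub_self, Finsupp.single_zero,
          zero_add, ← Finsupp.single_add, ← hcd, Nat.add_sub_cancel]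
        by_cases hc : c ≤ r
        · have : (Finsupp.single (1 : ℕ+) (r - c + p ^ e * d) = Finsupp.single 1 a) ↔
              r + (p ^ e + 1) * d = a + (c + d) := by
            rw [(Finsupp.single_injective (1 : ℕ+)).eq_iff, add_mul]
            omega
          simp only [this, mul_ite, mul_one, mul_zero]
        · rw [Nat.choose_eq_zero_of_lt (not_le.1 hc)]
          simp
      · rw [if_neg hdj]
        by_cases hlt : j < d
        · rw [Nat.choose_eq_zero_of_lt hlt]
          simp
        · rw [if_neg, mul_zero]
          intro h
          have := DFunLike.congr_fun h 2
          simp only [Finsupp.add_apply, Finsupp.single_eq_same, Finsupp.single_eq_of_ne h12.symm]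
            at this
          omega
    rw [Finset.sum_congr rfl key]
    by_cases hjb : j ≤ b
    · rw [Finset.sum_eq_single (b - j, j)]
      · simp [hjb]
      · rintro ⟨c, d⟩ hcd hne
        replace hcd : c + d = b := Finset.HasAntidiagonal.mem_antidiagonal.1 hcd
        rw [if_neg]
        rintro rfl
        apply hne
        rw [← hcd, Nat.add_sub_cancel]
      · intro h
        exact absurd (Finset.HasAntidiagonal.mem_antidiagonal.2 (Nat.sub_add_cancel hjb)) h
    · rw [if_neg (show ¬ (_ ∧ _ ∧ j ≤ b) from fun h => hjb h.2.2)]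
      refine Finset.sum_eq_zero ?_
      rintro ⟨c, d⟩ hcd
      replace hcd : c + d = b := Finset.HasAntidiagonal.mem_antidiagonal.1 hcd
      rw [if_neg]
      dsimp only
      omega
  · rw [if_neg (fun h => hT h.1)]
    have : ∃ j : ℕ+, 2 < j ∧ T j ≠ 0 := by
      by_contra h
      push Not at h
      refine hT (Finsupp.ext fun k => ?_)
      rw [Finsupp.add_apply]
      by_cases h1 : k = 1
      · subst h1; simp [Finsupp.single_eq_of_ne h12]
      · by_cases h2 : k = 2
        · subst h2; simp [Finsupp.single_eq_of_ne h12.symm]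
        · rw [Finsupp.single_eq_of_ne h1, Finsupp.single_eq_of_ne h2]
          refine h k ?_
          have h3 : (k : ℕ) ≠ 1 := fun h => h1 (PNat.coe_inj.1 h)
          have h4 : (k : ℕ) ≠ 2 := fun h => h2 (PNat.coe_inj.1 h)
          have := k.pos
          rw [← PNat.coe_lt_coe]
          change 2 < (k : ℕ)
          omega
    obtain ⟨j, hj, hTj⟩ := this
    exact coef_single_one_act_eq_zero a b hj hTj

variable (F p e) in
/-- Evaluation of functionals at `x`. -/
def evalAt (x : DualSteenrod F p e) : MilnorAlg F p e →ₗ[F] F :=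
  (LinearMap.applyₗ (R := F) x : (DualSteenrod F p e →ₗ[F] F) →ₗ[F] F) ∘ₗ
    (WithConv.linearEquiv F (DualSteenrod F p e →ₗ[F] F)).toLinearMap

theorem evalAt_apply (x : DualSteenrod F p e) (f : MilnorAlg F p e) :
    evalAt F p e x f = f.ofConv x := rfl

/-- Tested on `ξ_1^r ξ_2^j`, the relation for `(a, b)` becomes `choose_eq_adem_sum` for `(a - q j, b
- j)`. -/
theorem adem_milnor (he : e ≠ 0) (a b : ℕ) (h : a < p ^ e * b) :
    dualMonomial F p e (Finsupp.single 1 a) * dualMonomial F p e (Finsupp.single 1 b) =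
      ∑ j ∈ Finset.range (a / p ^ e + 1),
        ((-1 : F) ^ (a + j) * (((p ^ e - 1) * (b - j) - 1).choose (a - p ^ e * j) : F)) •
          (dualMonomial F p e (Finsupp.single 1 (a + b - j)) *
            dualMonomial F p e (Finsupp.single 1 j)) := by
  have hq : 0 < p ^ e := pow_pos hp.out.pos e
  refine milnor_ext fun T => ?_
  rw [← evalAt_apply, ← evalAt_apply, map_sum]
  simp only [map_smul, evalAt_apply, single_one_mul_single_one_apply, smul_eq_mul]
  have hlt : ∀ i ∈ Finset.range (a / p ^ e + 1), p ^ e * i ≤ a ∧ i < b := by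
    intro i hi
    have h1 : i ≤ a / p ^ e := by simpa [Nat.lt_succ_iff] using hi
    have h2 := (Nat.mul_le_mul_left (p ^ e) h1).trans (Nat.mul_div_le a (p ^ e))
    exact ⟨h2, lt_of_mul_lt_mul_left (h2.trans_lt h) (Nat.zero_le _)⟩
  by_cases hT : T = Finsupp.single 1 (T 1) + Finsupp.single 2 (T 2) ∧
      T 1 + (p ^ e + 1) * T 2 = a + b
  · obtain ⟨hT1, hT2⟩ := hT
    have hsum : ∀ i ∈ Finset.range (a / p ^ e + 1),
        (-1 : F) ^ (a + i) * (((p ^ e - 1) * (b - i) - 1).choose (a - p ^ e * i) : F) *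
          (if T = Finsupp.single 1 (T 1) + Finsupp.single 2 (T 2) ∧
            T 1 + (p ^ e + 1) * T 2 = a + b - i + i ∧ T 2 ≤ i then ((T 1).choose (i - T 2) : F)
              else 0) =
        if T 2 ≤ i then (-1 : F) ^ (a + i) *
          (((p ^ e - 1) * (b - i) - 1).choose (a - p ^ e * i) : F) * ((T 1).choose (i - T 2) : F)
            else 0 := by
      intro i hi
      have := hlt i hi
      rw [Nat.sub_add_cancel (by omega)]
      simp [← hT1, hT2]
    rw [Finset.sum_congr rfl hsum]
    simp only [← hT1, hT2, true_and]
    clear hsum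
    generalize T 1 = r at hT2
    generalize T 2 = j at hT2
    by_cases hja : p ^ e * j ≤ a
    · obtain ⟨a', rfl⟩ := Nat.exists_eq_add_of_le hja
      have hjb : j < b := lt_of_mul_lt_mul_left (hja.trans_lt h) (Nat.zero_le _)
      obtain ⟨b', rfl⟩ := Nat.exists_eq_add_of_le hjb.le
      rw [if_pos (by omega), Nat.add_sub_cancel_left]
      have hr : r = a' + b' := by
        rw [add_mul] at hT2
        omega
      have hab : a' < p ^ e * b' := by
        rw [mul_add] at h
        omega
      have hdiv : (p ^ e * j + a') / p ^ e + 1 = j + (a' / p ^ e + 1) := by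
        rw [Nat.mul_add_div hq, add_assoc]
      rw [hr, ← Nat.choose_symm_add, choose_eq_adem_sum he hab, hdiv,
        Finset.sum_range_add _ j, Finset.sum_eq_zero (s := Finset.range j), zero_add]
      · refine Finset.sum_congr rfl fun i _ => ?_
        have hs : (-1 : F) ^ (p ^ e * j + a' + (j + i)) = (-1) ^ (a' + i) := by
          rw [show p ^ e * j + a' + (j + i) = (p ^ e + 1) * j + (a' + i) by ring, pow_add, pow_mul,
            neg_one_pow_succ_char, one_pow, one_mul]
        rw [if_pos (by omega), hs, Nat.add_sub_cancel_left, Nat.add_sub_add_left, mul_add,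
          Nat.add_sub_add_left]
      · intro i hi
        rw [if_neg]
        have := Finset.mem_range.1 hi
        omega
    -- If `q j > a`, the binomial coefficient on the left vanishes because `r < b - j`, and no index
    -- `i ≤ a / q` on the right reaches `j`.
    · rw [Finset.sum_eq_zero]
      · split_ifs with hjb
        · rw [Nat.choose_eq_zero_of_lt, Nat.cast_zero]
          rw [add_mul] at hT2
          omega
        · rfl
      · intro i hi
        rw [if_neg]
        intro hji
        exact hja ((Nat.mul_le_mul_left _ hji).trans (hlt i hi).1)
  · rw [if_neg (fun h => hT ⟨h.1, h.2.1⟩), Finset.sum_eq_zero]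
    intro i hi
    have := hlt i hi
    rw [Nat.sub_add_cancel (by omega), if_neg (fun h => hT ⟨h.1, h.2.1⟩), mul_zero]

end Adem

/-! ### The homomorphism `ρ` and its image -/

section Rho

set_option linter.unusedSectionVars false

variable (F : Type*) [Field F] (p e : ℕ) [hp : Fact p.Prime] [CharP F p]

/-- The homomorphism from the free algebra to the Milnor algebra. -/
def freeRho : FreeAlgebra F ℕ →ₐ[F] MilnorAlg F p e :=
  FreeAlgebra.lift F fun r => dualMonomial F p e (Finsupp.single 1 r)

theorem freeRho_ι (r : ℕ) :
    freeRho F p e (FreeAlgebra.ι F r) = dualMonomial F p e (Finsupp.single 1 r) :=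
  FreeAlgebra.lift_ι_apply _ _

theorem freeRho_rel (he : e ≠ 0) ⦃x y : FreeAlgebra F ℕ⦄ (h : AdemRel F (p ^ e) x y) :
    freeRho F p e x = freeRho F p e y := by
  cases h with
  | zero => rw [freeRho_ι, map_one, Finsupp.single_zero, one_eq_dualMonomial]
  | adem a b h =>
    rw [map_mul, map_sum]
    simp only [map_smul, map_mul, freeRho_ι]
    exact adem_milnor he a b h

/-- The homomorphism `A_q → (F[ξ_1, ξ_2, …])*`. -/
def rho (he : e ≠ 0) : SteenrodAlg F (p ^ e) →ₐ[F] MilnorAlg F p e :=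
  RingQuot.liftAlgHom F ⟨freeRho F p e, freeRho_rel F p e he⟩

variable {F p e}

theorem rho_stP (he : e ≠ 0) (r : ℕ) :
    rho F p e he (stP F (p ^ e) r) = dualMonomial F p e (Finsupp.single 1 r) :=
  (RingQuot.liftAlgHom_mkAlgHom_apply F (freeRho F p e) (freeRho_rel F p e he) _).trans
    (freeRho_ι F p e r)

theorem rho_stP_pow (he : e ≠ 0) (i : ℕ) : rho F p e he (stP F (p ^ e) (p ^ i)) = milP F p e 1 i :=
  rho_stP he _

theorem exists_rho_eq (he : e ≠ 0) {n : ℕ} {f : MilnorAlg F p e} (hf : f ∈ wordFil F p e n 0) :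
    ∃ x ∈ subAlg F p e n, rho F p e he x = f := by
  have : wordFil F p e n 0 ≤ (subAlg F p e n).toSubmodule.map (rho F p e he).toLinearMap := by
    refine Submodule.span_le.2 ?_
    rintro _ ⟨L, h1, -, rfl⟩
    refine ⟨(L.map fun a => stP F (p ^ e) (p ^ a)).prod, ?_, ?_⟩
    · refine Subalgebra.list_prod_mem _ fun x hx => ?_
      obtain ⟨a, ha, rfl⟩ := List.mem_map.1 hx
      exact Algebra.subset_adjoin ⟨a, h1 a ha, rfl⟩
    · change rho F p e he _ = _
      rw [map_list_prod, List.map_map]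
      congr 1
      exact List.map_congr_left fun a _ => rho_stP_pow he a
  exact this hf

/-- Every `R` lies in some profile, and there words in the `P^(p^i)` span. This gives both the
existence of the `P(R)` and the lower bound in the counting argument for injectivity. -/
theorem exists_rho_eq_dualMonomial (he : e ≠ 0) (R : ℕ+ →₀ ℕ) :
    ∃ x, rho F p e he x = dualMonomial F p e R := by
  obtain ⟨n, hn⟩ := exists_inProfile (p := p) he R
  obtain ⟨x, -, hx⟩ := exists_rho_eq he (n := n) (f := dualMonomial F p e R) (by
    rw [← profFil_eq_wordFil he]
    exact dualMonomial_mem_profFil hn (Nat.zero_le _))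
  exact ⟨x, hx⟩

end Rho

/-! ### Admissible words -/

section Admissible

set_option linter.unusedSectionVars false

/-- Admissible sequences: positive entries with `a_i ≥ q a_{i+1}`. -/
def Admissible (q : ℕ) : List ℕ → Prop
  | [] => True
  | a :: l => 0 < a ∧ q * l.headD 0 ≤ a ∧ Admissible q l

/-- The moment `∑ i a_i`. -/
def moment : List ℕ → ℕ
  | [] => 0
  | a :: l => a + (moment l + l.sum)

theorem moment_append (u v : List ℕ) :
    moment (u ++ v) = moment u + moment v + u.length * v.sum := by
  induction u with
  | nil => simp [moment]
  | cons a u ih =>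
    rw [List.cons_append, moment, moment, ih, List.sum_append, List.length_cons]
    ring

theorem not_admissible_iff {q : ℕ} {l : List ℕ} (h : ¬ Admissible q l) :
    (∃ u v, l = u ++ 0 :: v) ∨ ∃ u a b v, l = u ++ a :: b :: v ∧ a < q * b := by
  induction l with
  | nil => exact absurd trivial h
  | cons a l ih =>
    by_cases hl : Admissible q l
    · rcases Nat.eq_zero_or_pos a with rfl | ha
      · exact Or.inl ⟨[], l, rfl⟩
      · have h1 : a < q * l.headD 0 := by
          by_contra h'
          exact h ⟨ha, not_lt.1 h', hl⟩
        cases l with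
        | nil => simp at h1
        | cons b v => exact Or.inr ⟨[], a, b, v, rfl, h1⟩
    · rcases ih hl with ⟨u, v, rfl⟩ | ⟨u, b, c, v, rfl, h1⟩
      · exact Or.inl ⟨a :: u, v, rfl⟩
      · exact Or.inr ⟨a :: u, b, c, v, rfl, h1⟩

/-- The product of Steenrod powers with the exponents in a list. -/
def word (F : Type*) [Field F] (q : ℕ) (l : List ℕ) : SteenrodAlg F q := (l.map (stP F q)).prod

variable {F : Type*} [Field F]

theorem word_append (q : ℕ) (u v : List ℕ) : word F q (u ++ v) = word F q u * word F q v := by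
  simp [word]

theorem word_cons (q a : ℕ) (l : List ℕ) : word F q (a :: l) = stP F q a * word F q l := by
  simp [word]

theorem stP_zero (q : ℕ) : stP F q 0 = 1 := by
  have h : stP F q 0 = RingQuot.mkAlgHom F (AdemRel F q) 1 :=
    RingQuot.mkAlgHom_rel F (AdemRel.zero : AdemRel F q _ _)
  rw [h]
  exact map_one (RingQuot.mkAlgHom F (AdemRel F q))

theorem stP_mul_stP {q a b : ℕ} (h : a < q * b) : stP F q a * stP F q b =
    ∑ j ∈ Finset.range (a / q + 1),
      ((-1 : F) ^ (a + j) * (((q - 1) * (b - j) - 1).choose (a - q * j) : F)) •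
        (stP F q (a + b - j) * stP F q j) := by
  have h1 := RingQuot.mkAlgHom_rel F (AdemRel.adem (F := F) a b h)
  rw [map_mul, map_sum] at h1
  simp only [map_smul, map_mul] at h1
  exact h1

/-- The rewriting terminates because moment plus length decreases: an Adem relation moves `b - j >
0` one place to the left and so lowers the moment, and deleting `P^0` shortens the word without
raising the moment. -/
theorem word_mem_span_admissible (q : ℕ) (l : List ℕ) :
    word F q l ∈ Submodule.span F (word F q '' {l | Admissible q l}) := by
  induction hm : moment l + l.length using Nat.strong_induction_on generalizing l with
  | _ m ih =>
    by_cases hl : Admissible q l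
    · exact Submodule.subset_span ⟨l, hl, rfl⟩
    · rcases not_admissible_iff hl with ⟨u, v, rfl⟩ | ⟨u, a, b, v, rfl, hab⟩
      · have h1 : word F q (u ++ 0 :: v) = word F q (u ++ v) := by
          rw [word_append, word_append, word_cons, stP_zero, one_mul]
        rw [h1]
        refine ih _ ?_ _ rfl
        rw [← hm, moment_append, moment_append, moment]
        simp only [List.length_append, List.length_cons, List.sum_cons, zero_add]
        omega
      · have h1 : word F q (u ++ a :: b :: v) = ∑ j ∈ Finset.range (a / q + 1),
            ((-1 : F) ^ (a + j) * (((q - 1) * (b - j) - 1).choose (a - q * j) : F)) •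
              word F q (u ++ (a + b - j) :: j :: v) := by
          rw [word_append, word_cons, word_cons, ← mul_assoc (stP F q a), stP_mul_stP hab,
            Finset.sum_mul, Finset.mul_sum]
          refine Finset.sum_congr rfl fun j _ => ?_
          rw [word_append, word_cons, word_cons, smul_mul_assoc, mul_smul_comm, mul_assoc]
        rw [h1]
        refine Submodule.sum_mem _ fun j hj => Submodule.smul_mem _ _ (ih _ ?_ _ rfl)
        have hjb : j < b := by
          have h2 : a / q < b := Nat.div_lt_of_lt_mul hab
          have := Finset.mem_range.1 hj
          omega
        rw [← hm, moment_append, moment_append]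
        simp only [moment, List.length_append, List.length_cons, List.sum_cons]
        rw [show a + b - j + (j + v.sum) = a + (b + v.sum) by omega]
        omega

/-- Words in the generators span an algebra given by generators and relations. -/
theorem span_range_prod_eq_top {X : Type*} (r : FreeAlgebra F X → FreeAlgebra F X → Prop) :
    Submodule.span F (Set.range fun l : List X =>
      (l.map fun a => RingQuot.mkAlgHom F r (FreeAlgebra.ι F a)).prod) = ⊤ := by
  have h1 := congrArg (Subalgebra.map (RingQuot.mkAlgHom F r))
    (FreeAlgebra.adjoin_range_ι (R := F) (X := X))
  rw [AlgHom.map_adjoin, Algebra.map_top, ← Set.range_comp,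
    (AlgHom.range_eq_top _).2 (RingQuot.mkAlgHom_surjective F r)] at h1
  have h2 := congrArg Subalgebra.toSubmodule h1
  rw [Algebra.adjoin_eq_span, Algebra.top_toSubmodule] at h2
  rw [eq_top_iff, ← h2]
  refine Submodule.span_mono fun x hx => ?_
  obtain ⟨L, hL, rfl⟩ := Submonoid.exists_list_of_mem_closure hx
  have : ∃ l : List X, L = l.map fun a => RingQuot.mkAlgHom F r (FreeAlgebra.ι F a) := by
    clear hx
    induction L with
    | nil => exact ⟨[], rfl⟩
    | cons x L ih =>
      obtain ⟨a, rfl⟩ := hL x (by simp)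
      obtain ⟨l, rfl⟩ := ih fun y hy => hL y (by simp [hy])
      exact ⟨a :: l, rfl⟩
  obtain ⟨l, rfl⟩ := this
  exact ⟨l, rfl⟩

theorem word_span_eq_top (q : ℕ) :
    Submodule.span F (Set.range (word F q)) = (⊤ : Submodule F (SteenrodAlg F q)) :=
  span_range_prod_eq_top (AdemRel F q)

theorem admissible_span_eq_top (q : ℕ) :
    Submodule.span F (word F q '' {l | Admissible q l}) = (⊤ : Submodule F (SteenrodAlg F q)) := by
  rw [eq_top_iff, ← word_span_eq_top, Submodule.span_le]
  rintro _ ⟨l, rfl⟩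
  exact word_mem_span_admissible q l

/-- Shift an exponent sequence by one position. -/
def shiftExp (R : ℕ+ →₀ ℕ) : ℕ+ →₀ ℕ := R.mapDomain (· + 1)

/-- The exponent sequence `r_i = a_i - q a_{i+1}` of an admissible sequence. -/
def admExp (q : ℕ) : List ℕ → (ℕ+ →₀ ℕ)
  | [] => 0
  | a :: l => Finsupp.single 1 (a - q * l.headD 0) + shiftExp (admExp q l)

/-- The sum `∑ q ^ (k - 1) r_k`. -/
def lead (q : ℕ) (R : ℕ+ →₀ ℕ) : ℕ := R.sum fun k r => q ^ ((k : ℕ) - 1) * r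

theorem shiftExp_apply_one (R : ℕ+ →₀ ℕ) : shiftExp R 1 = 0 := by
  refine Finsupp.mapDomain_of_notMem_range _ _ ?_
  rintro ⟨k, hk⟩
  have := congrArg PNat.val hk
  have h1 := k.pos
  change (k : ℕ) + 1 = 1 at this
  omega

theorem shiftExp_injective : Function.Injective shiftExp :=
  Finsupp.mapDomain_injective (add_left_injective 1)

theorem lead_add (q : ℕ) (R S : ℕ+ →₀ ℕ) : lead q (R + S) = lead q R + lead q S :=
  Finsupp.sum_add_index' (by simp) (by intros; ring)

theorem lead_shiftExp (q : ℕ) (R : ℕ+ →₀ ℕ) : lead q (shiftExp R) = q * lead q R := by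
  rw [lead, shiftExp, Finsupp.sum_mapDomain_index (by simp) (by intros; ring), lead, Finsupp.mul_sum]
  refine Finsupp.sum_congr fun k _ => ?_
  have : ((k + 1 : ℕ+) : ℕ) - 1 = (k : ℕ) - 1 + 1 := by
    have := k.pos
    rw [PNat.add_coe, PNat.one_coe]; omega
  rw [this, pow_succ]
  ring

theorem deg_shiftExp (q : ℕ) (R : ℕ+ →₀ ℕ) : deg q (shiftExp R) = deg q R + q * lead q R := by
  rw [deg, shiftExp, Finsupp.sum_mapDomain_index (by simp) (by intros; ring), lead, Finsupp.mul_sum,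
    deg, ← Finsupp.sum_add]
  refine Finsupp.sum_congr fun k _ => ?_
  obtain ⟨j, hj⟩ : ∃ j, (k : ℕ) = j + 1 := ⟨(k : ℕ) - 1, by have := k.pos; omega⟩
  rw [PNat.add_coe, PNat.one_coe, brk, Finset.sum_range_succ, ← brk, hj, Nat.add_sub_cancel]
  ring

/-- The sum `∑ q^(k-1) (a_k - q a_{k+1})` telescopes to `a_1`; admissibility ensures that no
subtraction is truncated. -/
theorem lead_admExp {q : ℕ} {l : List ℕ} (h : Admissible q l) : lead q (admExp q l) = l.headD 0 := by
  induction l with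
  | nil => exact Finsupp.sum_zero_index
  | cons a l ih =>
    obtain ⟨-, h2, h3⟩ := h
    rw [admExp, lead_add, lead_shiftExp, ih h3, lead, Finsupp.sum_single_index (by simp)]
    simp at h2 ⊢
    omega

theorem deg_admExp {q : ℕ} {l : List ℕ} (h : Admissible q l) : deg q (admExp q l) = l.sum := by
  induction l with
  | nil => exact deg_zero q
  | cons a l ih =>
    obtain ⟨-, h2, h3⟩ := h
    rw [admExp, deg_add, deg_shiftExp, lead_admExp h3, ih h3, deg_single, List.sum_cons]
    simp [brk] at h2 ⊢
    omega

/-- The shifted part determines the tail, and then `a_1 = r_1 + q a_2`. Since entries are positive,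
`lead` tells the empty sequence from the others. -/
theorem admExp_injOn {q : ℕ} {l l' : List ℕ} (h : Admissible q l) (h' : Admissible q l')
    (heq : admExp q l = admExp q l') : l = l' := by
  induction l generalizing l' with
  | nil =>
    cases l' with
    | nil => rfl
    | cons b l' =>
      have h1 := lead_admExp h'
      rw [← heq, lead_admExp h] at h1
      have := h'.1
      simp at h1
      omega
  | cons a l ih =>
    cases l' with
    | nil =>
      have h1 := lead_admExp h
      rw [heq, lead_admExp h'] at h1
      have := h.1
      simp at h1
      omega
    | cons b l' =>
      have h1 := DFunLike.congr_fun heq 1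
      simp only [admExp, Finsupp.add_apply, Finsupp.single_eq_same, shiftExp_apply_one,
        add_zero] at h1
      rw [admExp, admExp, h1] at heq
      have h2 := ih h.2.2 h'.2.2 (shiftExp_injective (add_left_cancel heq))
      subst h2
      have h3 := h.2.1
      have h4 := h'.2.1
      congr 1
      omega

theorem le_brk {q : ℕ} (hq : 0 < q) (k : ℕ) : k ≤ brk q k := by
  calc k = ∑ i ∈ Finset.range k, 1 := by simp
    _ ≤ _ := Finset.sum_le_sum fun i _ => pow_pos hq i

theorem deg_finite {q : ℕ} (hq : 0 < q) (d : ℕ) : {R | deg q R = d}.Finite := by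
  classical
  have : {R | deg q R = d} ⊆ Set.Iic
      (∑ k ∈ Finset.Icc (1 : ℕ+) d.succPNat, Finsupp.single k d) := by
    intro R hR
    refine (Finsupp.le_iff _ _).2 fun k hk => ?_
    have h1 : brk q k * R k ≤ d := by
      rw [← (hR : deg q R = d)]
      exact Finset.single_le_sum (f := fun k : ℕ+ => brk q k * R k) (fun _ _ => Nat.zero_le _) hk
    have h2 := le_brk hq k
    have h3 : 0 < R k := Nat.pos_of_ne_zero (Finsupp.mem_support_iff.1 hk)
    have h4 := k.pos
    have hkd : (k : ℕ) ≤ d := h2.trans ((Nat.le_mul_of_pos_right _ h3).trans h1)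
    have hRd : R k ≤ d := (Nat.le_mul_of_pos_left _ (h4.trans_le h2)).trans h1
    rw [Finsupp.finsetSum_apply]
    have hmem : k ∈ Finset.Icc (1 : ℕ+) d.succPNat := by
      rw [Finset.mem_Icc]
      refine ⟨one_le, ?_⟩
      rw [← PNat.coe_le_coe, Nat.succPNat_coe]
      omega
    refine hRd.trans (le_trans ?_ (Finset.single_le_sum (fun _ _ => Nat.zero_le _) hmem))
    simp
  exact (Set.finite_Iic _).subset this

end Admissible

/-! ### Injectivity of `ρ` by counting in each degree -/

section Injectivity

set_option linter.unusedSectionVars false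

variable {F : Type*} [Field F] {p e : ℕ} [hp : Fact p.Prime] [CharP F p]

theorem linearIndependent_dualMonomial : LinearIndependent F (dualMonomial F p e) := by
  rw [linearIndependent_iff']
  intro s g h R hR
  have h1 := congrArg (evalAt F p e (mon F p e R)) h
  rw [map_sum, map_zero] at h1
  simp only [map_smul, evalAt_apply, dualMonomial_mon, smul_eq_mul, mul_ite, mul_one, mul_zero,
    Finset.sum_ite_eq, if_pos hR] at h1
  exact h1

/-- The image of a word of Steenrod powers is homogeneous. -/
theorem rho_word_apply_eq_zero (he : e ≠ 0) (l : List ℕ) {S : ℕ+ →₀ ℕ}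
    (hS : deg (p ^ e) S ≠ l.sum) : (rho F p e he (word F (p ^ e) l)).ofConv (mon F p e S) = 0 := by
  induction l using List.reverseRecOn generalizing S with
  | nil =>
    rw [word, List.map_nil, List.prod_nil, map_one, one_eq_dualMonomial, dualMonomial_mon, if_neg]
    rintro rfl
    exact hS (deg_zero _)
  | append_singleton l a ih =>
    rw [word_append, map_mul, word_cons, map_mul, rho_stP]
    have : word F (p ^ e) [] = 1 := rfl
    rw [this, map_one, mul_one, mul_single_apply]
    refine vanish_of_mem_span (fun S' hS' => ih ?_) (act_deg 1 a S)
    simp only [Set.mem_ofPred_eq] at hS'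
    intro h
    apply hS
    rw [← hS', h]
    simp [brk]

/-- Admissible words of degree `d` inject into the `R` of degree `d`, whose dual monomials are
independent and lie in the span of the images of these words. That span thus has dimension at least
the number of words. -/
theorem linearIndepOn_rho_word_sum (he : e ≠ 0) (d : ℕ) :
    LinearIndepOn F (fun l => rho F p e he (word F (p ^ e) l))
      {l | Admissible (p ^ e) l ∧ l.sum = d} := by
  have hq : 0 < p ^ e := pow_pos hp.out.pos e
  have hfin := deg_finite hq d
  have := hfin.to_subtype
  let f : {l | Admissible (p ^ e) l ∧ l.sum = d} → {R | deg (p ^ e) R = d} :=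
    fun l => ⟨admExp (p ^ e) l.1, (deg_admExp l.2.1).trans l.2.2⟩
  have hf : Function.Injective f := fun l l' h =>
    Subtype.ext (admExp_injOn l.2.1 l'.2.1 (congrArg Subtype.val h))
  have hfinl := Finite.of_injective f hf
  have := Fintype.ofFinite {R | deg (p ^ e) R = d}
  have := Fintype.ofFinite {l | Admissible (p ^ e) l ∧ l.sum = d}
  rw [LinearIndepOn, linearIndependent_iff_card_le_finrank_span]
  refine (Fintype.card_le_of_injective f hf).trans ?_
  have hli : LinearIndependent F (fun R : {R | deg (p ^ e) R = d} => dualMonomial F p e R.1) :=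
    linearIndependent_dualMonomial.comp _ Subtype.val_injective
  rw [← finrank_span_eq_card hli, Set.finrank]
  have : FiniteDimensional F (Submodule.span F (Set.range
      fun l : {l | Admissible (p ^ e) l ∧ l.sum = d} => rho F p e he (word F (p ^ e) l))) :=
    FiniteDimensional.span_of_finite F (Set.finite_range _)
  refine Submodule.finrank_mono (Submodule.span_le.2 ?_)
  rintro _ ⟨⟨R, hR⟩, rfl⟩
  obtain ⟨x, hx⟩ := exists_rho_eq_dualMonomial (F := F) he R
  have hx' : x ∈ Submodule.span F (word F (p ^ e) '' {l | Admissible (p ^ e) l}) := by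
    rw [admissible_span_eq_top]; trivial
  -- `proj f g` says that `g` is the degree `d` component of `f`; it discards words of other degrees
  -- from a preimage of the dual monomial.
  let proj : MilnorAlg F p e → MilnorAlg F p e → Prop := fun f g =>
    ∀ S, g.ofConv (mon F p e S) = if deg (p ^ e) S = d then f.ofConv (mon F p e S) else 0
  have key : ∃ g ∈ Submodule.span F (Set.range
      fun l : {l | Admissible (p ^ e) l ∧ l.sum = d} => rho F p e he (word F (p ^ e) l)),
      proj (rho F p e he x) g := by
    clear hx
    induction hx' using Submodule.span_induction with
    | mem x hx =>
      obtain ⟨l, hl, rfl⟩ := hx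
      by_cases hld : l.sum = d
      · refine ⟨_, Submodule.subset_span ⟨⟨l, hl, hld⟩, rfl⟩, fun S => ?_⟩
        split_ifs with h
        · rfl
        · exact rho_word_apply_eq_zero he l (hld ▸ h)
      · refine ⟨0, zero_mem _, fun S => ?_⟩
        split_ifs with h
        · exact (rho_word_apply_eq_zero he l (h ▸ Ne.symm hld)).symm
        · rfl
    | zero => exact ⟨0, zero_mem _, fun S => by rw [map_zero]; simp⟩
    | add x y _ _ hx hy =>
      obtain ⟨g, hg, h1⟩ := hx
      obtain ⟨g', hg', h1'⟩ := hy
      refine ⟨g + g', add_mem hg hg', fun S => ?_⟩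
      rw [map_add, WithConv.ofConv_add, WithConv.ofConv_add, LinearMap.add_apply,
        LinearMap.add_apply, h1, h1']
      split_ifs <;> simp
    | smul c x _ hx =>
      obtain ⟨g, hg, h1⟩ := hx
      refine ⟨c • g, Submodule.smul_mem _ _ hg, fun S => ?_⟩
      rw [map_smul, WithConv.ofConv_smul, WithConv.ofConv_smul, LinearMap.smul_apply,
        LinearMap.smul_apply, h1]
      split_ifs <;> simp
  obtain ⟨g, hg, hproj⟩ := key
  have : dualMonomial F p e R = g := by
    refine milnor_ext fun S => ?_
    rw [hproj S, hx]
    split_ifs with h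
    · rfl
    · rw [dualMonomial_mon, if_neg]
      rintro rfl
      exact h hR
  change dualMonomial F p e R ∈ _
  rw [this]
  exact hg

/-- Words with different sums have images supported in different degrees, so a relation splits by
degree. -/
theorem linearIndepOn_rho_word (he : e ≠ 0) :
    LinearIndepOn F (fun l => rho F p e he (word F (p ^ e) l)) {l | Admissible (p ^ e) l} := by
  rw [linearIndepOn_iff']
  intro s g hs h l hl
  have h1 := linearIndepOn_iff'.1 (linearIndepOn_rho_word_sum (F := F) he l.sum)
    (s.filter fun l' => l'.sum = l.sum) g ?_ ?_ l (by simp [hl])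
  · exact h1
  · intro l' hl'
    rw [Finset.coe_filter] at hl'
    exact ⟨hs hl'.1, hl'.2⟩
  · refine milnor_ext fun S => ?_
    rw [← evalAt_apply, ← evalAt_apply, map_sum, map_zero]
    have h2 := congrArg (evalAt F p e (mon F p e S)) h
    rw [map_sum, map_zero] at h2
    simp only [map_smul, evalAt_apply, smul_eq_mul] at h2 ⊢
    rw [Finset.sum_filter]
    by_cases hS : deg (p ^ e) S = l.sum
    · refine (Finset.sum_congr rfl fun l' _ => ?_).trans h2
      split_ifs with h3
      · rfl
      · rw [rho_word_apply_eq_zero he l' (fun h4 => h3 (h4.symm.trans hS)), mul_zero]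
    · refine Finset.sum_eq_zero fun l' _ => ?_
      split_ifs with h3
      · rw [rho_word_apply_eq_zero he l' (h3 ▸ hS), mul_zero]
      · rfl

/-- The Adem relations imply all relations between the Steenrod powers in the Milnor algebra. -/
theorem rho_injective (he : e ≠ 0) : Function.Injective (rho F p e he) := by
  refine (injective_iff_map_eq_zero (rho F p e he)).2 fun x hx => ?_
  have hx' : x ∈ Submodule.span F (word F (p ^ e) '' {l | Admissible (p ^ e) l}) := by
    rw [admissible_span_eq_top]; trivial
  rw [Finsupp.mem_span_image_iff_linearCombination] at hx'
  obtain ⟨c, hc, hcx⟩ := hx'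
  have h1 : Finsupp.linearCombination F (fun l => rho F p e he (word F (p ^ e) l)) c = 0 := by
    rw [← hx, ← hcx, Finsupp.linearCombination_apply, Finsupp.linearCombination_apply, map_finsuppSum]
    simp only [map_smul]
  have h2 := linearIndepOn_rho_word (F := F) (p := p) he
  rw [linearIndepOn_iff] at h2
  rw [← hcx, h2 c hc h1, map_zero]

end Injectivity

/-! ### Computations in the associated graded algebra -/

section GrLemmas

set_option linter.unusedSectionVars false

variable (F : Type*) [Field F] {A : Type*} [Ring A] [Algebra F A] {I : Ideal A} [I.IsTwoSided]

/-- The linear map `I ^ k → Gr`. -/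
def grOfLin (I : Ideal A) [I.IsTwoSided] (k : ℕ) : powSub F I k →ₗ[F] Gr F I :=
  DirectSum.lof F ℕ (GrPiece F I) k ∘ₗ grQ F I k

theorem grOf_eq_zero {k : ℕ} {x : A} (hx : x ∈ I ^ k) : grOf F k x hx = 0 ↔ x ∈ I ^ (k + 1) := by
  rw [← grMk_eq_zero F hx]
  exact ⟨fun h => DirectSum.of_injective k (h.trans (map_zero _).symm),
    fun h => (congrArg (DirectSum.of (GrPiece F I) k) h).trans (map_zero _)⟩

theorem grOf_mul {i j : ℕ} {x y : A} (hx : x ∈ I ^ i) (hy : y ∈ I ^ j) :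
    grOf F i x hx * grOf F j y hy = grOf F (i + j) (x * y) (mul_mem_pow hx hy) :=
  DirectSum.of_mul_of _ _

theorem grOf_congr {i j : ℕ} {x y : A} (hx : x ∈ I ^ i) (hij : i = j) (hxy : x = y) :
    grOf F i x hx = grOf F j y (hij ▸ hxy ▸ hx) := by
  subst hij; subst hxy; rfl

theorem grOf_one : grOf F 0 (1 : A) (mem_pow_zero (I := I) 1) = 1 := rfl

theorem grOf_sub {k : ℕ} {x y : A} (hx : x ∈ I ^ k) (hy : y ∈ I ^ k) :
    grOf F k (x - y) (sub_mem hx hy) = grOf F k x hx - grOf F k y hy :=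
  map_sub (grOfLin F I k) ⟨x, hx⟩ ⟨y, hy⟩

theorem pow_mem_pow_mul {i : ℕ} {x : A} (hx : x ∈ I ^ i) (m : ℕ) : x ^ m ∈ I ^ (i * m) := by
  induction m with
  | zero => exact mem_pow_zero (I := I) _
  | succ m ih =>
    rw [pow_succ, Nat.mul_succ]
    exact mul_mem_pow ih hx

theorem grOf_pow {i : ℕ} {x : A} (hx : x ∈ I ^ i) (m : ℕ) :
    grOf F i x hx ^ m = grOf F (i * m) (x ^ m) (pow_mem_pow_mul hx m) := by
  induction m with
  | zero =>
    rw [pow_zero, ← grOf_one F (I := I)]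
    exact grOf_congr F _ (Nat.mul_zero i).symm (pow_zero x).symm
  | succ m ih =>
    rw [pow_succ, ih, grOf_mul]
    exact grOf_congr F _ (Nat.mul_succ _ _).symm (pow_succ _ _).symm

theorem grOf_apply_same {k : ℕ} {x : A} (hx : x ∈ I ^ k) : grOf F k x hx k = grMk F k x hx :=
  DirectSum.of_eq_same k _

theorem grOf_apply_ne {k l : ℕ} {x : A} (hx : x ∈ I ^ k) (h : k ≠ l) : grOf F k x hx l = 0 :=
  DirectSum.of_eq_of_ne k l _ h.symm

/-- A subalgebra of the graded algebra which contains all homogeneous elements is everything. -/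
theorem subalgebra_eq_top {B : Subalgebra F (Gr F I)}
    (h : ∀ k x (hx : x ∈ I ^ k), grOf F k x hx ∈ B) : B = ⊤ := by
  rw [eq_top_iff]
  intro y _
  induction y using DirectSum.induction_on with
  | zero => exact zero_mem _
  | of k a =>
    obtain ⟨x, hx, rfl⟩ := exists_grMk F a
    exact h k x hx
  | add x y hx hy => exact add_mem (hx trivial) (hy trivial)

end GrLemmas

/-! ### Powers of the augmentation ideal and the weight filtration -/

section Augmentation

set_option linter.unusedSectionVars false

variable {F : Type*} [Field F] {p e : ℕ} [hp : Fact p.Prime] [CharP F p]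

theorem aug_stP (q r : ℕ) : aug F q (stP F q r) = if r = 0 then 1 else 0 := by
  refine (RingQuot.liftAlgHom_mkAlgHom_apply F (freeAug F) (freeAug_rel F q) _).trans ?_
  exact FreeAlgebra.lift_ι_apply _ _

/-- Here `x` is not confined to a given profile; it is instead expanded in words in the `P^a`, each
of which is dual to a power of `ξ_1`. -/
theorem mul_rho_mem_wtFil (he : e ≠ 0) {k : ℕ} {f : MilnorAlg F p e} (hf : f ∈ wtFil F p e k)
    (x : SteenrodAlg F (p ^ e)) : f * rho F p e he x ∈ wtFil F p e k := by
  have hx : x ∈ Submodule.span F (Set.range (word F (p ^ e))) := by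
    rw [word_span_eq_top]; trivial
  induction hx using Submodule.span_induction with
  | mem x hx =>
    obtain ⟨l, rfl⟩ := hx
    induction l generalizing f with
    | nil =>
      have : word F (p ^ e) [] = 1 := rfl
      rwa [this, map_one, mul_one]
    | cons a l ih =>
      rw [word_cons, map_mul, rho_stP, ← mul_assoc]
      exact ih (wtFil_antitone (Nat.le_add_right _ _) (mul_single_mem_wtFil hf 1 a))
  | zero => rw [map_zero, mul_zero]; exact zero_mem _
  | add x y _ _ hx hy => rw [map_add, mul_add]; exact add_mem hx hy
  | smul c x _ hx => rw [map_smul, mul_smul_comm]; exact Submodule.smul_mem _ _ hx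

/-- A word containing some `P^a` with `a > 0` has augmentation zero, and that factor raises the
weight by the digit sum of `a`, which is positive. -/
theorem mul_rho_sub_aug_mem_wtFil (he : e ≠ 0) {k : ℕ} {f : MilnorAlg F p e}
    (hf : f ∈ wtFil F p e k) (x : SteenrodAlg F (p ^ e)) :
    f * rho F p e he x - aug F (p ^ e) x • f ∈ wtFil F p e (k + 1) := by
  have hx : x ∈ Submodule.span F (Set.range (word F (p ^ e))) := by
    rw [word_span_eq_top]; trivial
  induction hx using Submodule.span_induction with
  | mem x hx =>
    obtain ⟨l, rfl⟩ := hx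
    induction l generalizing f with
    | nil =>
      have : word F (p ^ e) [] = 1 := rfl
      rw [this, map_one, map_one, mul_one, one_smul, sub_self]
      exact zero_mem _
    | cons a l ih =>
      rw [word_cons, map_mul, map_mul, aug_stP]
      rcases Nat.eq_zero_or_pos a with rfl | ha
      · rw [if_pos rfl, one_mul, stP_zero, map_one, one_mul]
        exact ih hf
      · rw [if_neg ha.ne', zero_mul, zero_smul, sub_zero, rho_stP, ← mul_assoc]
        refine mul_rho_mem_wtFil he (wtFil_antitone ?_ (mul_single_mem_wtFil hf 1 a)) _
        have := dsum_pos (p := p) ha.ne'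
        rw [PNat.one_coe, one_mul]
        omega
  | zero => rw [map_zero, map_zero, mul_zero, zero_smul, sub_zero]; exact zero_mem _
  | add x y _ _ hx hy =>
    rw [map_add, map_add, mul_add, add_smul, add_sub_add_comm]
    exact add_mem hx hy
  | smul c x _ hx =>
    rw [map_smul, map_smul, mul_smul_comm, smul_eq_mul, mul_smul, ← smul_sub]
    exact Submodule.smul_mem _ _ hx

/-- The form with a ring homomorphism `g` covers the augmentation ideals of `A_q(n-2)` and of `A_q`
together. -/
theorem rho_mem_wtFil_of_mem_pow (he : e ≠ 0) {A : Type*} [Ring A]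
    (g : A →+* SteenrodAlg F (p ^ e)) {J : Ideal A} (hJ : ∀ x ∈ J, aug F (p ^ e) (g x) = 0) (k : ℕ)
    {x : A} (hx : x ∈ J ^ k) : rho F p e he (g x) ∈ wtFil F p e k := by
  induction k generalizing x with
  | zero => exact mem_wtFil_zero _
  | succ k ih =>
    rw [Submodule.pow_succ] at hx
    refine Submodule.mul_induction_on hx (fun m hm n hn => ?_) (fun x y hx hy => ?_)
    · have := mul_rho_sub_aug_mem_wtFil he (ih hm) (g n)
      rwa [hJ n hn, zero_smul, sub_zero, ← map_mul, ← map_mul] at this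
    · rw [map_add, map_add]
      exact add_mem hx hy

theorem mem_augIdeal (n : ℕ) (x : subAlg F p e n) :
    x ∈ augIdeal F p e n ↔ aug F (p ^ e) x = 0 := Iff.rfl

theorem pow_augIdeal_le (n k : ℕ) : augIdeal F p e n ^ k ≤
    (RingHom.ker (aug F (p ^ e)) ^ k).comap (subAlg F p e n).val := by
  induction k with
  | zero => exact fun x _ => mem_pow_zero (I := RingHom.ker (aug F (p ^ e))) _
  | succ k ih =>
    intro x hx
    rw [Submodule.pow_succ] at hx
    refine Submodule.mul_induction_on hx (fun m hm n hn => ?_) (fun x y hx hy => add_mem hx hy)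
    rw [Ideal.mem_comap, map_mul]
    exact mul_mem_pow (j := 1) (ih hm) (by rw [Submodule.pow_one]; exact hn)

/-- The generator `P^(p^i)` of `A_q(n-2)`. -/
def subGen (F : Type*) [Field F] (p e n : ℕ) (i : ℕ) (hi : i < (n - 1) * e) : subAlg F p e n :=
  ⟨stP F (p ^ e) (p ^ i), Algebra.subset_adjoin ⟨i, hi, rfl⟩⟩

theorem subGen_mem {n i : ℕ} (hi : i < (n - 1) * e) :
    subGen F p e n i hi ∈ augIdeal F p e n := by
  rw [mem_augIdeal]
  change aug F (p ^ e) (stP F (p ^ e) (p ^ i)) = 0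
  rw [aug_stP, if_neg (pow_ne_zero i hp.out.ne_zero)]

theorem subGen_mem_pow {n i : ℕ} (hi : i < (n - 1) * e) :
    subGen F p e n i hi ∈ augIdeal F p e n ^ 1 := by
  rw [Submodule.pow_one]
  exact subGen_mem hi

/-- Words of length at least `k` in the generators of `A_q(n-2)` span its `k`th power filtration. -/
theorem exists_word_sum (he : e ≠ 0) {n k : ℕ} {f : MilnorAlg F p e} (hf : f ∈ wordFil F p e n k)
    {N : Submodule F (subAlg F p e n)}
    (hN : ∀ l : List {i // i < (n - 1) * e}, k ≤ l.length →
      (l.map fun i => subGen F p e n i.1 i.2).prod ∈ N) :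
    ∃ x ∈ N, rho F p e he x = f := by
  have : wordFil F p e n k ≤
      N.map ((rho F p e he).comp (subAlg F p e n).val).toLinearMap := by
    refine Submodule.span_le.2 ?_
    rintro _ ⟨L, h1, h2, rfl⟩
    refine ⟨(L.attach.map fun a => subGen F p e n a.1 (h1 a.1 a.2)).prod, ?_, ?_⟩
    · have := hN (L.attach.map fun a => ⟨a.1, h1 a.1 a.2⟩) (by simpa using h2)
      rw [List.map_map] at this
      exact this
    · change ((rho F p e he).comp (subAlg F p e n).val) _ = _
      rw [map_list_prod, List.map_map]
      have : L.map (fun a => milP F p e 1 a) = L.attach.map (fun a => milP F p e 1 a.1) := by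
        conv_lhs => rw [← List.attach_map_subtype_val L, List.map_map]
        rfl
      rw [this]
      congr 1
      exact List.map_congr_left fun a _ => rho_stP_pow he a.1
  exact this hf

theorem prod_subGen_mem {n : ℕ} (l : List {i // i < (n - 1) * e}) :
    (l.map fun i => subGen F p e n i.1 i.2).prod ∈ augIdeal F p e n ^ l.length := by
  induction l with
  | nil => exact mem_pow_zero _
  | cons a l ih =>
    rw [List.map_cons, List.prod_cons, List.length_cons, add_comm]
    exact mul_mem_pow (subGen_mem_pow a.2) ih

theorem rho_mem_profSub (he : e ≠ 0) {n : ℕ} {x : SteenrodAlg F (p ^ e)}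
    (hx : x ∈ subAlg F p e n) : rho F p e he x ∈ profSub F p e n := by
  induction hx using Algebra.adjoin_induction with
  | mem x hx =>
    obtain ⟨i, hi, rfl⟩ := hx
    rw [rho_stP_pow]
    refine (milP_mem_profFil ?_).2
    rw [mul_comm]
    exact hi
  | algebraMap r =>
    rw [AlgHom.commutes, Algebra.algebraMap_eq_smul_one]
    exact Submodule.smul_mem _ _ (one_mem_profSub n)
  | add x y _ _ hx hy => rw [map_add]; exact add_mem hx hy
  | mul x y _ _ hx hy => rw [map_mul]; exact mul_mem_profSub he hx hy

/-- The powers of the augmentation ideal of `A_q(n-2)` form the weight filtration. -/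
theorem mem_augIdeal_pow_iff (he : e ≠ 0) {n k : ℕ} (x : subAlg F p e n) :
    x ∈ augIdeal F p e n ^ k ↔ rho F p e he x ∈ wtFil F p e k := by
  constructor
  · exact fun hx => rho_mem_wtFil_of_mem_pow he
      ((subAlg F p e n).val : subAlg F p e n →+* SteenrodAlg F (p ^ e)) (fun y hy => hy) k hx
  · intro hx
    have hx' : rho F p e he x ∈ wordFil F p e n k := by
      rw [← profFil_eq_wordFil he]
      exact ⟨hx, rho_mem_profSub he x.2⟩
    obtain ⟨y, hy, hyx⟩ := exists_word_sum he hx' (N := powSub F (augIdeal F p e n) k)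
      (fun l hl => Ideal.pow_le_pow_right hl (prod_subGen_mem l))
    rwa [Subtype.ext (rho_injective he hyx)] at hy

/-- An element of `A_q(n-2)` in the `k`th power of the large ideal has weight at least `k`, hence
lies in the `k`th power of the small one by `mem_augIdeal_pow_iff`. -/
theorem augIdeal_pow_eq_comap (he : e ≠ 0) (n k : ℕ) : augIdeal F p e n ^ k =
    ((RingHom.ker (aug F (p ^ e))) ^ k).comap (subAlg F p e n).val := by
  refine le_antisymm (pow_augIdeal_le n k) fun x hx => ?_
  rw [mem_augIdeal_pow_iff he]
  exact rho_mem_wtFil_of_mem_pow he (RingHom.id _) (fun y hy => hy) k hx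

end Augmentation

/-! ### The Milnor basis and its classes in the graded algebra -/

section MilnorBasis

set_option linter.unusedSectionVars false

variable {F : Type*} [Field F] {p e : ℕ} [hp : Fact p.Prime] [CharP F p]

variable (F p e) in
/-- The Milnor basis element `P(R)`. -/
def milnorP (he : e ≠ 0) (R : ℕ+ →₀ ℕ) : SteenrodAlg F (p ^ e) :=
  (exists_rho_eq_dualMonomial he R).choose

theorem rho_milnorP (he : e ≠ 0) (R : ℕ+ →₀ ℕ) :
    rho F p e he (milnorP F p e he R) = dualMonomial F p e R :=
  (exists_rho_eq_dualMonomial he R).choose_spec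

theorem isMilnorBasis_milnorP (he : e ≠ 0) : IsMilnorBasis p e (milnorP F p e he) :=
  ⟨rho F p e he, rho_stP he, rho_injective he, rho_milnorP he⟩

theorem milnorP_mem (he : e ≠ 0) {n : ℕ} {R : ℕ+ →₀ ℕ} (hR : InProfile p e n R) :
    milnorP F p e he R ∈ subAlg F p e n := by
  obtain ⟨x, hx, hxR⟩ := exists_rho_eq he (n := n) (f := dualMonomial F p e R) (by
    rw [← profFil_eq_wordFil he]
    exact dualMonomial_mem_profFil hR (Nat.zero_le _))
  rwa [rho_injective he ((rho_milnorP he R).trans hxR.symm)]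

theorem milnorP_mem_pow (he : e ≠ 0) {n : ℕ} {R : ℕ+ →₀ ℕ} (hR : InProfile p e n R) :
    (⟨milnorP F p e he R, milnorP_mem he hR⟩ : subAlg F p e n) ∈ augIdeal F p e n ^ wt p R := by
  rw [mem_augIdeal_pow_iff he]
  change rho F p e he (milnorP F p e he R) ∈ _
  rw [rho_milnorP]
  exact dualMonomial_mem_wtFil le_rfl

variable (F p e) in
/-- The class of `P(R)` in the graded algebra. -/
def grMilnor (he : e ≠ 0) (n : ℕ) (R : {R : ℕ+ →₀ ℕ // InProfile p e n R}) : E0 F p e n :=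
  grOf F (wt p R.1) ⟨milnorP F p e he R.1, milnorP_mem he R.2⟩ (milnorP_mem_pow he R.2)

/-- In grading `k = wt R`, a relation puts a combination of the `P(S)` of weight `k` into the next
power of the ideal, whose functionals vanish on `ξ^R`; evaluation there isolates the coefficient of
`P(R)`. -/
theorem linearIndependent_grMilnor (he : e ≠ 0) (n : ℕ) :
    LinearIndependent F (grMilnor F p e he n) := by
  rw [linearIndependent_iff']
  intro s g h R hR
  set k := wt p R.1 with hk
  let y : {R : ℕ+ →₀ ℕ // InProfile p e n R} → subAlg F p e n :=
    fun S => ⟨milnorP F p e he S.1, milnorP_mem he S.2⟩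
  have hy (S) (hS : wt p S.1 = k) : y S ∈ augIdeal F p e n ^ k := hS ▸ milnorP_mem_pow he S.2
  have hz : ∑ S ∈ s.filter (fun S => wt p S.1 = k), g S • y S ∈ powSub F (augIdeal F p e n) k :=
    Submodule.sum_mem _ fun S hS => Submodule.smul_mem _ _ (hy S (Finset.mem_filter.1 hS).2)
  have h1 : grMk F k _ hz = 0 := by
    have h2 := congrArg (DirectSum.component F ℕ (GrPiece F (augIdeal F p e n)) k) h
    rw [map_sum, map_zero] at h2
    refine Eq.trans ?_ h2
    have h3 : (⟨_, hz⟩ : powSub F (augIdeal F p e n) k) =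
        ∑ S ∈ s, if hS : wt p S.1 = k then
          g S • (⟨y S, hy S hS⟩ : powSub F (augIdeal F p e n) k) else 0 := by
      apply Subtype.ext
      refine (Finset.sum_filter _ _).trans ?_
      rw [AddSubmonoidClass.coe_finsetSum]
      refine Finset.sum_congr rfl fun S _ => ?_
      split_ifs <;> rfl
    change grQ F (augIdeal F p e n) k ⟨_, hz⟩ = _
    rw [h3, map_sum]
    refine Finset.sum_congr rfl fun S _ => ?_
    rw [map_smul]
    by_cases hS : wt p S.1 = k
    · rw [dif_pos hS, map_smul]
      congr 1
      have : grMilnor F p e he n S = grOf F k (y S) (hy S hS) := grOf_congr F _ hS rfl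
      rw [this]
      exact (grOf_apply_same F (hy S hS)).symm
    · rw [dif_neg hS, map_zero]
      have : DirectSum.component F ℕ (GrPiece F (augIdeal F p e n)) k (grMilnor F p e he n S) = 0 :=
        grOf_apply_ne F _ hS
      rw [this, smul_zero]
  have hz' : ∑ S ∈ s.filter (fun S => wt p S.1 = k), g S • y S ∈ augIdeal F p e n ^ k := hz
  have h2 := (mem_augIdeal_pow_iff he _).1 ((grMk_eq_zero F hz').1 h1) R.1 (Nat.lt_succ_self _)
  have h3 : rho F p e he ((∑ S ∈ s.filter (fun S => wt p S.1 = k), g S • y S : subAlg F p e n)) =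
      ∑ S ∈ s.filter (fun S => wt p S.1 = k), g S • dualMonomial F p e S.1 := by
    change ((rho F p e he).comp (subAlg F p e n).val) _ = _
    rw [map_sum]
    refine Finset.sum_congr rfl fun S _ => ?_
    rw [map_smul]
    congr 1
    exact rho_milnorP he S.1
  rw [h3, ← evalAt_apply, map_sum] at h2
  simp only [map_smul, evalAt_apply, dualMonomial_mon, smul_eq_mul, mul_ite, mul_one,
    mul_zero] at h2
  rw [Finset.sum_eq_single R] at h2
  · rwa [if_pos rfl] at h2
  · intro S _ hSR
    rw [if_neg]
    exact fun h => hSR (Subtype.ext h.symm)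
  · intro hR'
    exact absurd (Finset.mem_filter.2 ⟨hR, hk.symm⟩) hR'

end MilnorBasis

/-! ### Sums of atomic numbers -/

section Atomic

set_option linter.unusedSectionVars false

theorem brk_one (q : ℕ) : brk q 1 = 1 := by simp [brk]

theorem brk_succ (q k : ℕ) : brk q (k + 1) = q * brk q k + 1 := by
  rw [brk_add, brk_one, pow_one, mul_comm]

theorem brk_lt_pow {q : ℕ} (hq : 2 ≤ q) (k : ℕ) : brk q k < q ^ k := by
  induction k with
  | zero => simp [brk]
  | succ k ih =>
    rw [brk_succ, pow_succ, mul_comm _ q]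
    have := Nat.mul_le_mul_left q (Nat.succ_le_of_lt ih)
    rw [Nat.mul_succ] at this
    omega

theorem brk_strictMono {q : ℕ} (hq : q ≠ 0) : StrictMono (brk q) := by
  refine strictMono_nat_of_lt_succ fun k => ?_
  rw [brk_succ]
  have := Nat.le_mul_of_pos_left (brk q k) (Nat.pos_of_ne_zero hq)
  omega

variable {p : ℕ} [hp : Fact p.Prime] {e : ℕ}

/-- The sum is `1` modulo `p`, so `p^s` is the exact power of `p` in `p^s brk q k`. -/
theorem not_dvd_brk (he : e ≠ 0) {k : ℕ} (hk : k ≠ 0) : ¬ p ∣ brk (p ^ e) k := by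
  obtain ⟨k, rfl⟩ := Nat.exists_eq_succ_of_ne_zero hk
  rw [Nat.succ_eq_add_one, brk_succ,
    ← Nat.dvd_add_iff_right ((dvd_pow_self p he).mul_right _)]
  exact hp.out.one_lt.ne' ∘ Nat.dvd_one.1

theorem two_le_pow (he : e ≠ 0) : 2 ≤ p ^ e :=
  hp.out.two_le.trans (Nat.le_self_pow he p)

theorem pow_mul_eq_pow_mul {s w x y : ℕ} (hx : ¬ p ∣ x) (hy : ¬ p ∣ y)
    (h : p ^ s * x = p ^ w * y) : s = w ∧ x = y := by
  have key : ∀ {s w x y : ℕ}, ¬ p ∣ x → p ^ s * x = p ^ w * y → w ≤ s := by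
    intro s w x y hx h
    have h1 : p ^ w ∣ p ^ s := Nat.Coprime.dvd_of_dvd_mul_right
      (Nat.Coprime.pow_left w ((Nat.Prime.coprime_iff_not_dvd hp.out).2 hx)) ⟨y, h⟩
    exact (Nat.pow_dvd_pow_iff_le_right hp.out.one_lt).1 h1
  obtain rfl : s = w := le_antisymm (key hy h.symm) (key hx h)
  exact ⟨rfl, Nat.eq_of_mul_eq_mul_left (pow_pos hp.out.pos _) h⟩

theorem atomicNum_eq (he : e ≠ 0) (s : ℕ) (t : ℕ+) :
    atomicNum p e s t = p ^ s * brk (p ^ e) t := by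
  rw [atomicNum, brk, Nat.geomSum_eq (two_le_pow he)]

theorem atomicNum_injective (he : e ≠ 0) {s v : ℕ} {t u : ℕ+}
    (h : atomicNum p e s t = atomicNum p e v u) : s = v ∧ t = u := by
  rw [atomicNum_eq he, atomicNum_eq he] at h
  obtain ⟨h1, h2⟩ := pow_mul_eq_pow_mul (not_dvd_brk he t.ne_zero) (not_dvd_brk he u.ne_zero) h
  exact ⟨h1, PNat.coe_injective
    ((brk_strictMono (pow_ne_zero e hp.out.ne_zero)).injective h2)⟩

theorem atomicNum_one (he : e ≠ 0) (s : ℕ) : atomicNum p e s 1 = p ^ s := by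
  rw [atomicNum_eq he, PNat.one_coe, brk_one, mul_one]

theorem atomicNum_add (he : e ≠ 0) (v : ℕ) (t u : ℕ+) :
    atomicNum p e (v + e * u) t + atomicNum p e v u = atomicNum p e v (t + u) := by
  rw [atomicNum_eq he, atomicNum_eq he, atomicNum_eq he, PNat.add_coe, brk_add, pow_add, pow_mul]
  ring

/-- From `brk q t < q^t`. Used to exclude `v = s + e t` when the first degree is the larger one. -/
theorem atomicNum_lt (he : e ≠ 0) (s : ℕ) (t u : ℕ+) :
    atomicNum p e s t < atomicNum p e (s + e * t) u := by
  rw [atomicNum_eq he, atomicNum_eq he, pow_add, pow_mul, mul_assoc]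
  refine Nat.mul_lt_mul_of_pos_left ?_ (pow_pos hp.out.pos s)
  refine (brk_lt_pow (two_le_pow he) t).trans_le (Nat.le_mul_of_pos_right _ ?_)
  refine Nat.pos_of_ne_zero fun h => not_dvd_brk (p := p) he u.ne_zero ?_
  rw [h]
  exact dvd_zero p

/-- If `p^s [t] + p^v [u]` with `s < v` is atomic, then `v = s + e t`. -/
theorem eq_of_add_eq_of_lt (he : e ≠ 0) {s v w t u r : ℕ} (ht : t ≠ 0) (hu : u ≠ 0) (hr : r ≠ 0)
    (hsv : s < v)
    (h : p ^ s * brk (p ^ e) t + p ^ v * brk (p ^ e) u = p ^ w * brk (p ^ e) r) :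
    v = s + e * t := by
  obtain ⟨d, rfl⟩ := Nat.exists_eq_add_of_lt hsv
  have h1 : p ^ s * (brk (p ^ e) t + p ^ (d + 1) * brk (p ^ e) u) = p ^ w * brk (p ^ e) r := by
    rw [← h, add_assoc s, pow_add]
    ring
  have h2 : ¬ p ∣ brk (p ^ e) t + p ^ (d + 1) * brk (p ^ e) u := by
    rw [← Nat.dvd_add_iff_left ((dvd_pow_self p d.succ_ne_zero).mul_right _)]
    exact not_dvd_brk he ht
  obtain ⟨-, h3⟩ := pow_mul_eq_pow_mul h2 (not_dvd_brk he hr) h1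
  have hm := brk_strictMono (q := p ^ e) (pow_ne_zero e hp.out.ne_zero)
  have hu0 : 0 < brk (p ^ e) u := by
    have := hm (Nat.pos_of_ne_zero hu)
    omega
  have hrt : t < r := by
    rw [← hm.lt_iff_lt, ← h3]
    exact Nat.lt_add_of_pos_right (Nat.mul_pos (pow_pos hp.out.pos _) hu0)
  obtain ⟨c, rfl⟩ := Nat.exists_eq_add_of_lt hrt
  -- Since `brk q r - brk q t = q^t brk q (r - t)`, comparing powers of `p` gives `v - s = e t`.
  rw [add_assoc t, add_comm t, brk_add, add_comm, Nat.add_right_cancel_iff, ← pow_mul,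
    mul_comm (brk _ _)] at h3
  have := (pow_mul_eq_pow_mul (not_dvd_brk he hu) (not_dvd_brk he c.succ_ne_zero) h3).1
  omega

/-- The sum `p^s [t] + p^s [u]`, `u < t`, is a power of `p` if it is atomic. -/
theorem eq_one_of_add_eq (he : e ≠ 0) {s w t u r : ℕ} (hu : u ≠ 0) (hr : r ≠ 0) (hut : u < t)
    (h : p ^ s * brk (p ^ e) t + p ^ s * brk (p ^ e) u = p ^ w * brk (p ^ e) r) : r = 1 := by
  have hq0 : p ^ e ≠ 0 := pow_ne_zero e hp.out.ne_zero
  have hm := brk_strictMono hq0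
  have hr' := not_dvd_brk (p := p) he hr
  have hpq : p ∣ p ^ e := dvd_pow_self p he
  obtain ⟨t, rfl⟩ := Nat.exists_eq_succ_of_ne_zero (show t ≠ 0 by omega)
  obtain ⟨u, rfl⟩ := Nat.exists_eq_succ_of_ne_zero hu
  rw [Nat.succ_eq_add_one, Nat.succ_eq_add_one] at *
  have hut' : u < t := by omega
  rw [← mul_add] at h
  have h2 : brk (p ^ e) (t + 1) + brk (p ^ e) (u + 1) =
      2 + p ^ e * (brk (p ^ e) t + brk (p ^ e) u) := by
    rw [brk_succ, brk_succ]
    ring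
  obtain ⟨r, rfl⟩ := Nat.exists_eq_succ_of_ne_zero hr
  rw [Nat.succ_eq_add_one] at *
  have hr1 : ¬ p ∣ 1 := hp.out.one_lt.ne' ∘ Nat.dvd_one.1
  -- The sum in `h2` is `2` modulo `q`. For odd `p` it is prime to `p`, and cancelling powers of `p`
  -- leaves `2 ≡ 1` modulo `p`; for `p = 2` a further factor `2` must be cancelled first.
  by_cases hp2 : p = 2
  · subst hp2
    obtain ⟨e, rfl⟩ := Nat.exists_eq_succ_of_ne_zero he
    rw [Nat.succ_eq_add_one] at *
    have h3 : 2 ^ (s + 1) * (1 + 2 ^ e * (brk (2 ^ (e + 1)) t + brk (2 ^ (e + 1)) u)) =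
        2 ^ w * brk (2 ^ (e + 1)) (r + 1) := by
      rw [← h, h2]
      ring
    -- For `q = 2`, `brk 2 k = 2^k - 1`. If the smaller index is `1`, the sum is a power of `2`;
    -- otherwise `2^t + 2^u` with `u < t` would be one.
    rcases Nat.eq_zero_or_pos e with rfl | he0
    · have hbt (k : ℕ) : brk (2 ^ (0 + 1)) k + 1 = 2 ^ k := by
        induction k with
        | zero => simp [brk]
        | succ k ih => rw [brk_succ, pow_succ 2 k, ← ih]; ring
      have h4 : 2 ^ (s + 1) * (2 ^ t + brk (2 ^ (0 + 1)) u) =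
          2 ^ w * brk (2 ^ (0 + 1)) (r + 1) := by
        rw [← h3, ← hbt t]
        ring
      rcases Nat.eq_zero_or_pos u with rfl | hu0
      · have h5 : 2 ^ (s + 1 + t) * 1 = 2 ^ w * brk (2 ^ (0 + 1)) (r + 1) := by
          rw [← h4, pow_add]
          simp [brk]
        have := (pow_mul_eq_pow_mul hr1 hr' h5).2
        exact (hm.injective (this.symm.trans (brk_one _).symm))
      · have h5 : ¬ 2 ∣ 2 ^ t + brk (2 ^ (0 + 1)) u := by
          rw [← Nat.dvd_add_iff_right (dvd_pow_self 2 (by omega))]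
          exact not_dvd_brk he hu0.ne'
        have h6 := (pow_mul_eq_pow_mul h5 hr' h4).2
        have h7 := hbt u
        have h8 := hbt (r + 1)
        have h9 : 2 ^ t + 2 ^ u = 2 ^ (r + 1) := by omega
        have h10 : 2 ^ u < 2 ^ t := Nat.pow_lt_pow_right (by norm_num) hut'
        have h11 : t < r + 1 := by
          rw [← Nat.pow_lt_pow_iff_right (a := 2) (by norm_num)]
          have := pow_pos (show 0 < 2 by norm_num) u
          omega
        have h12 : 2 ^ (t + 1) ≤ 2 ^ (r + 1) := Nat.pow_le_pow_right (by norm_num) h11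
        rw [pow_succ] at h12
        omega
    -- For `q ≥ 4` the remaining factor is odd, so `brk q (t+1) + brk q (u+1) = 2 brk q (r+1)` with
    -- `r < t`. This contradicts `2 brk q t ≤ q brk q t < brk q (t+1)`.
    · have h4 : ¬ 2 ∣ 1 + 2 ^ e * (brk (2 ^ (e + 1)) t + brk (2 ^ (e + 1)) u) := by
        rw [← Nat.dvd_add_iff_left ((dvd_pow_self 2 he0.ne').mul_right _)]
        exact hr1
      have h5 := (pow_mul_eq_pow_mul h4 hr' h3).2
      have h6 : brk (2 ^ (e + 1)) (t + 1) + brk (2 ^ (e + 1)) (u + 1) =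
          2 * brk (2 ^ (e + 1)) (r + 1) := by
        rw [h2, ← h5]
        ring
      have h7 := hm hut
      have h8 : r + 1 < t + 1 := by
        rw [← hm.lt_iff_lt]
        omega
      have h9 := hm.monotone (show r + 1 ≤ t by omega)
      have h10 : 2 * brk (2 ^ (e + 1)) t ≤ 2 ^ (e + 1) * brk (2 ^ (e + 1)) t :=
        Nat.mul_le_mul_right _ (two_le_pow e.succ_ne_zero)
      have h11 := brk_succ (2 ^ (e + 1)) t
      have h12 := hm (Nat.succ_pos u)
      simp only [Nat.succ_eq_add_one] at h12
      omega
  · have h3 : ¬ p ∣ brk (p ^ e) (t + 1) + brk (p ^ e) (u + 1) := by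
      rw [h2, ← Nat.dvd_add_iff_left (hpq.mul_right _)]
      exact fun h => hp2 ((Nat.prime_dvd_prime_iff_eq hp.out Nat.prime_two).1 h)
    have h4 := (pow_mul_eq_pow_mul h3 hr' h).2
    rw [h2, brk_succ] at h4
    refine absurd ?_ hr1
    have h5 : 1 + p ^ e * (brk (p ^ e) t + brk (p ^ e) u) = p ^ e * brk (p ^ e) r := by omega
    exact (Nat.dvd_add_iff_left (hpq.mul_right _)).2 (h5 ▸ hpq.mul_right _)

/-- When the sum of two atomic numbers is atomic, without being a power of `p`. -/
theorem isAtomic_add_iff (he : e ≠ 0) {s v : ℕ} {t u : ℕ+}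
    (hab : atomicNum p e v u < atomicNum p e s t) :
    (IsAtomic p e (atomicNum p e s t + atomicNum p e v u) ∧
      ¬ ∃ i : ℕ, atomicNum p e s t + atomicNum p e v u = p ^ i) ↔ s = v + e * u := by
  constructor
  · rintro ⟨⟨w, r, h⟩, hpow⟩
    have h' := h
    rw [atomicNum_eq he, atomicNum_eq he, atomicNum_eq he] at h
    rcases lt_trichotomy s v with hsv | rfl | hvs
    · have := eq_of_add_eq_of_lt he t.ne_zero u.ne_zero r.ne_zero hsv h
      rw [this] at hab
      exact absurd hab (atomicNum_lt he s t u).not_gt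
    · refine absurd ⟨w, ?_⟩ hpow
      have hut : (u : ℕ) < t := by
        rw [← (brk_strictMono (pow_ne_zero e hp.out.ne_zero)).lt_iff_lt]
        rw [atomicNum_eq he, atomicNum_eq he] at hab
        exact lt_of_mul_lt_mul_left hab (Nat.zero_le _)
      have hr := eq_one_of_add_eq he u.ne_zero r.ne_zero hut h
      rw [h', atomicNum_eq he, hr, brk_one, mul_one]
    · rw [add_comm] at h
      exact eq_of_add_eq_of_lt he u.ne_zero t.ne_zero r.ne_zero hvs h
  · rintro rfl
    rw [atomicNum_add he]
    refine ⟨⟨v, t + u, rfl⟩, ?_⟩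
    rintro ⟨i, hi⟩
    rw [← atomicNum_one he] at hi
    have := congrArg PNat.val (atomicNum_injective he hi).2
    have h1 := t.pos
    have h2 := u.pos
    change (t + u : ℕ) = 1 at this
    omega

/-- For `t ≥ n` both sides are false, so the truncated subtraction does no harm. -/
theorem cond_iff (he : e ≠ 0) {n s t : ℕ} : (s : ℚ) / e + t < n ↔ s < e * (n - t) := by
  have he' : (0 : ℚ) < e := Nat.cast_pos.2 (Nat.pos_of_ne_zero he)
  rw [← lt_sub_iff_add_lt, div_lt_iff₀ he', Nat.mul_sub, lt_tsub_iff_right, sub_mul,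
    lt_sub_iff_add_lt, mul_comm (n : ℚ), mul_comm (t : ℚ)]
  exact_mod_cast Iff.rfl

theorem exists_of_mem_genDegrees (he : e ≠ 0) {n a : ℕ} (ha : a ∈ genDegrees p e n) :
    ∃ (s : ℕ) (t : ℕ+), s < e * (n - t) ∧ a = atomicNum p e s t := by
  obtain ⟨s, t, h, rfl⟩ := ha
  exact ⟨s, t, (cond_iff he).1 h, rfl⟩

theorem atomicNum_mem_genDegrees (he : e ≠ 0) {n s : ℕ} {t : ℕ+} (h : s < e * (n - t)) :
    atomicNum p e s t ∈ genDegrees p e n := ⟨s, t, (cond_iff he).2 h, rfl⟩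

/-- The pairs are indexed by `j = n - t` and `s < e j`; the form `n - j - 1 + 1` makes `t` visibly
positive, and `j = 0` contributes nothing. -/
theorem genDegrees_eq_image (he : e ≠ 0) (n : ℕ) : genDegrees p e n =
    (fun x : (_ : ℕ) × ℕ => atomicNum p e x.2 ⟨n - x.1 - 1 + 1, Nat.succ_pos _⟩) ''
      ((Finset.range n).sigma fun j => Finset.range (e * j) : Finset ((_ : ℕ) × ℕ)) := by
  ext a
  constructor
  · intro ha
    obtain ⟨s, t, h, rfl⟩ := exists_of_mem_genDegrees he ha
    have h1 : (t : ℕ) < n := by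
      by_contra h1
      rw [Nat.sub_eq_zero_of_le (not_lt.1 h1), mul_zero] at h
      omega
    have h2 := t.pos
    refine ⟨⟨n - t, s⟩, ?_, ?_⟩
    · simp only [Finset.coe_sigma, Set.mem_sigma_iff, Finset.mem_coe, Finset.mem_range]
      exact ⟨by omega, h⟩
    · change atomicNum p e s ⟨n - (n - t) - 1 + 1, _⟩ = atomicNum p e s t
      refine congrArg (atomicNum p e s) (PNat.coe_injective ?_)
      change n - (n - (t : ℕ)) - 1 + 1 = t
      omega
  · rintro ⟨⟨j, s⟩, h, rfl⟩
    simp only [Finset.coe_sigma, Set.mem_sigma_iff, Finset.mem_coe, Finset.mem_range] at h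
    refine atomicNum_mem_genDegrees he ?_
    change s < e * (n - (n - j - 1 + 1))
    rw [show n - (n - j - 1 + 1) = j by omega]
    exact h.2

theorem finite_genDegrees (he : e ≠ 0) (n : ℕ) : (genDegrees p e n).Finite := by
  rw [genDegrees_eq_image he]
  exact (Finset.finite_toSet _).image _

theorem sum_range_mul_eq (e n : ℕ) : ∑ j ∈ Finset.range n, e * j = e * (n * (n - 1) / 2) := by
  rw [← Finset.mul_sum, Finset.sum_range_id]

theorem ncard_genDegrees (he : e ≠ 0) (n : ℕ) :
    (genDegrees p e n).ncard = e * (n * (n - 1) / 2) := by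
  rw [genDegrees_eq_image he, Set.InjOn.ncard_image, Set.ncard_coe_finset, Finset.card_sigma]
  · simp only [Finset.card_range]
    exact sum_range_mul_eq e n
  · rintro ⟨j, s⟩ hj ⟨k, v⟩ hk h
    simp only [Finset.coe_sigma, Set.mem_sigma_iff, Finset.mem_coe, Finset.mem_range] at hj hk
    obtain ⟨h1, h2⟩ := atomicNum_injective he h
    have h3 := congrArg PNat.val h2
    change n - j - 1 + 1 = n - k - 1 + 1 at h3
    have h4 : j = k := by omega
    change s = v at h1
    rw [h1, h4]

/-- There are at least `p ^ (e n (n - 1) / 2)` exponent sequences in the profile. -/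
theorem exists_injective_inProfile (p e n : ℕ) [hp : Fact p.Prime] :
    ∃ f : ((j : Fin n) → Fin (p ^ (e * j))) → {R : ℕ+ →₀ ℕ // InProfile p e n R},
      Function.Injective f := by
  rcases Nat.eq_zero_or_pos n with rfl | hn
  · refine ⟨fun _ => ⟨0, fun k => ?_⟩, fun f g _ => Subsingleton.elim f g⟩
    exact pow_pos hp.out.pos _
  have hlt (k : ℕ+) : n - k < n := Nat.sub_lt hn k.pos
  obtain ⟨N, hN⟩ : ∃ N : ℕ+, (N : ℕ) = n := ⟨⟨n, hn⟩, rfl⟩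
  -- The exponent of `ξ_k` is the coordinate `n - k`. For `k ≥ n` this is coordinate `0`, which lies
  -- in `Fin (p ^ 0)` and so vanishes.
  let R (f : (j : Fin n) → Fin (p ^ (e * j))) : ℕ+ →₀ ℕ :=
    Finsupp.onFinset (Finset.Iic N) (fun k => f ⟨n - k, hlt k⟩) (by
      intro k hk
      rw [Finset.mem_Iic]
      by_contra h
      have h1 : n ≤ k := hN.symm.trans_le ((PNat.coe_le_coe N k).2 (not_le.1 h).le)
      refine hk ?_
      have h2 := (f ⟨n - k, hlt k⟩).2
      simp only [Nat.sub_eq_zero_of_le h1, mul_zero, pow_zero] at h2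
      exact Nat.lt_one_iff.1 h2)
  refine ⟨fun f => ⟨R f, fun k => (f ⟨n - k, hlt k⟩).2⟩, fun f g h => ?_⟩
  funext j
  have h1 := DFunLike.congr_fun (congrArg Subtype.val h) ⟨n - j, by have := j.2; omega⟩
  apply Fin.ext
  change ((f ⟨n - (n - j), _⟩ : ℕ)) = g ⟨n - (n - j), _⟩ at h1
  have h2 : (⟨n - (n - j), by have := j.2; omega⟩ : Fin n) = j :=
    Fin.ext (by have := j.2; simp only; omega)
  rwa [h2] at h1

end Atomic

/-! ### Ordered monomials -/

section OrderedMonomials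

variable {F B X : Type*} [Field F] [Ring B] [Algebra F B] {g : X → B}

/-- If commutators of generators are linear combinations of generators, then the product of a word
is unchanged by permutations, modulo shorter words. -/
theorem prod_sub_prod_mem_of_perm
    (hcomm : ∀ a b, g a * g b - g b * g a ∈ Submodule.span F (Set.range g))
    {l l' : List X} (h : l.Perm l') :
    (l.map g).prod - (l'.map g).prod ∈
      Submodule.span F {x | ∃ m : List X, m.length < l.length ∧ x = (m.map g).prod} := by
  induction h with
  | nil => rw [sub_self]; exact zero_mem _
  | @cons a l l' h ih =>
    rw [List.map_cons, List.map_cons, List.prod_cons, List.prod_cons, ← mul_sub]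
    refine Submodule.span_induction (p := fun x _ => g a * x ∈ Submodule.span F
      {x | ∃ m : List X, m.length < (a :: l).length ∧ x = (m.map g).prod}) ?_ ?_ ?_ ?_ ih
    · rintro _ ⟨m, hm, rfl⟩
      refine Submodule.subset_span ⟨a :: m, by simpa using hm, ?_⟩
      rw [List.map_cons, List.prod_cons]
    · rw [mul_zero]; exact zero_mem _
    · intro x y _ _ hx hy
      rw [mul_add]
      exact add_mem hx hy
    · intro c x _ hx
      rw [mul_smul_comm]
      exact Submodule.smul_mem _ _ hx
  | swap a b l =>
    simp only [List.map_cons, List.prod_cons]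
    rw [← mul_assoc, ← mul_assoc, ← sub_mul]
    refine Submodule.span_induction (p := fun x _ => x * (l.map g).prod ∈ Submodule.span F
      {x | ∃ m : List X, m.length < (b :: a :: l).length ∧ x = (m.map g).prod})
      ?_ ?_ ?_ ?_ (hcomm b a)
    · rintro _ ⟨c, rfl⟩
      refine Submodule.subset_span ⟨c :: l, by simp, ?_⟩
      rw [List.map_cons, List.prod_cons]
    · rw [zero_mul]; exact zero_mem _
    · intro x y _ _ hx hy
      rw [add_mul]
      exact add_mem hx hy
    · intro c x _ hx
      rw [smul_mul_assoc]
      exact Submodule.smul_mem _ _ hx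
  | trans h h' ih ih' =>
    rw [← h.length_eq] at ih'
    rw [← sub_add_sub_cancel]
    exact add_mem ih ih'

theorem perm_flatMap_replicate [DecidableEq X] {L : List X} (hL : L.Nodup) (hL' : ∀ a, a ∈ L)
    (l : List X) : l.Perm (L.flatMap fun a => List.replicate (l.count a) a) := by
  rw [List.perm_iff_count]
  intro b
  rw [List.count_flatMap]
  have h1 : (List.count b ∘ fun a => List.replicate (l.count a) a) =
      fun a => if a = b then l.count a else 0 := by
    funext a
    simp only [Function.comp, List.count_replicate, beq_iff_eq]
  rw [h1, ← List.sum_toFinset _ hL, Finset.sum_ite_eq',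
    if_pos (List.mem_toFinset.2 (hL' b))]

/-- Under the power and commutator relations, ordered monomials span. -/
theorem span_ordered_eq_top {p : ℕ}
    (hcomm : ∀ a b, g a * g b - g b * g a ∈ Submodule.span F (Set.range g))
    (hpow : ∀ a, g a ^ p = 0)
    (hgen : Submodule.span F (Set.range fun l : List X => (l.map g).prod) = ⊤)
    {L : List X} (hL : L.Nodup) (hL' : ∀ a, a ∈ L) :
    Submodule.span F (Set.range fun f : X → Fin p =>
      (L.map fun a => g a ^ (f a : ℕ)).prod) = ⊤ := by
  classical
  rw [← hgen]
  refine le_antisymm (hgen.symm ▸ le_top) (Submodule.span_le.2 ?_)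
  rintro _ ⟨l, rfl⟩
  change (l.map g).prod ∈ _
  induction h : l.length using Nat.strong_induction_on generalizing l with
  | _ k ih =>
    subst h
    -- Sorting into the order `L` changes the product only by shorter words, which induction on
    -- length covers.
    have h1 := prod_sub_prod_mem_of_perm hcomm (perm_flatMap_replicate hL hL' l)
    rw [← sub_add_cancel (l.map g).prod]
    refine add_mem (Submodule.span_le.2 ?_ h1) ?_
    · rintro _ ⟨m, hm, rfl⟩
      exact ih _ hm m rfl
    · have h2 : ((L.flatMap fun a => List.replicate (l.count a) a).map g).prod =
          (L.map fun a => g a ^ l.count a).prod := by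
        rw [List.map_flatMap, List.flatMap, List.prod_flatten, List.map_map]
        congr 1
        refine List.map_congr_left fun a _ => ?_
        simp
      rw [h2]
      -- A multiplicity of at least `p` makes the sorted word zero by the power relation.
      by_cases h3 : ∀ a, l.count a < p
      · exact Submodule.subset_span ⟨fun a => ⟨l.count a, h3 a⟩, rfl⟩
      · push Not at h3
        obtain ⟨a, ha⟩ := h3
        rw [List.prod_eq_zero]
        · exact zero_mem _
        · rw [List.mem_map]
          refine ⟨a, hL' a, ?_⟩
          rw [← Nat.sub_add_cancel ha, pow_add, hpow, mul_zero]

end OrderedMonomials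

/-! ### Relations and generators of the graded algebra -/

section Presentation

set_option linter.unusedSectionVars false

theorem grOf_commutator (F : Type*) [Field F] {A : Type*} [Ring A] [Algebra F A] {I : Ideal A}
    [I.IsTwoSided] {i j k : ℕ} {x y z : A} (hx : x ∈ I ^ i) (hy : y ∈ I ^ j) (hz : z ∈ I ^ k)
    (hk : k = i + j) (h : x * y - y * x - z ∈ I ^ (k + 1)) :
    grOf F i x hx * grOf F j y hy - grOf F j y hy * grOf F i x hx = grOf F k z hz := by
  subst hk
  rw [grOf_mul, grOf_mul, grOf_congr F (mul_mem_pow hy hx) (add_comm j i) rfl, ← grOf_sub,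
    ← sub_eq_zero, ← grOf_sub, grOf_eq_zero]
  exact h

variable {F : Type*} [Field F] {p e : ℕ} [hp : Fact p.Prime] [CharP F p]

theorem milnorP_single_mem (he : e ≠ 0) {n s : ℕ} {t : ℕ+} (h : s < e * (n - t)) :
    milnorP F p e he (Finsupp.single t (p ^ s)) ∈ subAlg F p e n :=
  milnorP_mem he (inProfile_single (Nat.pow_lt_pow_right hp.out.one_lt h))

theorem milnorP_single_mem_pow (he : e ≠ 0) {n s : ℕ} {t : ℕ+} (h : s < e * (n - t)) :
    (⟨milnorP F p e he (Finsupp.single t (p ^ s)), milnorP_single_mem he h⟩ : subAlg F p e n) ∈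
      augIdeal F p e n ^ (t : ℕ) := by
  have := milnorP_mem_pow (F := F) he
    (inProfile_single (Nat.pow_lt_pow_right hp.out.one_lt h))
  rwa [wt_single_pow] at this

variable (F) in
/-- The class of `P^s_t` in `E⁰(A_q(n-2))`. -/
def grP (he : e ≠ 0) {n s : ℕ} {t : ℕ+} (h : s < e * (n - t)) : E0 F p e n :=
  grOf F (t : ℕ) ⟨milnorP F p e he (Finsupp.single t (p ^ s)), milnorP_single_mem he h⟩
    (milnorP_single_mem_pow he h)

theorem grP_pow (he : e ≠ 0) {n s : ℕ} {t : ℕ+} (h : s < e * (n - t)) :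
    grP F he h ^ p = 0 := by
  rw [grP, grOf_pow, grOf_eq_zero, mem_augIdeal_pow_iff he]
  change rho F p e he (_ ^ p) ∈ _
  rw [map_pow, rho_milnorP]
  exact milP_pow_char he t s


theorem grP_commutator (he : e ≠ 0) {n s v : ℕ} {t u : ℕ+} (h : s < e * (n - t))
    (h' : v < e * (n - u)) (hs : s = v + e * u) (h'' : v < e * (n - (t + u : ℕ+))) :
    grP F he h * grP F he h' - grP F he h' * grP F he h = grP F he h'' := by
  rw [grP, grP, grP]
  refine grOf_commutator F _ _ _ rfl ?_
  rw [mem_augIdeal_pow_iff he]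
  change rho F p e he (_ * _ - _ * _ - _) ∈ _
  rw [map_sub, map_sub, map_mul, map_mul, rho_milnorP, rho_milnorP, rho_milnorP]
  have := milP_commutator (F := F) (p := p) (e := e) u t v s
  rwa [if_pos hs, if_neg, sub_zero] at this
  -- The opposite term would require `v = s + e t`, but here `v < s`.
  have := Nat.mul_pos (Nat.pos_of_ne_zero he) u.pos
  omega

theorem grP_commutator_eq_zero (he : e ≠ 0) {n s v : ℕ} {t u : ℕ+} (h : s < e * (n - t))
    (h' : v < e * (n - u)) (hs : s ≠ v + e * u) (hv : v ≠ s + e * t) :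
    grP F he h * grP F he h' - grP F he h' * grP F he h = 0 := by
  rw [grP, grP]
  refine (grOf_commutator F _ _ (zero_mem _) rfl ?_).trans ((grOf_eq_zero F _).2 (zero_mem _))
  rw [mem_augIdeal_pow_iff he]
  change rho F p e he (_ * _ - _ * _ - _) ∈ _
  rw [map_sub, map_sub, map_mul, map_mul, rho_milnorP, rho_milnorP, ZeroMemClass.coe_zero, map_zero]
  have := milP_commutator (F := F) (p := p) (e := e) u t v s
  rwa [if_neg hs, if_neg hv, sub_zero] at this

/-- The class of the element `P^s_t` of degree `a`. -/
theorem exists_grGen (F : Type*) [Field F] [CharP F p] (he : e ≠ 0) (n : ℕ) :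
    ∃ g : genDegrees p e n → E0 F p e n, ∀ (s : ℕ) (t : ℕ+) (h : s < e * (n - t)),
      g ⟨atomicNum p e s t, atomicNum_mem_genDegrees he h⟩ = grP F he h := by
  -- By `atomicNum_injective` the pair `(s, t)` chosen for a degree is the only one.
  choose s t h ha using fun a : genDegrees p e n => exists_of_mem_genDegrees he a.2
  refine ⟨fun a => grP F he (h a), fun s' t' h' => ?_⟩
  have h1 := ha ⟨atomicNum p e s' t', atomicNum_mem_genDegrees he h'⟩
  have h2 := h ⟨atomicNum p e s' t', atomicNum_mem_genDegrees he h'⟩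
  obtain ⟨h3, h4⟩ := atomicNum_injective he h1
  simp only [← h3, ← h4]

theorem grGen_rel (he : e ≠ 0) {n : ℕ} {g : genDegrees p e n → E0 F p e n}
    (hg : ∀ (s : ℕ) (t : ℕ+) (h : s < e * (n - t)),
      g ⟨atomicNum p e s t, atomicNum_mem_genDegrees he h⟩ = grP F he h)
    ⦃x y : FreeAlgebra F (genDegrees p e n)⦄ (hxy : PowerCommRel F p e n x y) :
    FreeAlgebra.lift F g x = FreeAlgebra.lift F g y := by
  cases hxy with
  | power a =>
    obtain ⟨a, ha⟩ := a
    obtain ⟨s, t, h, rfl⟩ := exists_of_mem_genDegrees he ha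
    rw [map_pow, FreeAlgebra.lift_ι_apply, hg s t h, grP_pow, map_zero]
  | comm a b c hab hc hpow =>
    obtain ⟨a, ha⟩ := a
    obtain ⟨b, hb⟩ := b
    obtain ⟨c, hc'⟩ := c
    obtain ⟨s, t, h, rfl⟩ := exists_of_mem_genDegrees he ha
    obtain ⟨v, u, h', rfl⟩ := exists_of_mem_genDegrees he hb
    obtain ⟨w, r, h'', rfl⟩ := exists_of_mem_genDegrees he hc'
    simp only at hc hab hpow
    have hs := (isAtomic_add_iff he hab).1 ⟨⟨w, r, hc.symm⟩, hpow⟩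
    have h3 := hc
    rw [hs, atomicNum_add he] at h3
    obtain ⟨rfl, rfl⟩ := atomicNum_injective he h3
    rw [map_sub, map_mul, map_mul, FreeAlgebra.lift_ι_apply, FreeAlgebra.lift_ι_apply,
      FreeAlgebra.lift_ι_apply, hg s t h, hg w u h', hg w (t + u) h'',
      grP_commutator he h h' hs h'']
  | comm_zero a b hab hnot =>
    obtain ⟨a, ha⟩ := a
    obtain ⟨b, hb⟩ := b
    obtain ⟨s, t, h, rfl⟩ := exists_of_mem_genDegrees he ha
    obtain ⟨v, u, h', rfl⟩ := exists_of_mem_genDegrees he hb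
    simp only at hab hnot
    rw [map_sub, map_mul, map_mul, FreeAlgebra.lift_ι_apply, FreeAlgebra.lift_ι_apply,
      hg s t h, hg v u h', map_zero,
      grP_commutator_eq_zero he h h' (fun hs => hnot ((isAtomic_add_iff he hab).2 hs))]
    -- Here `v = s + e t` would make the second degree larger than the first.
    rintro rfl
    exact hab.not_gt (atomicNum_lt he s t u)

/-- The commutators of generators of the presented algebra are generators, up to sign, or zero. -/
theorem gen_commutator_mem (he : e ≠ 0) {n : ℕ} (a b : genDegrees p e n) :
    gen F p e n a * gen F p e n b - gen F p e n b * gen F p e n a ∈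
      Submodule.span F (Set.range (gen F p e n)) := by
  wlog hab : (b : ℕ) < a generalizing a b
  · rcases lt_or_eq_of_le (not_lt.1 hab) with h | h
    · rw [← neg_sub]
      exact neg_mem (this b a h)
    · rw [Subtype.ext h, sub_self]
      exact zero_mem _
  by_cases h : IsAtomic p e (a + b) ∧ ¬ ∃ i : ℕ, (a : ℕ) + b = p ^ i
  · have hmem : (a + b : ℕ) ∈ genDegrees p e n := by
      obtain ⟨a, ha⟩ := a
      obtain ⟨b, hb⟩ := b
      obtain ⟨s, t, hs, rfl⟩ := exists_of_mem_genDegrees he ha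
      obtain ⟨v, u, hv, rfl⟩ := exists_of_mem_genDegrees he hb
      have h1 := (isAtomic_add_iff he hab).1 h
      change atomicNum p e s t + atomicNum p e v u ∈ _
      -- With `s = v + e u`, the bound `s < e (n - t)` yields `v < e (n - (t + u))`, so the sum is
      -- again a generator degree.
      rw [h1, atomicNum_add he]
      refine atomicNum_mem_genDegrees he ?_
      rw [Nat.mul_sub] at hs ⊢
      rw [PNat.add_coe, mul_add]
      omega
    have h2 := RingQuot.mkAlgHom_rel F (PowerCommRel.comm (F := F) a b ⟨_, hmem⟩ hab rfl h.2)
    rw [map_sub, map_mul, map_mul] at h2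
    exact Submodule.subset_span ⟨_, h2.symm⟩
  · have h2 := RingQuot.mkAlgHom_rel F (PowerCommRel.comm_zero (F := F) a b hab h)
    rw [map_sub, map_mul, map_mul, map_zero] at h2
    have h3 : gen F p e n a * gen F p e n b - gen F p e n b * gen F p e n a = 0 := h2
    rw [h3]
    exact zero_mem _

theorem gen_pow (n : ℕ) (a : genDegrees p e n) : gen F p e n a ^ p = 0 := by
  have h2 := RingQuot.mkAlgHom_rel F (PowerCommRel.power (F := F) a)
  rwa [map_pow, map_zero] at h2

theorem span_ordered_gen_eq_top (he : e ≠ 0) {n : ℕ} {L : List (genDegrees p e n)}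
    (hL : L.Nodup) (hL' : ∀ a, a ∈ L) :
    Submodule.span F (Set.range fun f : genDegrees p e n → Fin p =>
      (L.map fun a => gen F p e n a ^ (f a : ℕ)).prod) = ⊤ :=
  span_ordered_eq_top (gen_commutator_mem he) (gen_pow n)
    (span_range_prod_eq_top (PowerCommRel F p e n)) hL hL'

/-- The graded algebra is generated by the classes of the `P^(p^i)`. -/
theorem eq_top_of_grP_mem (he : e ≠ 0) {n : ℕ} {B : Subalgebra F (E0 F p e n)}
    (hB : ∀ (s : ℕ) (t : ℕ+) (h : s < e * (n - t)), grP F he h ∈ B) : B = ⊤ := by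
  have h1 (i : ℕ) (hi : i < (n - 1) * e) :
      grOf F 1 (subGen F p e n i hi) (subGen_mem_pow hi) ∈ B := by
    have hi' : i < e * (n - (1 : ℕ+)) := by rwa [mul_comm] at hi
    have h2 := hB i 1 hi'
    rw [grP] at h2
    convert h2 using 1
    refine grOf_congr F _ rfl (Subtype.ext (rho_injective he ?_))
    exact (rho_stP_pow he i).trans (rho_milnorP he _).symm
  have h2 (l : List {i // i < (n - 1) * e}) : grOf F l.length
      (l.map fun i => subGen F p e n i.1 i.2).prod (prod_subGen_mem l) ∈ B := by
    induction l with
    | nil => exact one_mem B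
    | cons a l ih =>
      have h3 := mul_mem (h1 a.1 a.2) ih
      rw [grOf_mul] at h3
      convert h3 using 1
      exact grOf_congr F _ (add_comm _ _) rfl
  refine subalgebra_eq_top F fun k x hx => ?_
  have hx' : rho F p e he x ∈ wordFil F p e n k := by
    rw [← profFil_eq_wordFil he]
    exact ⟨(mem_augIdeal_pow_iff he x).1 hx, rho_mem_profSub he x.2⟩
  -- `N` consists of the elements of the `k`th power whose class lies in `B`. It contains words of
  -- length `k` by `h2`, and longer words because their class in grading `k` is zero.
  obtain ⟨y, ⟨⟨y, hy⟩, hyB, rfl⟩, hyx⟩ := exists_word_sum he hx'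
    (N := ((Subalgebra.toSubmodule B).comap (grOfLin F (augIdeal F p e n) k)).map
      (powSub F (augIdeal F p e n) k).subtype) (fun l hl => by
        have hmem (m : ℕ) (hm : m ≤ l.length) :
            (l.map fun i => subGen F p e n i.1 i.2).prod ∈ augIdeal F p e n ^ m :=
          Ideal.pow_le_pow_right hm (prod_subGen_mem l)
        refine ⟨⟨_, hmem k hl⟩, ?_, rfl⟩
        rcases hl.eq_or_lt with rfl | hl'
        · exact h2 l
        · have h3 := (grOf_eq_zero F (hmem k hl)).2 (hmem (k + 1) hl')
          change grOf F k _ (hmem k hl) ∈ B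
          rw [h3]
          exact zero_mem B)
  obtain rfl : y = x := Subtype.ext (rho_injective he hyx)
  exact hyB

/-- The classes of the `P(R)` with `R` in the profile are independent, and at least `∏ p^(e j)`, `j
< n`, of them exist. -/
theorem le_finrank_E0 (he : e ≠ 0) (n : ℕ) [Module.Finite F (E0 F p e n)] :
    p ^ (e * (n * (n - 1) / 2)) ≤ Module.finrank F (E0 F p e n) := by
  obtain ⟨f, hf⟩ := exists_injective_inProfile p e n
  have h := ((linearIndependent_grMilnor (F := F) he n).comp f hf).fintype_card_le_finrank
  rw [Fintype.card_pi] at h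
  simp only [Fintype.card_fin] at h
  rwa [Fin.prod_univ_eq_prod_range (fun j => p ^ (e * j)), Finset.prod_pow_eq_pow_sum,
    sum_range_mul_eq] at h

end Presentation

/-! ### Comparison of dimensions -/

section Isomorphism

set_option linter.unusedSectionVars false

variable {F : Type*} [Field F] {p e : ℕ} [hp : Fact p.Prime] [CharP F p]

variable (F) in
theorem exists_presentation_hom (he : e ≠ 0) (n : ℕ) :
    ∃ Φ : PowerCommAlg F p e n →ₐ[F] E0 F p e n, Function.Surjective Φ ∧
      ∀ (s : ℕ) (t : ℕ+) (h : s < e * (n - t)),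
        Φ (gen F p e n ⟨atomicNum p e s t, atomicNum_mem_genDegrees he h⟩) = grP F he h := by
  obtain ⟨g, hg⟩ := exists_grGen F he n
  have hgen (a : genDegrees p e n) : RingQuot.liftAlgHom F
      ⟨FreeAlgebra.lift F g, grGen_rel he hg⟩ (gen F p e n a) = g a :=
    (RingQuot.liftAlgHom_mkAlgHom_apply F _ (grGen_rel he hg) _).trans
      (FreeAlgebra.lift_ι_apply _ _)
  refine ⟨RingQuot.liftAlgHom F ⟨FreeAlgebra.lift F g, grGen_rel he hg⟩, ?_,
    fun s t h => (hgen _).trans (hg s t h)⟩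
  rw [← AlgHom.range_eq_top]
  exact eq_top_of_grP_mem he fun s t h => ⟨_, (hgen _).trans (hg s t h)⟩

theorem card_exponents (he : e ≠ 0) (n : ℕ) [Fintype (genDegrees p e n)]
    [DecidableEq (genDegrees p e n)] :
    Fintype.card (genDegrees p e n → Fin p) = p ^ (e * (n * (n - 1) / 2)) := by
  rw [Fintype.card_fun, Fintype.card_fin, ← ncard_genDegrees (p := p) he n,
    Set.ncard_eq_toFinset_card', Set.toFinset_card]

/-- A surjection from the presented algebra is an isomorphism, and ordered monomials are bases. -/
theorem finrank_E0_and_bases (he : e ≠ 0) (n : ℕ) {Φ : PowerCommAlg F p e n →ₐ[F] E0 F p e n}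
    (hΦ : Function.Surjective Φ) :
    Function.Injective Φ ∧ Module.finrank F (E0 F p e n) = p ^ (e * (n * (n - 1) / 2)) ∧
      ∀ L : List (genDegrees p e n), L.Nodup → (∀ a, a ∈ L) →
        ∃ b : Module.Basis (genDegrees p e n → Fin p) F (E0 F p e n),
          ∀ f, b f = (L.map fun a => Φ (gen F p e n a) ^ (f a : ℕ)).prod := by
  classical
  have hfin : Fintype (genDegrees p e n) := (finite_genDegrees he n).fintype
  have hspan := span_ordered_gen_eq_top (F := F) he (Finset.nodup_toList Finset.univ)
    (fun a : genDegrees p e n => Finset.mem_toList.2 (Finset.mem_univ a))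
  have hfin' : Module.Finite F (PowerCommAlg F p e n) :=
    ⟨(Set.finite_range _).toFinset, by rw [Set.Finite.coe_toFinset, hspan]⟩
  have hfin'' : Module.Finite F (E0 F p e n) := Module.Finite.of_surjective Φ.toLinearMap hΦ
  have h1 : Module.finrank F (PowerCommAlg F p e n) ≤ p ^ (e * (n * (n - 1) / 2)) := by
    have := finrank_range_le_card (R := F) (fun f : genDegrees p e n → Fin p =>
      ((Finset.univ : Finset (genDegrees p e n)).toList.map
        fun a => gen F p e n a ^ (f a : ℕ)).prod)
    rwa [Set.finrank, hspan, finrank_top, card_exponents he] at this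
  have h2 := le_finrank_E0 (F := F) (p := p) he n
  have h3 : Module.finrank F (E0 F p e n) ≤ Module.finrank F (PowerCommAlg F p e n) :=
    LinearMap.finrank_le_finrank_of_surjective (f := Φ.toLinearMap) hΦ
  -- The ordered monomials bound the presented algebra from above, the `P(R)` bound `E⁰` from below,
  -- and the surjection connects the two.
  have h4 : Module.finrank F (E0 F p e n) = p ^ (e * (n * (n - 1) / 2)) :=
    le_antisymm (h3.trans h1) h2
  refine ⟨?_, h4, fun L hL hL' => ?_⟩
  · exact (LinearMap.injective_iff_surjective_of_finrank_eq_finrank (f := Φ.toLinearMap)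
      (le_antisymm (h1.trans h2) h3)).2 hΦ
  -- For any order of the generators the monomials span, and their number is the dimension; so they
  -- form a basis.
  · have h5 : ⊤ ≤ Submodule.span F (Set.range fun f : genDegrees p e n → Fin p =>
        (L.map fun a => Φ (gen F p e n a) ^ (f a : ℕ)).prod) := by
      have h6 := congrArg (Submodule.map Φ.toLinearMap) (span_ordered_gen_eq_top (F := F) he hL hL')
      rw [Submodule.map_span, Submodule.map_top, LinearMap.range_eq_top.2 hΦ, ← Set.range_comp] at h6
      rw [← h6]
      refine Submodule.span_mono ?_
      rintro _ ⟨f, rfl⟩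
      refine ⟨f, ?_⟩
      change _ = Φ _
      rw [map_list_prod, List.map_map]
      exact congrArg List.prod (List.map_congr_left fun a _ => (map_pow Φ _ _).symm)
    refine ⟨basisOfTopLeSpanOfCardEqFinrank _ h5 ((card_exponents he n).trans h4.symm), fun f => ?_⟩
    rw [coe_basisOfTopLeSpanOfCardEqFinrank]

end Isomorphism

end SteenrodQ

end

theorem proposition4p1 (p e n : ℕ) [Fact p.Prime] (he : 1 ≤ e) (hn : 1 ≤ n)
    (F : Type*) [Field F] [CharP F p] (hF : Nat.card F = p ^ e) :
    (SteenrodQ.genDegrees p e n).Finite ∧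
    (SteenrodQ.genDegrees p e n).ncard = e * (n * (n - 1) / 2) ∧
    (∀ k : ℕ, SteenrodQ.augIdeal F p e n ^ k =
      ((RingHom.ker (SteenrodQ.aug F (p ^ e))) ^ k).comap (SteenrodQ.subAlg F p e n).val) ∧
    ∃ (P : (ℕ+ →₀ ℕ) → SteenrodQ.SteenrodAlg F (p ^ e)), SteenrodQ.IsMilnorBasis p e P ∧
    ∃ Φ : SteenrodQ.PowerCommAlg F p e n ≃ₐ[F] SteenrodQ.E0 F p e n,
      (∀ (s : ℕ) (t : ℕ+) (h : (s : ℚ) / e + (t : ℕ) < n),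
        ∃ (hmem : P (Finsupp.single t (p ^ s)) ∈ SteenrodQ.subAlg F p e n)
          (hfil : (⟨P (Finsupp.single t (p ^ s)), hmem⟩ : SteenrodQ.subAlg F p e n) ∈
            SteenrodQ.augIdeal F p e n ^ (t : ℕ)),
          Φ (SteenrodQ.gen F p e n ⟨SteenrodQ.atomicNum p e s t, s, t, h, rfl⟩) =
            SteenrodQ.grOf F (t : ℕ) ⟨P (Finsupp.single t (p ^ s)), hmem⟩ hfil) ∧
      (∀ L : List (SteenrodQ.genDegrees p e n), L.Nodup → (∀ a, a ∈ L) →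
        ∃ b : Module.Basis (SteenrodQ.genDegrees p e n → Fin p) F (SteenrodQ.E0 F p e n),
          ∀ f, b f = (L.map fun a => Φ (SteenrodQ.gen F p e n a) ^ (f a : ℕ)).prod) ∧
      Module.finrank F (SteenrodQ.E0 F p e n) = p ^ (e * (n * (n - 1) / 2)) ∧
      Module.finrank F (SteenrodQ.E0 F p e n) = (p ^ e) ^ (n * (n - 1) / 2) := by
  have he' : e ≠ 0 := by omega
  obtain ⟨Φ, hsurj, hΦ⟩ := SteenrodQ.exists_presentation_hom F (p := p) he' n
  obtain ⟨hinj, hrank, hbasis⟩ := SteenrodQ.finrank_E0_and_bases he' n hsurj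
  refine ⟨SteenrodQ.finite_genDegrees he' n, SteenrodQ.ncard_genDegrees he' n,
    SteenrodQ.augIdeal_pow_eq_comap he' n, SteenrodQ.milnorP F p e he',
    SteenrodQ.isMilnorBasis_milnorP he', AlgEquiv.ofBijective Φ ⟨hinj, hsurj⟩, ?_, hbasis, hrank,
    by rw [hrank, pow_mul]⟩
  intro s t h
  have h' := (SteenrodQ.cond_iff he').1 h
  exact ⟨SteenrodQ.milnorP_single_mem he' h', SteenrodQ.milnorP_single_mem_pow he' h', hΦ s t h'⟩
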